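/- Conventions. A compact manifold is a compact Hausdorff smooth manifold $X$, possibly with boundary and corners, of pure dimension; smooth maps and embeddings need not respect boundary or corner strata. For $d$-dimensional compact manifolds $X,Y$, let $\mathrm{emb}(X,Y)$ be the space of smooth embeddings $X\to Y$ with invertible derivative at every point, with the $C^\infty$ topology, and let $\mathrm{Mfld}_d$ be the simplicially enriched category of compact $d$-manifolds with mapping spaces $\mathrm{Sing}\,\mathrm{emb}(X,Y)$. Let $$\mathrm{Mfld}^{\diamond}=\mathrm{colim}\bigl(\mathrm{Mfld}_0\xrightarrow{-\times[-1,1]}\mathrm{Mfld}_1\xrightarrow{-\times[-1,1]}\cdots\bigr)$$ be the simplicially enriched category of thickened compact manifolds. So for $\dim X=d$, $\dim Y=e$, $$\hom_{\mathrm{Mfld}^{\diamond}}(X,Y)=\mathrm{colim}_{d+k=e+l}\ \mathrm{Sing}\,\mathrm{emb}(X\times[-1,1]^k,\,Y\times[-1,1]^l).$$ For $\dim X=d$ let $\mathrm{Fr}_d(X)$ be the frame bundle of $X$ (the principal $GL(d)$-bundle of bases of tangent spaces), and let the stable frame bundle be the topological colimit $$\mathrm{Fr}(X)=\mathrm{colim}_k\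 \mathrm{Fr}_{d+k}(X\times[-1,1]^k)$$ along the maps $\bigl(x;(v_1,\dots,v_n)\bigr)\mapsto\bigl((x,0);(v_1,\dots,v_n,\partial_t)\bigr)$, where $\partial_t$ is the coordinate vector field of the new factor $[-1,1]$. Derivatives of codimension zero embeddings make $X\mapsto\mathrm{Sing}\,\mathrm{Fr}(X)$ a simplicially enriched functor on $\mathrm{Mfld}^{\diamond}$. Proposition. For every compact smooth manifold $X$ (possibly with corners), $\hom_{\mathrm{Mfld}^{\diamond}}(pt,X)$ and $\mathrm{Sing}\,\mathrm{Fr}(X)$ are Kan complexes, and there is a homotopy equivalence of Kan complexes $$\hom_{\mathrm{Mfld}^{\diamond}}(pt,X)\longrightarrow \mathrm{Sing}\,\mathrm{Fr}(X)$$ which is natural in $X\in\mathrm{Mfld}^{\diamond}$, that is, a natural transformation of simplicially enriched functors on $\mathrm{Mfld}^{\diamond}$ (compatible with families of codimension zero embeddings). -/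

import Mathlib

open CategoryTheory MonoidalCategory

noncomputable section

open Opposite Topology
open scoped Manifold ContDiff

namespace ThickMfd

/-- A finite-dimensional smooth manifold with corners `M`, modelled on `H` through the model with
corners `I : H → E`. -/
structure SmoothMfd where
  E : Type
  H : Type
  M : Type
  [instNACG : NormedAddCommGroup E]
  [instNS : NormedSpace ℝ E]
  [instFD : FiniteDimensional ℝ E]
  [instTopH : TopologicalSpace H]
  [instTopM : TopologicalSpace M]
  I : ModelWithCorners ℝ E H
  [instCharted : ChartedSpace H M]
  [instMfd : IsManifold I ∞ M]

attribute [instance] SmoothMfd.instNACG SmoothMfd.instNS SmoothMfd.instFD SmoothMfd.instTopH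
  SmoothMfd.instTopM SmoothMfd.instCharted SmoothMfd.instMfd

namespace SmoothMfd

/-- The product manifold. -/
abbrev prod (X Y : SmoothMfd) : SmoothMfd where
  E := X.E × Y.E
  H := ModelProd X.H Y.H
  M := X.M × Y.M
  I := X.I.prod Y.I

/-- The total space of the tangent bundle, as a manifold. -/
abbrev tangent (X : SmoothMfd) : SmoothMfd where
  E := X.E × X.E
  H := ModelProd X.H X.E
  M := TangentBundle X.I X.M
  I := X.I.tangent

/-- The `k`-fold iterated tangent bundle `T(T(⋯TX))`. -/
def iterTangent : ℕ → SmoothMfd → SmoothMfd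
  | 0, X => X
  | k + 1, X => iterTangent k X.tangent

theorem locallyCompact (X : SmoothMfd) : LocallyCompactSpace X.M :=
  haveI := X.I.locallyCompactSpace
  ChartedSpace.locallyCompactSpace X.H X.M

end SmoothMfd

/-- Smooth (`C^∞`) maps; they need not respect boundary or corner strata. -/
structure SmoothMap (X Y : SmoothMfd) where
  toFun : X.M → Y.M
  smooth : ContMDiff X.I Y.I ∞ toFun

namespace SmoothMap
variable {X Y Z W : SmoothMfd}

@[ext] theorem ext {f g : SmoothMap X Y} (h : ∀ x, f.toFun x = g.toFun x) : f = g := by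
  cases f; cases g; congr; funext x; exact h x

/-- The underlying continuous map. -/
def toC (f : SmoothMap X Y) : C(X.M, Y.M) := ⟨f.toFun, f.smooth.continuous⟩

/-- The identity. -/
def id (X : SmoothMfd) : SmoothMap X X := ⟨fun x => x, contMDiff_id⟩

/-- Composition. -/
def comp (g : SmoothMap Y Z) (f : SmoothMap X Y) : SmoothMap X Z :=
  ⟨fun x => g.toFun (f.toFun x), g.smooth.comp f.smooth⟩

/-- The map `x ↦ (f x, g x)`. -/
def pair (f : SmoothMap X Y) (g : SmoothMap X Z) : SmoothMap X (Y.prod Z) :=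
  ⟨fun x => (f.toFun x, g.toFun x), f.smooth.prodMk g.smooth⟩

/-- First projection. -/
def fst (X Y : SmoothMfd) : SmoothMap (X.prod Y) X := ⟨fun p => p.1, contMDiff_fst⟩
/-- Second projection. -/
def snd (X Y : SmoothMfd) : SmoothMap (X.prod Y) Y := ⟨fun p => p.2, contMDiff_snd⟩

/-- The differential `Tf : TX → TY`. -/
def tangent (f : SmoothMap X Y) : SmoothMap X.tangent Y.tangent :=
  ⟨tangentMap X.I Y.I f.toFun, f.smooth.contMDiff_tangentMap (m := ∞) (by simp)⟩

/-- The `k`-fold iterated differential `T^k f : T^k X → T^k Y`. -/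
def iterTangent : (k : ℕ) → {X Y : SmoothMfd} → SmoothMap X Y →
    SmoothMap (X.iterTangent k) (Y.iterTangent k)
  | 0, _, _, f => f
  | k + 1, _, _, f => iterTangent k f.tangent

theorem mdiff (f : SmoothMap X Y) : MDifferentiable X.I Y.I f.toFun :=
  f.smooth.mdifferentiable (by simp)

theorem tangent_comp (g : SmoothMap Y Z) (f : SmoothMap X Y) :
    (g.comp f).tangent = g.tangent.comp f.tangent := by
  apply SmoothMap.ext
  intro p
  exact congrFun (tangentMap_comp g.mdiff f.mdiff) p

theorem iterTangent_comp (k : ℕ) : ∀ {X Y Z : SmoothMfd} (g : SmoothMap Y Z) (f : SmoothMap X Y),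
    iterTangent k (g.comp f) = (iterTangent k g).comp (iterTangent k f) := by
  induction k with
  | zero => intros; rfl
  | succ k ih =>
    intro X Y Z g f
    change iterTangent k (g.comp f).tangent = _
    rw [tangent_comp, ih]; rfl

/-- The `C^∞` topology: the initial topology for the maps `f ↦ T^k f ∈ C(T^k X, T^k Y)`, `k ≥ 0`,
where `C(T^k X, T^k Y)` carries the compact-open topology (for compact `X` this is the usual Whitney
`C^∞` topology). -/
instance instTopSmoothMap : TopologicalSpace (SmoothMap X Y) :=
  ⨅ k : ℕ, TopologicalSpace.induced (fun f => (iterTangent k f).toC) inferInstance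

theorem continuous_iff {T : Type*} [TopologicalSpace T] {F : T → SmoothMap X Y} :
    Continuous F ↔ ∀ k, Continuous fun t => (iterTangent k (F t)).toC := by
  rw [continuous_iInf_rng]
  simp only [continuous_induced_rng]; rfl

theorem continuous_iterTangent_toC (k : ℕ) :
    Continuous fun f : SmoothMap X Y => (iterTangent k f).toC :=
  continuous_iff.1 continuous_id k

theorem continuous_tangent : Continuous (tangent : SmoothMap X Y → _) :=
  continuous_iff.2 fun k => continuous_iterTangent_toC (k + 1)

theorem continuous_comp :
    Continuous fun p : SmoothMap Y Z × SmoothMap X Y => p.1.comp p.2 := by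
  refine continuous_iff.2 fun k => ?_
  simp only [iterTangent_comp]
  have := (Y.iterTangent k).locallyCompact
  exact ((continuous_iterTangent_toC k).comp continuous_fst).compCM
    ((continuous_iterTangent_toC k).comp continuous_snd)

/-- The canonical smooth map `TX × TY → T(X × Y)`. -/
def tangentProd (X Y : SmoothMfd) : SmoothMap (X.tangent.prod Y.tangent) (X.prod Y).tangent :=
  ⟨(equivTangentBundleProd X.I X.M Y.I Y.M).symm, contMDiff_equivTangentBundleProd_symm⟩

theorem tangent_pair (f : SmoothMap X Y) (g : SmoothMap X Z) :
    (pair f g).tangent = (tangentProd Y Z).comp (pair f.tangent g.tangent) := by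
  apply SmoothMap.ext
  intro p
  change tangentMap X.I (Y.I.prod Z.I) (fun x => (f.toFun x, g.toFun x)) p = _
  simp only [tangentMap, mfderiv_prodMk (f.mdiff p.1) (g.mdiff p.1)]
  rfl

theorem continuous_eval : Continuous fun p : SmoothMap X Y × X.M => p.1.toFun p.2 := by
  have := X.locallyCompact
  exact ContinuousMap.continuous_uncurry_of_continuous
    (⟨fun f : SmoothMap X Y => f.toC, continuous_iterTangent_toC 0⟩ : C(SmoothMap X Y, C(X.M, Y.M)))

theorem continuous_pair : Continuous fun p : SmoothMap X Y × SmoothMap X Z => pair p.1 p.2 := by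
  refine continuous_iff.2 fun k => ?_
  induction k generalizing X Y Z with
  | zero =>
    refine ContinuousMap.continuous_of_continuous_uncurry _ ?_
    change Continuous fun q : (SmoothMap X Y × SmoothMap X Z) × X.M =>
      (q.1.1.toFun q.2, q.1.2.toFun q.2)
    exact (continuous_eval.comp ((continuous_fst.comp continuous_fst).prodMk continuous_snd)).prodMk
      (continuous_eval.comp ((continuous_snd.comp continuous_fst).prodMk continuous_snd))
  | succ k ih =>
    change Continuous fun p : SmoothMap X Y × SmoothMap X Z =>
      (iterTangent k (pair p.1 p.2).tangent).toC
    simp only [tangent_pair, iterTangent_comp]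
    exact (ContinuousMap.continuous_postcomp (iterTangent k (tangentProd Y Z)).toC).comp
      ((ih (X := X.tangent) (Y := Y.tangent) (Z := Z.tangent)).comp
        (continuous_tangent.prodMap continuous_tangent))

/-- The map `f × g`. -/
def prodMap (f : SmoothMap X Y) (g : SmoothMap Z W) : SmoothMap (X.prod Z) (Y.prod W) :=
  pair (f.comp (fst X Z)) (g.comp (snd X Z))

theorem continuous_prodMap_left (g : SmoothMap Z W) :
    Continuous fun f : SmoothMap X Y => prodMap f g := by
  have h : Continuous fun f : SmoothMap X Y => (f.comp (fst X Z), g.comp (snd X Z)) :=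
    (continuous_comp.comp (continuous_id.prodMk continuous_const)).prodMk continuous_const
  exact continuous_pair.comp h

end SmoothMap

/-- A smooth codimension zero embedding: a smooth map which is a topological embedding and whose
differential is an isomorphism at every point. No compatibility with strata is required. -/
structure Emb (X Y : SmoothMfd) extends SmoothMap X Y where
  isEmbedding : IsEmbedding toFun
  bijective_mfderiv : ∀ x, Function.Bijective (mfderiv X.I Y.I toFun x)

namespace Emb
variable {X Y Z W : SmoothMfd}

@[ext] theorem ext {f g : Emb X Y} (h : ∀ x, f.toFun x = g.toFun x) : f = g := by
  cases f; cases g; congr; exact SmoothMap.ext h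

/-- The space of embeddings, with the `C^∞` topology. -/
instance instTopEmb : TopologicalSpace (Emb X Y) := TopologicalSpace.induced Emb.toSmoothMap inferInstance

theorem continuous_toSmoothMap : Continuous (Emb.toSmoothMap : Emb X Y → _) :=
  continuous_induced_dom

/-- The identity embedding. -/
def id (X : SmoothMfd) : Emb X X where
  toSmoothMap := SmoothMap.id X
  isEmbedding := IsEmbedding.id
  bijective_mfderiv x := by
    change Function.Bijective (mfderiv X.I X.I _root_.id x)
    rw [mfderiv_id]; exact Function.bijective_id

/-- Composition of embeddings. -/
def comp (g : Emb Y Z) (f : Emb X Y) : Emb X Z where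
  toSmoothMap := g.toSmoothMap.comp f.toSmoothMap
  isEmbedding := g.isEmbedding.comp f.isEmbedding
  bijective_mfderiv x := by
    change Function.Bijective (mfderiv X.I Z.I (g.toFun ∘ f.toFun) x)
    rw [mfderiv_comp x (g.mdiff _) (f.mdiff _)]
    exact (g.bijective_mfderiv _).comp (f.bijective_mfderiv x)

/-- The embedding `f × g`. -/
def prodMap (f : Emb X Y) (g : Emb Z W) : Emb (X.prod Z) (Y.prod W) where
  toSmoothMap := f.toSmoothMap.prodMap g.toSmoothMap
  isEmbedding := f.isEmbedding.prodMap g.isEmbedding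
  bijective_mfderiv x := by
    change Function.Bijective (mfderiv (X.I.prod Z.I) (Y.I.prod W.I) (Prod.map f.toFun g.toFun) x)
    rw [mfderiv_prodMap (f.mdiff _) (g.mdiff _)]
    exact (f.bijective_mfderiv _).prodMap (g.bijective_mfderiv _)

theorem continuous_comp : Continuous fun p : Emb Y Z × Emb X Y => p.1.comp p.2 :=
  continuous_induced_rng.2 <| SmoothMap.continuous_comp.comp
    (continuous_toSmoothMap.prodMap continuous_toSmoothMap)

theorem continuous_prodMap_left (g : Emb Z W) : Continuous fun f : Emb X Y => f.prodMap g :=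
  continuous_induced_rng.2 <|
    (SmoothMap.continuous_prodMap_left g.toSmoothMap).comp continuous_toSmoothMap

end Emb

instance factNegOneLtOne : Fact ((-1 : ℝ) < 1) := ⟨by norm_num⟩

/-- The interval `[-1,1]`. -/
abbrev interval : SmoothMfd where
  E := EuclideanSpace ℝ (Fin 1)
  H := EuclideanHalfSpace 1
  M := Set.Icc (-1 : ℝ) 1
  I := 𝓡∂ 1

/-- A compact smooth `d`-manifold with corners: a compact Hausdorff space with a smooth atlas in
open subsets of `{v | ∀ i ∈ S, 0 ≤ v i} ⊆ ℝ^d`, for some `S ⊆ {1, …, d}` (in suitable linear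
coordinates on `E`). Such sets are open subsets of octants up to diffeomorphism. -/
structure CornerMfd (d : ℕ) extends SmoothMfd where
  [compact : CompactSpace M]
  [hausdorff : T2Space M]
  octant : ∃ (b : Module.Basis (Fin d) ℝ E) (S : Set (Fin d)),
    Set.range I = {v | ∀ i ∈ S, 0 ≤ b.repr v i}

attribute [instance] CornerMfd.compact CornerMfd.hausdorff

namespace CornerMfd
variable {d e : ℕ}

/-- The thickening `X × [-1,1]`. -/
abbrev thicken (X : CornerMfd d) : CornerMfd (d + 1) where
  toSmoothMfd := X.toSmoothMfd.prod interval
  octant := by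
    obtain ⟨b, S, h⟩ := X.octant
    refine ⟨(b.prod (EuclideanSpace.basisFun (Fin 1) ℝ).toBasis).reindex finSumFinEquiv,
      {i | ∀ j, i = Fin.castSucc j → j ∈ S}, ?_⟩
    rw [ModelWithCorners.range_prod, h, range_modelWithCornersEuclideanHalfSpace]
    ext ⟨v, w⟩
    have e1 : ∀ j : Fin d, finSumFinEquiv.symm (Fin.castSucc j) = (Sum.inl j : Fin d ⊕ Fin 1) :=
      fun j => finSumFinEquiv.symm_apply_eq.2 rfl
    have e2 : finSumFinEquiv.symm (Fin.last d) = (Sum.inr 0 : Fin d ⊕ Fin 1) :=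
      finSumFinEquiv.symm_apply_eq.2 rfl
    simp only [Set.mem_prod, Set.mem_ofPred_eq]
    rw [Fin.forall_fin_succ']
    simp [e1, e2, Module.Basis.prod_repr_inl, Module.Basis.prod_repr_inr,
      (Fin.castSucc_ne_last _).symm]

/-- The `k`-fold thickening `X × [-1,1]^k`. -/
def thick (X : CornerMfd d) : (k : ℕ) → CornerMfd (d + k)
  | 0 => X
  | k + 1 => (thick X k).thicken

end CornerMfd
/-- The point `ℝ^0`. -/
def point : CornerMfd 0 where
  E := EuclideanSpace ℝ (Fin 0)
  H := EuclideanSpace ℝ (Fin 0)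
  M := EuclideanSpace ℝ (Fin 0)
  I := 𝓘(ℝ, EuclideanSpace ℝ (Fin 0))
  compact := Finite.compactSpace
  octant := ⟨(EuclideanSpace.basisFun (Fin 0) ℝ).toBasis, ∅, by simp⟩


/-- The thickening `f × id_{[-1,1]}` of an embedding. -/
def Emb.thicken {d e : ℕ} {X : CornerMfd d} {Y : CornerMfd e}
    (f : Emb X.toSmoothMfd Y.toSmoothMfd) : Emb X.thicken.toSmoothMfd Y.thicken.toSmoothMfd :=
  f.prodMap (Emb.id interval)

/-- Embeddings `X × [-1,1]^k → Y × [-1,1]^l`. -/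
abbrev StageEmb {d e : ℕ} (X : CornerMfd d) (Y : CornerMfd e) (k l : ℕ) : Type :=
  Emb (X.thick k).toSmoothMfd (Y.thick l).toSmoothMfd

namespace StageEmb
variable {d e c : ℕ} {X : CornerMfd d} {Y : CornerMfd e} {Z : CornerMfd c} {k l l' m : ℕ}

/-- `f × id_{[-1,1]}` -/
def thicken (f : StageEmb X Y k l) : StageEmb X Y (k + 1) (l + 1) := Emb.thicken f

theorem continuous_thicken : Continuous (thicken : StageEmb X Y k l → _) :=
  Emb.continuous_prodMap_left _

theorem thicken_comp (g : StageEmb Y Z l m) (f : StageEmb X Y k l) :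
    thicken (X := X) (Y := Z) (g.comp f) = (thicken g).comp (thicken f) := rfl

/-- `f × id_{[-1,1]^j}` -/
def thickenN (f : StageEmb X Y k l) : (j : ℕ) → StageEmb X Y (k + j) (l + j)
  | 0 => f
  | j + 1 => thicken (thickenN f j)

theorem continuous_thickenN (j : ℕ) : Continuous fun f : StageEmb X Y k l => thickenN f j := by
  induction j with
  | zero => exact continuous_id
  | succ j ih => exact continuous_thicken.comp ih

/-- The identity, as an embedding `X × [-1,1]^k → X × [-1,1]^l` when `k = l`. -/
def ofEq (X : CornerMfd d) (h : k = l) : StageEmb X X k l := h ▸ Emb.id _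

theorem thicken_id : thicken (Emb.id (X.thick k).toSmoothMfd : StageEmb X X k k) = Emb.id _ := rfl

theorem thicken_ofEq (h : k = l) :
    thicken (ofEq X h) = ofEq X (by rw [h] : k + 1 = l + 1) := by
  subst h; rfl

theorem ofEq_comp {A : SmoothMfd} (h : k = l) (h' : l = m) (f : Emb A (X.thick k).toSmoothMfd) :
    (ofEq X h').comp ((ofEq X h).comp f) = (ofEq X (h.trans h')).comp f := by
  subst h; subst h'; rfl

theorem thickenN_thicken (f : StageEmb X Y k l) (j : ℕ) :
    (thickenN (thicken f) j).comp (ofEq X (by omega : k + (j + 1) = k + 1 + j)) =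
      (ofEq Y (by omega : l + (j + 1) = l + 1 + j)).comp (thickenN f (j + 1)) := by
  induction j with
  | zero => rfl
  | succ j ih =>
    have h := congrArg (thicken (X := X) (Y := Y) (k := k + (j + 1)) (l := l + 1 + j)) ih
    rw [thicken_comp, thicken_comp, thicken_ofEq, thicken_ofEq] at h
    exact h

/-- The composite of `f : X × [-1,1]^k → Y × [-1,1]^l` and `g : Y × [-1,1]^l' → Z × [-1,1]^m` in the
thickened category: both are thickened until they become composable. -/
def compStage (g : StageEmb Y Z l' m) (f : StageEmb X Y k l) : StageEmb X Z (k + l') (m + l) :=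
  (thickenN g l).comp ((ofEq Y (Nat.add_comm l l')).comp (thickenN f l'))

theorem continuous_compStage : Continuous
    fun p : StageEmb Y Z l' m × StageEmb X Y k l => compStage p.1 p.2 :=
  Emb.continuous_comp.comp <| ((continuous_thickenN l).comp continuous_fst).prodMk <|
    Emb.continuous_comp.comp <| continuous_const.prodMk ((continuous_thickenN l').comp continuous_snd)

theorem thicken_compStage (g : StageEmb Y Z l' m) (f : StageEmb X Y k l) :
    thicken (compStage g f) = (thickenN g (l + 1)).comp
      ((ofEq Y (by omega : l + (l' + 1) = l' + (l + 1))).comp (thickenN f (l' + 1))) := by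
  rw [compStage, thicken_comp, thicken_comp (X := X) (Y := Y) (Z := Y), thicken_ofEq]
  rfl

theorem compStage_thicken_right (g : StageEmb Y Z l' m) (f : StageEmb X Y k l) :
    (compStage g (thicken f)).comp (ofEq X (by omega : k + l' + 1 = k + 1 + l')) =
      thicken (compStage g f) := by
  rw [thicken_compStage]
  change (thickenN g (l + 1)).comp ((ofEq Y _).comp ((thickenN (thicken f) l').comp
    (ofEq X (by omega : k + (l' + 1) = k + 1 + l')))) = _
  rw [thickenN_thicken, ofEq_comp]

theorem compStage_thicken_left (g : StageEmb Y Z l' m) (f : StageEmb X Y k l) :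
    compStage (thicken g) f =
      (ofEq Z (by omega : m + l + 1 = m + 1 + l)).comp (thicken (compStage g f)) := by
  rw [thicken_compStage]
  change _ = ((ofEq Z (by omega : m + (l + 1) = m + 1 + l)).comp (thickenN g (l + 1))).comp
    ((ofEq Y (by omega : l + (l' + 1) = l' + (l + 1))).comp (thickenN f (l' + 1)))
  rw [← thickenN_thicken]
  change _ = (thickenN (thicken g) l).comp ((ofEq Y _).comp ((ofEq Y _).comp (thickenN f (l' + 1))))
  rw [ofEq_comp]
  rfl

/-- Equality of embeddings up to equality of the stages. -/
def Same {k' l'' : ℕ} (f : StageEmb X Y k l) (f' : StageEmb X Y k' l'') : Prop :=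
  k = k' ∧ l = l'' ∧ f ≍ f'

namespace Same
variable {k₁ l₁ m₁ k₂ l₂ : ℕ}

theorem comp_ofEq {f : StageEmb X Y k l} {f' : StageEmb X Y k₁ l₁} (h : Same f f') :
    f'.comp (ofEq X h.1) = (ofEq Y h.2.1).comp f := by
  obtain ⟨rfl, rfl, h⟩ := h
  obtain rfl := eq_of_heq h
  rfl

theorem refl (f : StageEmb X Y k l) : Same f f := ⟨rfl, rfl, HEq.rfl⟩

theorem symm {f : StageEmb X Y k l} {f' : StageEmb X Y k₁ l₁} (h : Same f f') : Same f' f :=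
  ⟨h.1.symm, h.2.1.symm, h.2.2.symm⟩

theorem trans {f : StageEmb X Y k l} {f' : StageEmb X Y k₁ l₁} {f'' : StageEmb X Y k₂ l₂}
    (h : Same f f') (h' : Same f' f'') : Same f f'' :=
  ⟨h.1.trans h'.1, h.2.1.trans h'.2.1, h.2.2.trans h'.2.2⟩

theorem ofEq_left {f : StageEmb X Y k l} {f' : StageEmb X Y k₁ l₁} (h : Same f f') (e : l = m) :
    Same (X := X) (Y := Y) ((ofEq Y e).comp f) f' := by
  subst e; exact h

theorem ofEq_right {f : StageEmb X Y k l} {f' : StageEmb X Y k₁ l₁} (h : Same f f') (e : m = k) :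
    Same (X := X) (Y := Y) (f.comp (ofEq X e)) f' := by
  subst e; exact h

theorem comp {g : StageEmb Y Z l m} {g' : StageEmb Y Z l₁ m₁} (h : Same g g')
    {f : StageEmb X Y k l} {f' : StageEmb X Y k₁ l₁} (h' : Same f f') :
    Same (X := X) (Y := Z) (g.comp f) (g'.comp f') := by
  obtain ⟨rfl, rfl, h⟩ := h
  obtain ⟨rfl, -, h'⟩ := h'
  obtain rfl := eq_of_heq h
  obtain rfl := eq_of_heq h'
  exact refl _

theorem comp_ofEq_comp {g : StageEmb Y Z l m} {g' : StageEmb Y Z l₁ m₁} (h : Same g g')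
    {f : StageEmb X Y k k₂} {f' : StageEmb X Y k₁ l₂} (h' : Same f f') (e : k₂ = l) (e' : l₂ = l₁) :
    Same (X := X) (Y := Z) (g.comp ((ofEq Y e).comp f)) (g'.comp ((ofEq Y e').comp f')) := by
  subst e; subst e'
  exact h.comp h'

theorem thickenN {f : StageEmb X Y k l} {f' : StageEmb X Y k₁ l₁} (h : Same f f') {i j : ℕ}
    (e : i = j) : Same (StageEmb.thickenN f i) (StageEmb.thickenN f' j) := by
  obtain ⟨rfl, rfl, h⟩ := h
  obtain rfl := eq_of_heq h
  subst e; exact refl _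

end Same

theorem thickenN_thickenN (f : StageEmb X Y k l) (i j : ℕ) :
    Same (thickenN (thickenN f i) j) (thickenN f (i + j)) := by
  induction j with
  | zero => exact Same.refl _
  | succ j ih => exact ih.thickenN (rfl : 1 = 1)

theorem thickenN_comp (g : StageEmb Y Z l m) (f : StageEmb X Y k l) (j : ℕ) :
    thickenN (X := X) (Y := Z) (g.comp f) j = (thickenN g j).comp (thickenN f j) := by
  induction j with
  | zero => rfl
  | succ j ih => exact congrArg thicken ih

theorem thickenN_id (j : ℕ) :
    thickenN (X := X) (Y := X) (k := k) (l := k) (Emb.id _) j = Emb.id _ := by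
  induction j with
  | zero => rfl
  | succ j ih => exact congrArg thicken ih

theorem thickenN_ofEq (h : k = l) (j : ℕ) :
    thickenN (ofEq X h) j = ofEq X (by rw [h] : k + j = l + j) := by
  subst h; exact thickenN_id j

theorem compStage_id_right (g : StageEmb Y Z l' m) :
    Same (compStage (k := 0) (l := 0) g (Emb.id _)) g := by
  rw [compStage, thickenN_id]
  exact Same.ofEq_right (Same.refl g) _

theorem compStage_id_left (f : StageEmb X Y k l) :
    Same (compStage (l' := 0) (m := 0) (Emb.id _) f) f := by
  rw [compStage, thickenN_id]
  exact Same.ofEq_left (Same.refl f) (Nat.add_comm l 0)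

theorem compStage_assoc {b p m' : ℕ} {W : CornerMfd b} (h : StageEmb Z W m' p)
    (g : StageEmb Y Z l' m) (f : StageEmb X Y k l) :
    Same (compStage h (compStage g f)) (compStage (compStage h g) f) := by
  simp only [compStage]
  rw [thickenN_comp, thickenN_comp (X := X) (Y := Y) (Z := Y), thickenN_ofEq,
    thickenN_comp (X := Y) (Y := Z) (Z := W), thickenN_comp (X := Y) (Y := Z) (Z := Z),
    thickenN_ofEq]
  exact Same.comp_ofEq_comp (thickenN_thickenN h m l).symm
    (Same.comp_ofEq_comp ((thickenN_thickenN g l m').trans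
      (((Same.refl g).thickenN (Nat.add_comm l m')).trans (thickenN_thickenN g m' l).symm))
      (thickenN_thickenN f l' m') _ _) _ _

end StageEmb

/-- A frame of the `d`-manifold `X`: a point together with `d` linearly independent vectors, that
is, a basis, of the `d`-dimensional tangent space. -/
structure Frame {d : ℕ} (X : CornerMfd d) where
  pt : X.M
  vec : Fin d → TangentSpace X.I pt
  linearIndependent : LinearIndependent ℝ vec

namespace Frame
variable {d e c : ℕ} {X : CornerMfd d} {Y : CornerMfd e} {Z : CornerMfd c}

/-- A frame, as a point of `X` and a `d`-tuple of tangent vectors. -/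
def coords (z : Frame X) : X.M × (Fin d → TangentBundle X.I X.M) := (z.pt, fun i => ⟨z.pt, z.vec i⟩)

theorem coords_injective : Function.Injective (coords : Frame X → _) := by
  rintro ⟨x, v, h⟩ ⟨y, w, h'⟩ hh
  obtain rfl : x = y := congrArg Prod.fst hh
  have : v = w := by
    funext i
    have := congrFun (congrArg Prod.snd hh) i
    simpa [coords] using this
  subst this; rfl

/-- The topology of the frame bundle `Fr_d(X) ⊆ TX ×_X ⋯ ×_X TX`. -/
instance instTopFrame : TopologicalSpace (Frame X) := TopologicalSpace.induced coords inferInstance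

theorem continuous_coords : Continuous (coords : Frame X → _) := continuous_induced_dom

theorem continuous_pt : Continuous (pt : Frame X → X.M) :=
  continuous_fst.comp continuous_coords

theorem continuous_vec (i : Fin d) :
    Continuous fun z : Frame X => (⟨z.pt, z.vec i⟩ : TangentBundle X.I X.M) :=
  (continuous_apply i).comp (continuous_snd.comp continuous_coords)

theorem continuous_mk_iff {T : Type*} [TopologicalSpace T] {F : T → Frame X} :
    Continuous F ↔ Continuous (fun t => (F t).pt) ∧
      ∀ i, Continuous fun t => (⟨(F t).pt, (F t).vec i⟩ : TangentBundle X.I X.M) := by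
  rw [continuous_induced_rng]
  constructor
  · intro h
    exact ⟨continuous_fst.comp h, fun i => (continuous_apply i).comp (continuous_snd.comp h)⟩
  · intro h
    exact h.1.prodMk (continuous_pi h.2)

/-- The map of frame bundles induced by the derivative of a codimension zero embedding. -/
def push (h : d = e) (f : Emb X.toSmoothMfd Y.toSmoothMfd) (z : Frame X) : Frame Y where
  pt := f.toFun z.pt
  vec i := mfderiv X.I Y.I f.toFun z.pt (z.vec (Fin.cast h.symm i))
  linearIndependent :=
    (z.linearIndependent.comp _ (Fin.cast_injective h.symm)).map'
      (mfderiv X.I Y.I f.toFun z.pt).toLinearMap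
      (LinearMap.ker_eq_bot.2 (f.bijective_mfderiv z.pt).1)

theorem push_comp (h : d = e) (h' : e = c) (g : Emb Y.toSmoothMfd Z.toSmoothMfd)
    (f : Emb X.toSmoothMfd Y.toSmoothMfd) (z : Frame X) :
    push h' g (push h f z) = push (h.trans h') (g.comp f) z := by
  apply coords_injective
  refine Prod.ext rfl (funext fun i => ?_)
  have := congrFun (tangentMap_comp g.mdiff f.mdiff)
    ⟨z.pt, z.vec (Fin.cast (h.trans h').symm i)⟩
  exact this.symm

theorem push_id (z : Frame X) : push rfl (Emb.id _) z = z := by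
  apply coords_injective
  refine Prod.ext rfl (funext fun i => ?_)
  exact congrFun (tangentMap_id (I := X.I) (M := X.M)) ⟨z.pt, z.vec i⟩

theorem continuous_push (h : d = e) :
    Continuous fun p : Emb X.toSmoothMfd Y.toSmoothMfd × Frame X => push h p.1 p.2 := by
  refine continuous_mk_iff.2 ⟨?_, fun i => ?_⟩
  · exact SmoothMap.continuous_eval.comp
      ((Emb.continuous_toSmoothMap.comp continuous_fst).prodMk (continuous_pt.comp continuous_snd))
  · exact SmoothMap.continuous_eval.comp
      ((SmoothMap.continuous_tangent.comp (Emb.continuous_toSmoothMap.comp continuous_fst)).prodMk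
        ((continuous_vec (Fin.cast h.symm i)).comp continuous_snd))

/-- The origin of `[-1,1]`. -/
def origin : Set.Icc (-1 : ℝ) 1 := ⟨0, by norm_num⟩

theorem one_ne_zero_origin : (1 : TangentSpace (𝓡∂ 1) origin) ≠ 0 := by
  intro h
  have h1 := mfderiv_subtypeVal_Icc_one origin
  rw [h, map_zero] at h1
  exact zero_ne_one (α := ℝ) h1

/-- The stabilization `Fr_d(X) → Fr_{d+1}(X × [-1,1])` over `x ↦ (x, 0)`, adjoining the coordinate
vector `∂/∂t` of `[-1,1]` as the last vector. (In Mathlib, `1 : TangentSpace (𝓡∂ 1) t` is the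
coordinate vector `∂/∂t`.) -/
def stabilize (z : Frame X) : Frame X.thicken where
  pt := (z.pt, origin)
  vec := Fin.snoc (α := fun _ => TangentSpace X.I z.pt × TangentSpace (𝓡∂ 1) origin)
    (fun i => (z.vec i, 0)) (0, 1)
  linearIndependent := by
    refine (linearIndependent_finSnoc (K := ℝ)
      (V := TangentSpace X.I z.pt × TangentSpace (𝓡∂ 1) origin)).2 ⟨?_, ?_⟩
    · exact z.linearIndependent.map' (LinearMap.inl ℝ (TangentSpace X.I z.pt)
        (TangentSpace (𝓡∂ 1) origin)) (LinearMap.ker_eq_bot.2 LinearMap.inl_injective)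
    · intro hmem
      have hle : Submodule.span ℝ (Set.range fun i =>
          ((z.vec i, 0) : TangentSpace X.I z.pt × TangentSpace (𝓡∂ 1) origin)) ≤
          LinearMap.ker (LinearMap.snd ℝ _ _) := by
        rw [Submodule.span_le]
        rintro _ ⟨i, rfl⟩
        simp
      exact one_ne_zero_origin (by simpa using hle hmem)

theorem stabilize_push (h : d = e) (f : Emb X.toSmoothMfd Y.toSmoothMfd) (z : Frame X) :
    stabilize (push h f z) =
      push (Y := Y.thicken) (congrArg (· + 1) h) f.thicken (stabilize z) := by
  subst h
  apply coords_injective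
  refine Prod.ext rfl (funext fun i => ?_)
  have key : mfderiv (X.I.prod (𝓡∂ 1)) (Y.I.prod (𝓡∂ 1)) (Prod.map f.toFun _root_.id)
      (z.pt, origin) = (mfderiv X.I Y.I f.toFun z.pt).prodMap (.id ℝ _) := by
    rw [mfderiv_prodMap (f.mdiff _) mdifferentiableAt_id, mfderiv_id]
    rfl
  refine congrArg (fun v => (⟨(f.toFun z.pt, origin), v⟩ :
    TangentBundle (Y.I.prod (𝓡∂ 1)) (Y.M × Set.Icc (-1 : ℝ) 1))) ?_
  change _ = mfderiv (X.I.prod (𝓡∂ 1)) (Y.I.prod (𝓡∂ 1)) (Prod.map f.toFun _root_.id)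
      (z.pt, origin) _
  rw [key]
  refine Fin.lastCases ?_ (fun j => ?_) i
  · simp [stabilize]
    exact Prod.ext (map_zero (mfderiv X.I Y.I f.toFun z.pt)).symm rfl
  · simp [stabilize, push]
    exact Prod.ext rfl rfl

theorem continuous_stabilize : Continuous (stabilize : Frame X → _) := by
  have h0 : Continuous fun x : X.M => (⟨x, 0⟩ : TangentBundle X.I X.M) :=
    (Bundle.contMDiff_zeroSection ℝ (TangentSpace X.I) (n := ∞) (IB := X.I)).continuous
  refine continuous_mk_iff.2 ⟨continuous_pt.prodMk continuous_const, fun i => ?_⟩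
  have hT := (SmoothMap.tangentProd X.toSmoothMfd interval).smooth.continuous
  refine Fin.lastCases ?_ (fun j => ?_) i
  · have := hT.comp ((h0.comp continuous_pt).prodMk (continuous_const
      (y := (⟨origin, 1⟩ : TangentBundle (𝓡∂ 1) (Set.Icc (-1 : ℝ) 1)))))
    convert this using 2
    simp [stabilize]
    rfl
  · have := hT.comp ((continuous_vec j).prodMk (continuous_const
      (y := (⟨origin, 0⟩ : TangentBundle (𝓡∂ 1) (Set.Icc (-1 : ℝ) 1)))))
    convert this using 2
    simp [stabilize]
    rfl

end Frame

/-- Objects of the category of thickened compact manifolds, the colimit over `d` of the categories of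
compact `d`-manifolds along `X ↦ X × [-1,1]`: an object is represented by a compact `d`-manifold. -/
structure Thickened where
  dim : ℕ
  mfd : CornerMfd dim

/-- The point. -/
def Thickened.pt : Thickened := ⟨0, point⟩

/-- The singular complex of a space. -/
abbrev sing (A : Type) [TopologicalSpace A] : SSet.{0} := TopCat.toSSet.obj (TopCat.of A)

/-- An `n`-simplex of the singular complex is a continuous map from the standard simplex. -/
def sing.equiv {A : Type} [TopologicalSpace A] {n : SimplexCategoryᵒᵖ} :
    (sing A).obj n ≃ C(stdSimplex ℝ (Fin (n.unop.len + 1)), A) :=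
  TopCat.toSSetObjEquiv (TopCat.of A) n

/-- Functoriality of the singular complex. -/
def sing.map {A B : Type} [TopologicalSpace A] [TopologicalSpace B] (f : A → B) (hf : Continuous f) :
    sing A ⟶ sing B := TopCat.toSSet.map (TopCat.ofHom ⟨f, hf⟩)

theorem sing.equiv_map {A B : Type} [TopologicalSpace A] [TopologicalSpace B] (f : A → B)
    (hf : Continuous f) {n : SimplexCategoryᵒᵖ} (σ : (sing A).obj n) (t) :
    sing.equiv ((sing.map f hf).app n σ) t = f (sing.equiv σ t) := rfl

theorem sing.equiv_restrict {A : Type} [TopologicalSpace A] {n m : SimplexCategoryᵒᵖ} (θ : n ⟶ m)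
   (σ : (sing A).obj n) (t) :
    sing.equiv ((sing A).map θ σ) t = sing.equiv σ (stdSimplex.map θ.unop.toOrderHom t) := by
  rfl


/-- Simplexwise application of a continuous binary operation -/
def sing.map₂ {A B C : Type} [TopologicalSpace A] [TopologicalSpace B] [TopologicalSpace C]
    (f : A × B → C) (hf : Continuous f) {n : SimplexCategoryᵒᵖ} (σ : (sing A).obj n)
    (τ : (sing B).obj n) : (sing C).obj n :=
  sing.equiv.symm ((⟨f, hf⟩ : C(A × B, C)).comp ((sing.equiv σ).prodMk (sing.equiv τ)))

theorem sing.ext {A : Type} [TopologicalSpace A] {n : SimplexCategoryᵒᵖ} {σ τ : (sing A).obj n}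
    (h : ∀ t, sing.equiv σ t = sing.equiv τ t) : σ = τ :=
  sing.equiv.injective (ContinuousMap.ext h)

/-- A representative of an `n`-simplex of the mapping space: an `n`-simplex of the singular complex
of the space of embeddings `X × [-1,1]^k → Y × [-1,1]^l` of manifolds of the same dimension. -/
structure HomRep (X Y : Thickened) (n : SimplexCategoryᵒᵖ) where
  k : ℕ
  l : ℕ
  dim_eq : X.dim + k = Y.dim + l
  σ : (sing (StageEmb X.mfd Y.mfd k l)).obj n

namespace HomRep
variable {X Y Z W : Thickened} {n n' : SimplexCategoryᵒᵖ}

/-- Thickening of representatives. -/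
def thicken (r : HomRep X Y n) : HomRep X Y n :=
  ⟨r.k + 1, r.l + 1, by have := r.dim_eq; omega,
    (sing.map StageEmb.thicken StageEmb.continuous_thicken).app n r.σ⟩

/-- A representative is identified with its thickening. -/
def Step (r r' : HomRep X Y n) : Prop := r' = r.thicken

/-- The simplicial structure maps, on representatives. -/
def restrict (θ : n ⟶ n') (r : HomRep X Y n) : HomRep X Y n' :=
  ⟨r.k, r.l, r.dim_eq, (sing _).map θ r.σ⟩

/-- Composition of representatives. -/
def comp (r : HomRep X Y n) (s : HomRep Y Z n) : HomRep X Z n :=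
  ⟨r.k + s.k, s.l + r.l, by have := r.dim_eq; have := s.dim_eq; omega,
    sing.map₂ _ StageEmb.continuous_compStage s.σ r.σ⟩

theorem eq_of (r r' : HomRep X Y n) (hk : r.k = r'.k) (hl : r.l = r'.l)
    (h : ∀ t, (sing.equiv r'.σ t).comp (StageEmb.ofEq X.mfd hk) =
      (StageEmb.ofEq Y.mfd hl).comp (sing.equiv r.σ t)) : r = r' := by
  obtain ⟨k, l, hd, σ⟩ := r
  obtain ⟨k', l', hd', σ'⟩ := r'
  obtain rfl : k = k' := hk
  obtain rfl : l = l' := hl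
  congr 1
  exact sing.ext fun t => (h t).symm

theorem eq_of' (r r' : HomRep X Y n)
    (h : ∀ t, StageEmb.Same (sing.equiv r.σ t) (sing.equiv r'.σ t)) : r = r' := by
  have t : stdSimplex ℝ (Fin (n.unop.len + 1)) := Classical.arbitrary _
  exact eq_of r r' (h t).1 (h t).2.1 fun t => (h t).comp_ofEq

theorem thicken_comp (r : HomRep X Y n) (s : HomRep Y Z n) :
    r.thicken.comp s = (r.comp s).thicken :=
  (eq_of (r.comp s).thicken (r.thicken.comp s) (by simp only [comp, thicken]; omega) rfl fun t =>
    StageEmb.compStage_thicken_right (sing.equiv s.σ t) (sing.equiv r.σ t)).symm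

theorem comp_thicken (r : HomRep X Y n) (s : HomRep Y Z n) :
    r.comp s.thicken = (r.comp s).thicken :=
  Eq.symm (eq_of (r.comp s).thicken (r.comp s.thicken) rfl
    (by simp only [comp, thicken]; omega) fun t =>
    StageEmb.compStage_thicken_left (sing.equiv s.σ t) (sing.equiv r.σ t))

end HomRep

/-- The mapping space in the category of thickened manifolds: the colimit of the singular complexes of
`Emb(X × [-1,1]^k, Y × [-1,1]^l)`, `dim X + k = dim Y + l`, along the thickening maps. -/
def hom (X Y : Thickened) : SSet.{0} where
  obj n := Quot (HomRep.Step (X := X) (Y := Y) (n := n))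
  map θ := ↾(Quot.map (HomRep.restrict θ) (by rintro r _ rfl; rfl))
  map_id n := by
    ext x
    induction x using Quot.ind with | mk r =>
    exact congrArg (fun σ => Quot.mk _ (⟨r.k, r.l, r.dim_eq, σ⟩ : HomRep X Y n))
      (congrArg (fun f => f r.σ) ((sing _).map_id n))
  map_comp {_ _ p} θ ψ := by
    ext x
    induction x using Quot.ind with | mk r =>
    exact congrArg (fun σ => Quot.mk _ (⟨r.k, r.l, r.dim_eq, σ⟩ : HomRep X Y p))
      (congrArg (fun f => f r.σ) ((sing _).map_comp θ ψ))

/-- The identities. -/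
def hom.id (X : Thickened) : MonoidalCategory.tensorUnit SSet.{0} ⟶ hom X X where
  app n := ↾fun _ => Quot.mk _ ⟨0, 0, rfl, sing.equiv.symm (ContinuousMap.const _ (Emb.id _))⟩
  naturality _ _ _ := rfl

/-- The composition. -/
def hom.comp (X Y Z : Thickened) : hom X Y ⊗ hom Y Z ⟶ hom X Z where
  app n := ↾fun p => Quot.map₂ HomRep.comp
    (by rintro r s _ rfl; exact r.comp_thicken s) (by rintro r _ s rfl; exact r.thicken_comp s)
    p.1 p.2
  naturality _ _ _ := by
    ext ⟨x, y⟩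
    induction x using Quot.ind with | mk r =>
    induction y using Quot.ind with | mk s =>
    rfl

/-- The simplicially enriched category of thickened compact manifolds. -/
instance instEnrichedThickened : EnrichedCategory SSet.{0} Thickened where
  Hom := hom
  id := hom.id
  comp := hom.comp
  id_comp X Y := by
    ext n x
    induction x using Quot.ind with | mk r =>
    refine congrArg (Quot.mk _) ?_
    exact HomRep.eq_of' _ r fun t => StageEmb.compStage_id_right (sing.equiv r.σ t)
  comp_id X Y := by
    ext n x
    induction x using Quot.ind with | mk r =>
    refine congrArg (Quot.mk _) ?_
    exact HomRep.eq_of' _ r fun t => StageEmb.compStage_id_left (sing.equiv r.σ t)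
  assoc X Y Z W := by
    ext n ⟨x, y, z⟩
    induction x using Quot.ind with | mk r =>
    induction y using Quot.ind with | mk s =>
    induction z using Quot.ind with | mk u =>
    refine congrArg (Quot.mk _) ?_
    exact HomRep.eq_of' ((r.comp s).comp u) (r.comp (s.comp u)) fun t =>
      StageEmb.compStage_assoc (sing.equiv u.σ t) (sing.equiv s.σ t) (sing.equiv r.σ t)

/-- The frame bundle of `X × [-1,1]^i`. -/
abbrev StageFrame {d : ℕ} (X : CornerMfd d) (i : ℕ) : Type := Frame (X.thick i)

namespace StageFrame
variable {d e c : ℕ} {X : CornerMfd d} {Y : CornerMfd e} {Z : CornerMfd c} {k l l' m i j : ℕ}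

/-- The stabilization map. -/
def stabilize (z : StageFrame X i) : StageFrame X (i + 1) := Frame.stabilize z

theorem continuous_stabilize : Continuous (stabilize : StageFrame X i → _) :=
  Frame.continuous_stabilize

/-- The `j`-fold stabilization map. -/
def stabilizeN (z : StageFrame X i) : (j : ℕ) → StageFrame X (i + j)
  | 0 => z
  | j + 1 => stabilize (stabilizeN z j)

theorem continuous_stabilizeN (j : ℕ) : Continuous fun z : StageFrame X i => stabilizeN z j := by
  induction j with
  | zero => exact continuous_id
  | succ j ih => exact continuous_stabilize.comp ih

/-- The map of frame bundles induced by an embedding `X × [-1,1]^k → Y × [-1,1]^l`. -/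
def push (h : d + k = e + l) (f : StageEmb X Y k l) (z : StageFrame X k) : StageFrame Y l :=
  Frame.push h f z

theorem stabilize_push (h : d + k = e + l) (f : StageEmb X Y k l) (z : StageFrame X k) :
    stabilize (push h f z) =
      push (by omega : d + (k + 1) = e + (l + 1)) (StageEmb.thicken f) (stabilize z) :=
  Frame.stabilize_push h f z

theorem stabilizeN_stabilize (z : StageFrame X i) (j : ℕ) :
    stabilizeN (stabilize z) j =
      push (by omega) (StageEmb.ofEq X (by omega : i + (j + 1) = i + 1 + j))
        (stabilizeN z (j + 1)) := by
  induction j with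
  | zero => exact (Frame.push_id _).symm
  | succ j ih =>
    have h := congrArg stabilize ih
    rw [stabilize_push, StageEmb.thicken_ofEq] at h
    exact h

end StageFrame

/-- The disjoint union of the frame bundles of the thickenings of `X`. -/
def FrRep (X : Thickened) : Type := Σ i : ℕ, StageFrame X.mfd i

namespace FrRep

instance instTopFrRep (X : Thickened) : TopologicalSpace (FrRep X) :=
  inferInstanceAs (TopologicalSpace (Σ i : ℕ, StageFrame X.mfd i))

/-- A frame is identified with its stabilization. -/
def Step {X : Thickened} (r r' : FrRep X) : Prop := r' = ⟨r.1 + 1, StageFrame.stabilize r.2⟩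

end FrRep

/-- The stable frame bundle `Fr(X)`: the colimit of the frame bundles of `X × [-1,1]^i` along the
stabilization maps, with the colimit topology. -/
def Fr (X : Thickened) : Type := Quot (FrRep.Step (X := X))

instance instTopFr (X : Thickened) : TopologicalSpace (Fr X) := inferInstanceAs (TopologicalSpace (Quot _))

namespace Fr
variable {X Y Z : Thickened}

/-- The class of a frame of `X × [-1,1]^i`. -/
def mk (i : ℕ) (z : StageFrame X.mfd i) : Fr X := Quot.mk _ ⟨i, z⟩

theorem continuous_mk (i : ℕ) : Continuous (mk i : StageFrame X.mfd i → Fr X) :=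
  continuous_quot_mk.comp (continuous_sigmaMk (σ := fun i => StageFrame X.mfd i))

theorem mk_stabilize {i : ℕ} (z : StageFrame X.mfd i) :
    mk (i + 1) (StageFrame.stabilize z) = mk i z :=
  (Quot.sound (r := FrRep.Step (X := X)) (a := ⟨i, z⟩) rfl).symm

theorem mk_push_ofEq {i j : ℕ} (h : i = j) (z : StageFrame X.mfd i) :
    mk j (StageFrame.push (by rw [h]) (StageEmb.ofEq X.mfd h) z) = mk i z := by
  subst h
  exact congrArg (mk i) (Frame.push_id z)

/-- The effect of `map` on representatives. -/
def mapRep {k l : ℕ} (h : X.dim + k = Y.dim + l) (f : StageEmb X.mfd Y.mfd k l) (i : ℕ)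
    (z : StageFrame X.mfd i) : Fr Y :=
  mk (l + i) (StageFrame.push (by omega)
    ((StageEmb.thickenN f i).comp (StageEmb.ofEq X.mfd (Nat.add_comm i k)) :
      StageEmb X.mfd Y.mfd (i + k) (l + i)) (StageFrame.stabilizeN z k))

theorem mapRep_stabilize {k l : ℕ} (h : X.dim + k = Y.dim + l) (f : StageEmb X.mfd Y.mfd k l)
    (i : ℕ) (z : StageFrame X.mfd i) :
    mapRep h f (i + 1) (StageFrame.stabilize z) = mapRep h f i z := by
  rw [mapRep, mapRep, ← mk_stabilize (X := Y) (i := l + i), StageFrame.stabilize_push,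
    StageFrame.stabilizeN_stabilize]
  refine congrArg (mk (l + i + 1)) ((Frame.push_comp _ _ _ _ _).trans ?_)
  rw [StageEmb.thicken_comp (X := X.mfd) (Y := X.mfd) (Z := Y.mfd), StageEmb.thicken_ofEq]
  change Frame.push _ ((StageEmb.thickenN f (i + 1)).comp ((StageEmb.ofEq X.mfd _).comp
    ((StageEmb.ofEq X.mfd _).comp (Emb.id _)))) _ = _
  rw [StageEmb.ofEq_comp]
  rfl

/-- The map `Fr(X) → Fr(Y)` induced by an embedding `X × [-1,1]^k → Y × [-1,1]^l`; on the classes of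
frames of `X × [-1,1]^(k+j)` it is the derivative of the embedding times `[-1,1]^j`, see `map_mk`. -/
def map {k l : ℕ} (h : X.dim + k = Y.dim + l) (f : StageEmb X.mfd Y.mfd k l) : Fr X → Fr Y :=
  Quot.lift (fun r : FrRep X => mapRep h f r.1 r.2)
    (by rintro ⟨i, z⟩ _ rfl; exact (mapRep_stabilize h f i z).symm)

theorem map_thicken {k l : ℕ} (h : X.dim + k = Y.dim + l) (f : StageEmb X.mfd Y.mfd k l) (x : Fr X) :
    map (by omega : X.dim + (k + 1) = Y.dim + (l + 1)) (StageEmb.thicken f) x = map h f x := by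
  induction x using Quot.ind with | mk r =>
  obtain ⟨i, z⟩ := r
  change mapRep (by omega) (StageEmb.thicken f) i z = mapRep h f i z
  rw [mapRep, mapRep, ← mk_stabilize (X := Y) (i := l + i), StageFrame.stabilize_push,
    ← mk_push_ofEq (X := Y) (by omega : l + i + 1 = l + 1 + i)]
  refine congrArg (mk (l + 1 + i)) (Eq.symm ((Frame.push_comp _ _ _ _ _).trans ?_))
  rw [StageEmb.thicken_comp (X := X.mfd) (Y := X.mfd) (Z := Y.mfd), StageEmb.thicken_ofEq]
  change Frame.push _ (((StageEmb.ofEq Y.mfd (by omega : l + (i + 1) = l + 1 + i)).comp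
    (StageEmb.thickenN f (i + 1))).comp (StageEmb.ofEq X.mfd _)) _ = _
  rw [← StageEmb.thickenN_thicken]
  change Frame.push _ ((StageEmb.thickenN (StageEmb.thicken f) i).comp ((StageEmb.ofEq X.mfd _).comp
    ((StageEmb.ofEq X.mfd _).comp (Emb.id _)))) _ = _
  rw [StageEmb.ofEq_comp]
  rfl

theorem stabilizeN_push {k l : ℕ} (h : X.dim + k = Y.dim + l) (f : StageEmb X.mfd Y.mfd k l)
    (z : StageFrame X.mfd k) (j : ℕ) :
    StageFrame.stabilizeN (StageFrame.push h f z) j =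
      StageFrame.push (by omega) (StageEmb.thickenN f j) (StageFrame.stabilizeN z j) := by
  induction j with
  | zero => rfl
  | succ j ih => exact (congrArg StageFrame.stabilize ih).trans (StageFrame.stabilize_push _ _ _)

theorem mk_stabilizeN {i : ℕ} (z : StageFrame X.mfd i) (j : ℕ) :
    mk (i + j) (StageFrame.stabilizeN z j) = mk i z := by
  induction j with
  | zero => rfl
  | succ j ih => exact (mk_stabilize (i := i + j) _).trans ih

theorem mk_push_same {k l k' l' : ℕ} (h : X.dim + k = Y.dim + l) (f : StageEmb X.mfd Y.mfd k l)
    (f' : StageEmb X.mfd Y.mfd k' l') (e : f.Same f') (z : StageFrame X.mfd k) :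
    mk l (StageFrame.push h f z) = mk l' (StageFrame.push (by have := e.1; have := e.2.1; omega)
      (f'.comp (StageEmb.ofEq X.mfd e.1) : StageEmb X.mfd Y.mfd k l') z) := by
  obtain ⟨rfl, rfl, e⟩ := e
  obtain rfl := eq_of_heq e
  rfl

/-- On a class that is represented at a stage `≥ k`, the map `map h f` is computed by the thickened
embedding. -/
theorem map_mk {k l : ℕ} (h : X.dim + k = Y.dim + l) (f : StageEmb X.mfd Y.mfd k l) (j : ℕ)
    (z : StageFrame X.mfd (k + j)) :
    map h f (mk (k + j) z) =
      mk (l + j) (StageFrame.push (by omega) (StageEmb.thickenN f j) z) := by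
  rw [← mk_stabilizeN (X := Y) (i := l + j) _ k, stabilizeN_push]
  exact (mk_push_same _ (StageEmb.thickenN (StageEmb.thickenN f j) k)
    (StageEmb.thickenN f (k + j)) ((StageEmb.thickenN_thickenN f j k).trans
      ((StageEmb.Same.refl f).thickenN (Nat.add_comm j k))) _).symm

theorem exists_mk (x : Fr X) (k : ℕ) : ∃ (j : ℕ) (z : StageFrame X.mfd (k + j)), x = mk (k + j) z := by
  induction x using Quot.ind with | mk r =>
  obtain ⟨i, z⟩ := r
  refine ⟨i, StageFrame.push (by omega) (StageEmb.ofEq X.mfd (Nat.add_comm i k))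
    (StageFrame.stabilizeN z k), ?_⟩
  rw [mk_push_ofEq, mk_stabilizeN]; rfl

theorem map_id (x : Fr X) : map (Y := X) (k := 0) (l := 0) rfl (Emb.id _) x = x := by
  obtain ⟨j, z, rfl⟩ := exists_mk x 0
  rw [map_mk, StageEmb.thickenN_id]
  exact congrArg (mk (0 + j)) (Frame.push_id z)

theorem map_compStage {k l l' m : ℕ} (h : X.dim + k = Y.dim + l) (h' : Y.dim + l' = Z.dim + m)
    (g : StageEmb Y.mfd Z.mfd l' m) (f : StageEmb X.mfd Y.mfd k l) (x : Fr X) :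
    map (by omega : X.dim + (k + l') = Z.dim + (m + l)) (StageEmb.compStage g f) x =
      map h' g (map h f x) := by
  obtain ⟨j, z, rfl⟩ := exists_mk x (k + l')
  rw [map_mk, ← mk_push_ofEq (X := X) (by omega : k + l' + j = k + (l' + j)) z, map_mk,
    ← mk_push_ofEq (X := Y) (by omega : l + (l' + j) = l' + (l + j)), map_mk]
  have e : StageEmb.Same (StageEmb.thickenN (StageEmb.compStage g f) j)
      ((StageEmb.thickenN g (l + j)).comp ((StageEmb.ofEq Y.mfd (by omega)).comp
        (StageEmb.thickenN f (l' + j))) :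
        StageEmb X.mfd Z.mfd (k + (l' + j)) (m + (l + j))) := by
    rw [StageEmb.compStage, StageEmb.thickenN_comp,
      StageEmb.thickenN_comp (X := X.mfd) (Y := Y.mfd) (Z := Y.mfd), StageEmb.thickenN_ofEq]
    exact StageEmb.Same.comp_ofEq_comp (StageEmb.thickenN_thickenN g l j)
      (StageEmb.thickenN_thickenN f l' j) _ _
  refine (mk_push_same _ _ _ e z).trans (congrArg (mk (m + (l + j))) (Eq.symm ?_))
  simp only [StageFrame.push]
  rw [Frame.push_comp, Frame.push_comp, Frame.push_comp]
  rfl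

theorem continuous_mapRep {k l : ℕ} (h : X.dim + k = Y.dim + l) (i : ℕ) :
    Continuous fun p : StageEmb X.mfd Y.mfd k l × StageFrame X.mfd i => mapRep h p.1 i p.2 :=
  (continuous_mk _).comp <| (Frame.continuous_push _).comp <|
    (Emb.continuous_comp.comp (((StageEmb.continuous_thickenN i).comp continuous_fst).prodMk
      continuous_const)).prodMk ((StageFrame.continuous_stabilizeN k).comp continuous_snd)

theorem continuous_map {T : Type} [TopologicalSpace T] [LocallyCompactSpace T] {k l : ℕ}
    (h : X.dim + k = Y.dim + l) (f : C(T, StageEmb X.mfd Y.mfd k l)) :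
    Continuous fun p : T × Fr X => map h (f p.1) p.2 := by
  let G (i : ℕ) : C(StageFrame X.mfd i, C(T, Fr Y)) :=
    ContinuousMap.curry ⟨fun p : StageFrame X.mfd i × T => mapRep h (f p.2) i p.1,
      (continuous_mapRep h i).comp ((f.continuous.comp continuous_snd).prodMk continuous_fst)⟩
  have hq : Continuous fun p : FrRep X × T => map h (f p.2) (Quot.mk _ p.1) :=
    ContinuousMap.continuous_uncurry_of_continuous
      (⟨fun r : FrRep X => G r.1 r.2, continuous_sigma fun i => (G i).continuous⟩ :
        C(FrRep X, C(T, Fr Y)))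
  exact (isQuotientMap_quot_mk (X := FrRep X)).continuous_lift_prod_right
    (g := fun p : T × Fr X => map h (f p.1) p.2) (hq.comp continuous_swap)

/-- The effect of `act` on representatives. -/
def actRep {n : SimplexCategoryᵒᵖ} (s : (sing (Fr X)).obj n) (r : HomRep X Y n) :
    (sing (Fr Y)).obj n :=
  sing.equiv.symm ⟨fun t => map r.dim_eq (sing.equiv r.σ t) (sing.equiv s t),
    (continuous_map r.dim_eq (sing.equiv r.σ)).comp
      (continuous_id.prodMk (sing.equiv s).continuous)⟩

/-- The functoriality of `X ↦ Sing Fr(X)` for families of codimension zero embeddings: the action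
`Sing Fr(X) × hom(X, Y) → Sing Fr(Y)` sends `(s, σ)` to `t ↦ Fr(σ(t))(s(t))`. -/
def act (X Y : Thickened) : sing (Fr X) ⊗ hom X Y ⟶ sing (Fr Y) where
  app n := ↾fun p => Quot.lift (actRep p.1)
    (by rintro r _ rfl; exact sing.ext fun t => (map_thicken r.dim_eq _ _).symm) p.2
  naturality _ _ _ := by
    ext ⟨x, y⟩
    induction y using Quot.ind with | mk r =>
    rfl

theorem act_id (X : Thickened) : (sing (Fr X) ◁ eId SSet.{0} X) ≫ act X X = (ρ_ (sing (Fr X))).hom := by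
  ext n ⟨x, y⟩
  exact sing.ext fun t => map_id (sing.equiv x t)

theorem act_comp (X Y Z : Thickened) :
    (sing (Fr X) ◁ eComp SSet.{0} X Y Z) ≫ act X Z =
      (α_ _ _ _).inv ≫ (act X Y ▷ hom Y Z) ≫ act Y Z := by
  ext n ⟨x, y, z⟩
  induction y using Quot.ind with | mk r =>
  induction z using Quot.ind with | mk s =>
  exact sing.ext fun t => map_compStage r.dim_eq s.dim_eq (sing.equiv s.σ t) (sing.equiv r.σ t)
    (sing.equiv x t)

end Fr

/-- A homotopy equivalence of simplicial sets: a map with a two-sided inverse up to simplicial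
homotopy. -/
def IsHomotopyEquiv {A B : SSet.{0}} (f : A ⟶ B) : Prop :=
  ∃ g : B ⟶ A, Nonempty (SSet.Homotopy (f ≫ g) (𝟙 A)) ∧ Nonempty (SSet.Homotopy (g ≫ f) (𝟙 B))

end ThickMfd

end

open CategoryTheory MonoidalCategory
noncomputable section
open Opposite Topology
open scoped Manifold ContDiff
namespace ThickMfd

/-! The thickenings of the point are the cubes, so `hom(pt, X)` is the colimit over `l` of the
singular complexes of the spaces of embeddings of the cube of dimension `dim X + l` into `X ×
[-1,1]^l`. The comparison map `Fr.ofHom` evaluates the action of embeddings on stable frames at the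
frame of the point, as in the Yoneda lemma. Its naturality is therefore the functoriality of `Fr`;
concretely, it records the derivative at the centre of the cube.

It is an equivalence because an embedded cube is determined, up to contractible choice, by its frame
at the centre: the cube can be shrunk into a chart, and there two embeddings with the same value and
derivative at the centre are joined by linear interpolation, which stays an embedding on a small
enough cube. Since an invertible derivative cannot send the interior centre of the cube to a
boundary point, only frames over interior points occur, and the argument has two halves.

The map from `hom(pt, X)` to the singular complex of the interior frames is a trivial fibration
(`Fr.rlp_ofHomInterior`). A lifting problem against a boundary inclusion lives at a finite stage,
because the boundary is a finite simplicial set and a compact family of stable frames factors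
through a stage (`SeqStep.exists_factor`). At that stage it becomes a lifting problem for continuous
families over the topological simplex, solved by `exists_lift`. The local input is
`Frame.exists_isLocallyLiftable`: near an interior frame, frames can be moved to one another by
self-embeddings of the manifold (`Frame.exists_move`), and families of embeddings with equal frames
are homotopic (`Frame.exists_homotopyWith`).

The interior frames are all of `Fr X` up to homotopy: `exists_push` gives an isotopy from the
identity of `X` into its interior, and squeezing the added cube factors does the same for the
thickenings. `isHomotopyEquiv_of_rlp` combines the halves. The Kan property holds for singular
complexes by retraction onto horns, and passes to `hom(pt, X)` because horns are finite. -/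

/-- A finite-dimensional normed space, as a manifold. -/
abbrev vec (V : Type) [NormedAddCommGroup V] [NormedSpace ℝ V] [FiniteDimensional ℝ V] :
    SmoothMfd where
  E := V
  H := V
  M := V
  I := 𝓘(ℝ, V)

/-! ### Smooth families of maps and their pointwise derivatives. -/

namespace SmoothMap
variable {X Y Z W T : SmoothMfd}

/-- The constant map. -/
def const (X : SmoothMfd) {T : SmoothMfd} (t : T.M) : SmoothMap X T := ⟨fun _ => t, contMDiff_const⟩

theorem tangent_const (t : T.M) :
    (const X t).tangent = const X.tangent (⟨t, 0⟩ : TangentBundle T.I T.M) := by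
  apply SmoothMap.ext
  intro p
  change tangentMap X.I T.I (fun _ => t) p = _
  simp only [tangentMap, mfderiv_const]
  rfl

/-- The differential of a constant map is the constant map at a zero vector, so the induction on the
order passes to the tangent manifolds along the zero section. -/
theorem continuous_const : Continuous (const X : T.M → SmoothMap X T) := by
  refine continuous_iff.2 fun k => ?_
  induction k generalizing X T with
  | zero => exact ContinuousMap.continuous_const'
  | succ k ih =>
    have h0 : Continuous fun x : T.M => (⟨x, 0⟩ : TangentBundle T.I T.M) :=
      (Bundle.contMDiff_zeroSection ℝ (TangentSpace T.I) (n := ∞) (IB := T.I)).continuous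
    change Continuous fun t : T.M => (iterTangent k (const X t).tangent).toC
    simp only [tangent_const]
    exact (ih (X := X.tangent) (T := T.tangent)).comp h0

/-- The member of a smooth family of maps at a parameter. -/
def slice (G : SmoothMap (T.prod X) Y) (t : T.M) : SmoothMap X Y := G.comp (pair (const X t) (id X))

/-- The source of continuity for the explicit families below: one smooth map on the product with the
parameter manifold replaces estimates in the `C^∞` topology. -/
theorem continuous_slice (G : SmoothMap (T.prod X) Y) : Continuous G.slice :=
  continuous_comp.comp (_root_.continuous_const.prodMk
    (continuous_pair.comp (continuous_const.prodMk _root_.continuous_const)))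

theorem continuous_comp_left (g : SmoothMap Y Z) : Continuous fun f : SmoothMap X Y => g.comp f :=
  continuous_comp.comp (_root_.continuous_const.prodMk continuous_id)

theorem continuous_comp_right (f : SmoothMap X Y) : Continuous fun g : SmoothMap Y Z => g.comp f :=
  continuous_comp.comp (continuous_id.prodMk _root_.continuous_const)

theorem continuous_prodMap :
    Continuous fun p : SmoothMap X Y × SmoothMap Z W => prodMap p.1 p.2 :=
  continuous_pair.comp (((continuous_comp_right (fst X Z)).comp continuous_fst).prodMk
    ((continuous_comp_right (snd X Z)).comp continuous_snd))

/-- The derivative of a smooth map at a point, as a linear map of the model vector spaces. -/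
def D (f : SmoothMap X Y) (x : X.M) : X.E →L[ℝ] Y.E := mfderiv X.I Y.I f.toFun x

theorem D_comp (g : SmoothMap Y Z) (f : SmoothMap X Y) (x : X.M) :
    (g.comp f).D x = (g.D (f.toFun x)).comp (f.D x) :=
  mfderiv_comp x (g.mdiff _) (f.mdiff x)

theorem D_comp_apply (g : SmoothMap Y Z) (f : SmoothMap X Y) (x : X.M) (v : X.E) :
    (g.comp f).D x v = g.D (f.toFun x) (f.D x v) := by rw [D_comp]; rfl

theorem D_id (x : X.M) (v : X.E) : (id X).D x v = v :=
  DFunLike.congr_fun (mfderiv_id (I := X.I) (x := x)) v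

theorem D_pair (f : SmoothMap X Y) (g : SmoothMap X Z) (x : X.M) (v : X.E) :
    (pair f g).D x v = (f.D x v, g.D x v) :=
  DFunLike.congr_fun (mfderiv_prodMk (f.mdiff x) (g.mdiff x)) v

theorem D_fst (p : (X.prod Y).M) (v : (X.prod Y).E) : (fst X Y).D p v = v.1 :=
  DFunLike.congr_fun (mfderiv_fst (I := X.I) (I' := Y.I)) v

theorem D_snd (p : (X.prod Y).M) (v : (X.prod Y).E) : (snd X Y).D p v = v.2 :=
  DFunLike.congr_fun (mfderiv_snd (I := X.I) (I' := Y.I)) v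

theorem D_prodMap (f : SmoothMap X Y) (g : SmoothMap Z W) (p : (X.prod Z).M)
    (v : (X.prod Z).E) : (prodMap f g).D p v = (f.D p.1 v.1, g.D p.2 v.2) := by
  rw [prodMap, D_pair, D_comp_apply, D_comp_apply, D_fst, D_snd]; rfl

theorem D_congr {f g : SmoothMap X Y} {x : X.M} (h : f.toFun =ᶠ[𝓝 x] g.toFun) : f.D x = g.D x :=
  h.mfderiv_eq

section vec
variable {V E : Type} [NormedAddCommGroup V] [NormedSpace ℝ V] [FiniteDimensional ℝ V]
  [NormedAddCommGroup E] [NormedSpace ℝ E] [FiniteDimensional ℝ E]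

/-- The tangent bundle of a vector space is a product, so the fibre coordinate of `f.tangent` can be
read off continuously. -/
theorem continuous_D_apply : Continuous fun p : SmoothMap X (vec E) × TangentBundle X.I X.M =>
    (p.1.D p.2.1 p.2.2 : E) := by
  have h : Continuous fun p : SmoothMap X (vec E) × TangentBundle X.I X.M =>
      p.1.tangent.toFun p.2 :=
    continuous_eval.comp ((continuous_tangent.comp continuous_fst).prodMk continuous_snd)
  have h2 := continuous_snd.comp ((tangentBundleModelSpaceHomeomorph 𝓘(ℝ, E)).continuous.comp h)
  exact h2.congr fun p => by
    simp [tangentBundleModelSpaceHomeomorph_coe, tangent, tangentMap]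
    rfl

theorem D_eq_fderiv (f : SmoothMap (vec V) (vec E)) (v : V) : f.D v = fderiv ℝ f.toFun v :=
  mfderiv_eq_fderiv

theorem contDiff (f : SmoothMap (vec V) (vec E)) : ContDiff ℝ ∞ f.toFun := f.smooth.contDiff

theorem continuous_fderiv : Continuous fun p : SmoothMap (vec V) (vec E) × V =>
    fderiv ℝ p.1.toFun p.2 := by
  refine continuous_clm_apply.2 fun w => ?_
  have h0 : Continuous fun v : V => (⟨v, w⟩ : TangentBundle 𝓘(ℝ, V) V) :=
    (tangentBundleModelSpaceHomeomorph 𝓘(ℝ, V)).symm.continuous.comp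
      (continuous_id.prodMk _root_.continuous_const)
  have := (continuous_D_apply (X := vec V) (E := E)).comp
    (continuous_fst.prodMk (h0.comp continuous_snd))
  refine this.congr fun p => ?_
  simp only [D, mfderiv_eq_fderiv]
  rfl

/-- A smooth map of normed spaces. -/
def ofContDiff (f : V → E) (hf : ContDiff ℝ ∞ f) : SmoothMap (vec V) (vec E) := ⟨f, hf.contMDiff⟩

end vec
end SmoothMap

namespace CornerMfd
variable {d : ℕ}

theorem finrank_E (X : CornerMfd d) : Module.finrank ℝ X.E = d := by
  obtain ⟨b, -, -⟩ := X.octant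
  simpa using Module.finrank_eq_card_basis b

end CornerMfd

namespace Emb
variable {X Y Z W : SmoothMfd}

/-- An injective immersion of compact manifolds of the same dimension. -/
def ofInjective {d e : ℕ} (h : d = e) {X : CornerMfd d} {Y : CornerMfd e}
    (f : SmoothMap X.toSmoothMfd Y.toSmoothMfd) (hf : Function.Injective f.toFun)
    (hf' : ∀ x, Function.Injective (f.D x)) :
    Emb X.toSmoothMfd Y.toSmoothMfd where
  toSmoothMap := f
  isEmbedding := (f.smooth.continuous.isClosedEmbedding hf).isEmbedding
  bijective_mfderiv x := by
    have hd : Module.finrank ℝ X.E = Module.finrank ℝ Y.E := by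
      rw [X.finrank_E, Y.finrank_E, h]
    exact ⟨hf' x, (LinearMap.injective_iff_surjective_of_finrank_eq_finrank (K := ℝ) (V := X.E)
      (V₂ := Y.E) (f := (f.D x).toLinearMap) hd).1 (hf' x)⟩

theorem D_bijective (f : Emb X Y) (x : X.M) : Function.Bijective (f.toSmoothMap.D x) :=
  f.bijective_mfderiv x

theorem D_injective (f : Emb X Y) (x : X.M) : Function.Injective (f.toSmoothMap.D x) :=
  (f.D_bijective x).1

theorem continuous_iff {T : Type*} [TopologicalSpace T] {F : T → Emb X Y} :
    Continuous F ↔ Continuous fun t => (F t).toSmoothMap := continuous_induced_rng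

theorem continuous_prodMap :
    Continuous fun p : Emb X Y × Emb Z W => p.1.prodMap p.2 :=
  continuous_induced_rng.2 <| SmoothMap.continuous_prodMap.comp
    (continuous_toSmoothMap.prodMap continuous_toSmoothMap)

/-- Embeddings need not respect strata, but a surjective derivative rules out that an interior point
lands on the boundary. The converse fails, and this asymmetry is why interior frames are treated
separately. -/
theorem isInteriorPoint (f : Emb X Y) {x : X.M} (hx : X.I.IsInteriorPoint x) :
    Y.I.IsInteriorPoint (f.toFun x) :=
  (f.mdiff x).isInteriorPoint_of_surjective_mfderiv (f.bijective_mfderiv x).2 hx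

end Emb

namespace Frame
variable {d e : ℕ} {X : CornerMfd d} {Y : CornerMfd e}

/-- The vectors of a frame, in the model vector space. -/
def v (z : Frame X) (i : Fin d) : X.E := z.vec i

theorem ext' {z w : Frame X} (h : z.pt = w.pt) (h' : ∀ i, z.v i = w.v i) : z = w := by
  obtain ⟨x, v, hv⟩ := z
  obtain ⟨y, u, hu⟩ := w
  obtain rfl : x = y := h
  obtain rfl : v = u := funext h'
  rfl

theorem push_v (h : d = e) (f : Emb X.toSmoothMfd Y.toSmoothMfd) (z : Frame X) (i : Fin e) :
    (push h f z).v i = f.toSmoothMap.D z.pt (z.v (Fin.cast h.symm i)) := rfl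

theorem linearIndependent_v (z : Frame X) : LinearIndependent ℝ z.v := z.linearIndependent

theorem stabilize_v_castSucc (z : Frame X) (i : Fin d) :
    (stabilize z).v i.castSucc = (z.v i, 0) := by
  simp only [v, stabilize, Fin.snoc_castSucc]
  rfl

/-- The coordinate vector of `[-1,1]`. -/
def unitVec : interval.E := (1 : TangentSpace (𝓡∂ 1) origin)

theorem stabilize_v_last (z : Frame X) :
    (stabilize z).v (Fin.last d) = (0, unitVec) := by
  simp only [v, stabilize, Fin.snoc_last]
  rfl

end Frame

/-! ### Squeezing the interval and the cube. -/

/-- The contraction `t ↦ t / √(1 + r²t²)`. -/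
def squeeze (r t : ℝ) : ℝ := t / √(1 + r ^ 2 * t ^ 2)

namespace squeeze

theorem pos (r t : ℝ) : 0 < 1 + r ^ 2 * t ^ 2 := by positivity

theorem contDiff : ContDiff ℝ ∞ fun p : ℝ × ℝ => squeeze p.1 p.2 := by
  unfold squeeze
  refine ContDiff.div contDiff_snd (ContDiff.sqrt (by fun_prop) fun p => (pos _ _).ne') fun p => ?_
  exact (Real.sqrt_pos.2 (pos _ _)).ne'

theorem contDiff_right (r : ℝ) : ContDiff ℝ ∞ (squeeze r) :=
  contDiff.comp (contDiff_const.prodMk contDiff_id)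

@[simp] theorem zero_left (t : ℝ) : squeeze 0 t = t := by simp [squeeze]

@[simp] theorem zero_right (r : ℝ) : squeeze r 0 = 0 := by simp [squeeze]

theorem abs_eq (r t : ℝ) : |squeeze r t| = |t| / √(1 + r ^ 2 * t ^ 2) := by
  rw [squeeze, abs_div, abs_of_pos (Real.sqrt_pos.2 (pos _ _))]

theorem abs_le (r t : ℝ) : |squeeze r t| ≤ |t| := by
  rw [abs_eq]
  refine div_le_self (abs_nonneg t) ?_
  rw [Real.one_le_sqrt]
  nlinarith [sq_nonneg (r * t)]

/-- The whole line is squeezed to size less than `1 / |r|`, so a large parameter brings a cube into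
any given neighbourhood of the centre. -/
theorem mul_abs_lt (r t : ℝ) : |r| * |squeeze r t| < 1 := by
  rw [abs_eq, ← mul_div_assoc, div_lt_one (Real.sqrt_pos.2 (pos _ _)), ← abs_mul]
  refine Real.lt_sqrt_of_sq_lt ?_
  rw [sq_abs]; nlinarith

theorem abs_lt_one {t : ℝ} (ht : |t| ≤ 1) {r : ℝ} (hr : r ≠ 0) : |squeeze r t| < 1 := by
  rw [abs_eq, div_lt_one (Real.sqrt_pos.2 (pos _ _))]
  refine Real.lt_sqrt_of_sq_lt ?_
  rw [sq_abs]
  have h1 : t ^ 2 ≤ 1 := by rw [← sq_abs]; nlinarith [abs_nonneg t]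
  rcases eq_or_ne t 0 with rfl | h
  · simp
  · have : 0 < r ^ 2 * t ^ 2 := by positivity
    linarith

/-- Away from zero, squeezing adds `r²` to `1 / t²`, so parameters compose by adding squares.
Passing to coordinates and back is thus again a squeeze, joined to the identity by letting its
parameter go to zero. -/
theorem one_squeeze (r t : ℝ) : squeeze 1 (squeeze r t) = squeeze √(1 + r ^ 2) t := by
  have hp := pos r t
  have h1 : 1 + 1 ^ 2 * (squeeze r t) ^ 2 =
      (1 + (√(1 + r ^ 2)) ^ 2 * t ^ 2) / (1 + r ^ 2 * t ^ 2) := by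
    rw [squeeze, div_pow, Real.sq_sqrt hp.le, Real.sq_sqrt (by positivity)]
    field_simp
    ring
  rw [squeeze, h1, Real.sqrt_div' _ hp.le, squeeze, squeeze]
  have := (Real.sqrt_pos.2 hp).ne'
  field_simp

theorem hasDerivAt (r t : ℝ) :
    HasDerivAt (squeeze r) (1 / ((1 + r ^ 2 * t ^ 2) * √(1 + r ^ 2 * t ^ 2))) t := by
  have hp := pos r t
  have h1 : HasDerivAt (fun t : ℝ => 1 + r ^ 2 * t ^ 2) (r ^ 2 * (2 * t)) t := by
    simpa using ((hasDerivAt_pow 2 t).const_mul (r ^ 2)).const_add 1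
  have h2 := (hasDerivAt_id t).div (h1.sqrt hp.ne') (Real.sqrt_pos.2 hp).ne'
  refine h2.congr_deriv ?_
  have h3 := (Real.sqrt_pos.2 hp).ne'
  have h4 := Real.sq_sqrt hp.le
  simp only [_root_.id]
  field_simp
  rw [h4]
  ring

theorem hasDerivAt_zero (r : ℝ) : HasDerivAt (squeeze r) 1 0 := by
  simpa using hasDerivAt r 0

theorem strictMono (r : ℝ) : StrictMono (squeeze r) := by
  refine strictMono_of_deriv_pos fun t => ?_
  rw [(hasDerivAt r t).deriv]
  have := pos r t
  positivity

end squeeze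

section interval

/-- The inclusion `[-1,1] → ℝ`. -/
def intervalVal : SmoothMap interval (vec ℝ) := ⟨Subtype.val, contMDiff_subtypeVal_Icc⟩

theorem D_intervalVal_one (z : Set.Icc (-1 : ℝ) 1) :
    intervalVal.D z (1 : TangentSpace (𝓡∂ 1) z) = (1 : ℝ) :=
  mfderiv_subtypeVal_Icc_one z

theorem D_intervalVal_unitVec : intervalVal.D Frame.origin Frame.unitVec = (1 : ℝ) :=
  D_intervalVal_one Frame.origin

theorem finrank_interval : Module.finrank ℝ interval.E = 1 :=
  finrank_euclideanSpace_fin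

theorem D_intervalVal_injective (z : interval.M) : Function.Injective (intervalVal.D z) := by
  have hs : Function.Surjective (intervalVal.D z).toLinearMap := by
    intro c
    refine ⟨(c : ℝ) • (show interval.E from (1 : TangentSpace (𝓡∂ 1) z)), ?_⟩
    refine (map_smul (intervalVal.D z) (c : ℝ) _).trans ?_
    exact (congrArg (c • ·) (D_intervalVal_one z)).trans (mul_one (c : ℝ))
  exact (LinearMap.injective_iff_surjective_of_finrank_eq_finrank
    (finrank_interval.trans (Module.finrank_self ℝ).symm)).2 hs

/-- The map `t ↦ t / √(1 + r²t²)` of `ℝ`. -/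
def squeezeReal (r : ℝ) : SmoothMap (vec ℝ) (vec ℝ) :=
  SmoothMap.ofContDiff (squeeze r) (squeeze.contDiff_right r)

theorem D_squeezeReal (r t v : ℝ) : (squeezeReal r).D t v =
    v * (1 / ((1 + r ^ 2 * t ^ 2) * √(1 + r ^ 2 * t ^ 2))) := by
  rw [SmoothMap.D_eq_fderiv]
  exact DFunLike.congr_fun (squeeze.hasDerivAt r t).hasFDerivAt.fderiv v

theorem D_squeezeReal_zero (r v : ℝ) : (squeezeReal r).D (0 : ℝ) v = v := by
  rw [D_squeezeReal]; simp

theorem D_squeezeReal_injective (r t : ℝ) : Function.Injective ((squeezeReal r).D t) := by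
  refine (injective_iff_map_eq_zero _).2 fun v hv => ?_
  rw [D_squeezeReal] at hv
  exact (mul_eq_zero.1 hv).resolve_right (by have := squeeze.pos r t; positivity)

/-- The family of maps `t ↦ t / √(1 + s²t²)`, `s ∈ ℝ`, of `[-1,1]`. -/
def squeezeMap : SmoothMap ((vec ℝ).prod interval) interval where
  toFun p := ⟨squeeze p.1 p.2.1, abs_le.1 ((squeeze.abs_le _ _).trans (abs_le.2 p.2.2))⟩
  smooth := by
    rw [contMDiff_iff_comp_subtypeVal_Icc]
    refine ⟨?_, ?_⟩
    · refine Continuous.subtype_mk ?_ _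
      exact squeeze.contDiff.continuous.comp
        (continuous_fst.prodMk (continuous_subtype_val.comp continuous_snd))
    · exact squeeze.contDiff.contMDiff.comp
        (contMDiff_fst.prodMk_space (contMDiff_subtypeVal_Icc.comp contMDiff_snd))

theorem intervalVal_comp_squeezeMap (s : ℝ) :
    intervalVal.comp (squeezeMap.slice s) = (squeezeReal s).comp intervalVal := rfl

theorem D_intervalVal_D_squeezeMap (s : ℝ) (t : interval.M) (v : interval.E) :
    intervalVal.D ((squeezeMap.slice s).toFun t) ((squeezeMap.slice s).D t v) =
      (squeezeReal s).D t.1 (intervalVal.D t v) := by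
  rw [← SmoothMap.D_comp_apply, intervalVal_comp_squeezeMap, SmoothMap.D_comp_apply]
  rfl

/-- The map `t ↦ t / √(1 + s²t²)` of `[-1,1]`. -/
def squeezeEmb (s : ℝ) : Emb interval interval where
  toSmoothMap := squeezeMap.slice s
  isEmbedding := by
    refine ((squeezeMap.slice s).smooth.continuous.isClosedEmbedding fun a b h => ?_).isEmbedding
    exact Subtype.ext ((squeeze.strictMono s).injective (congrArg Subtype.val h))
  bijective_mfderiv t := by
    have hi : Function.Injective ((squeezeMap.slice s).D t) := by
      refine (injective_iff_map_eq_zero _).2 fun v hv => ?_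
      have h := D_intervalVal_D_squeezeMap s t v
      rw [hv, map_zero] at h
      exact (injective_iff_map_eq_zero _).1 (D_intervalVal_injective t) v
        ((injective_iff_map_eq_zero _).1 (D_squeezeReal_injective s t.1) _ h.symm)
    exact ⟨hi, (LinearMap.injective_iff_surjective
      (f := ((squeezeMap.slice s).D t).toLinearMap)).1 hi⟩

theorem continuous_squeezeEmb : Continuous squeezeEmb :=
  Emb.continuous_iff.2 squeezeMap.continuous_slice

theorem squeezeEmb_zero : squeezeEmb 0 = Emb.id interval :=
  Emb.ext fun t => Subtype.ext (squeeze.zero_left t.1)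

theorem squeezeEmb_origin (s : ℝ) : (squeezeEmb s).toFun Frame.origin = Frame.origin :=
  Subtype.ext (squeeze.zero_right s)

theorem D_squeezeEmb_origin (s : ℝ) (v : interval.E) :
    (squeezeEmb s).toSmoothMap.D Frame.origin v = v := by
  have h := D_intervalVal_D_squeezeMap s Frame.origin v
  have h1 : (squeezeMap.slice s).toFun Frame.origin = Frame.origin := squeezeEmb_origin s
  rw [h1] at h
  exact D_intervalVal_injective Frame.origin (h.trans (D_squeezeReal_zero s _))

theorem isInteriorPoint_squeezeEmb {s : ℝ} (hs : s ≠ 0) (t : interval.M) :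
    interval.I.IsInteriorPoint ((squeezeEmb s).toFun t) := by
  refine Icc_isInteriorPoint_interior ?_
  exact abs_lt.1 (squeeze.abs_lt_one (abs_le.2 t.2) hs)

/-- The map `v ↦ v / √(1 + v²)` from `ℝ` to `[-1,1]`. -/
def intervalMap : SmoothMap (vec ℝ) interval where
  toFun v := ⟨squeeze 1 v, abs_le.1 (by simpa using (squeeze.mul_abs_lt 1 v).le)⟩
  smooth := by
    rw [contMDiff_iff_comp_subtypeVal_Icc]
    exact ⟨(squeeze.contDiff_right 1).continuous.subtype_mk _,
      (squeeze.contDiff_right 1).contMDiff⟩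

theorem intervalMap_zero : intervalMap.toFun (0 : ℝ) = Frame.origin :=
  Subtype.ext (squeeze.zero_right 1)

theorem D_intervalMap_zero : intervalMap.D (0 : ℝ) (1 : ℝ) = Frame.unitVec := by
  have h : intervalVal.comp intervalMap = squeezeReal 1 := rfl
  have h1 := intervalVal.D_comp_apply intervalMap (0 : ℝ) (1 : ℝ)
  rw [h, D_squeezeReal_zero, intervalMap_zero] at h1
  exact D_intervalVal_injective Frame.origin (h1.symm.trans D_intervalVal_unitVec.symm)

/-- The map `t ↦ t / √(1 + r²t²)` from `[-1,1]` to `ℝ`. -/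
def intervalCoord (r : ℝ) : SmoothMap interval (vec ℝ) := (squeezeReal r).comp intervalVal

theorem intervalMap_intervalCoord (r : ℝ) :
    intervalMap.comp (intervalCoord r) = (squeezeEmb √(1 + r ^ 2)).toSmoothMap :=
  SmoothMap.ext fun t => Subtype.ext (squeeze.one_squeeze r t.1)

end interval

/-- The cube `[-1,1]^n`. -/
abbrev cube (n : ℕ) : CornerMfd (0 + n) := point.thick n

/-- The coordinate space of the cube. -/
abbrev CubeVec (n : ℕ) : Type := Fin (0 + n) → ℝ

/-- The map `(q, t) ↦ (q / √(1 + s²q²), t / √(1 + s²t²))` of the cube. -/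
def shrink : (n : ℕ) → ℝ → Emb (cube n).toSmoothMfd (cube n).toSmoothMfd
  | 0, _ => Emb.id _
  | n + 1, s => (shrink n s).prodMap (squeezeEmb s)

theorem continuous_shrink (n : ℕ) : Continuous (shrink n) := by
  induction n with
  | zero => exact continuous_const
  | succ n ih => exact Emb.continuous_prodMap.comp (ih.prodMk continuous_squeezeEmb)

theorem shrink_zero (n : ℕ) : shrink n 0 = Emb.id _ := by
  induction n with
  | zero => rfl
  | succ n ih => rw [shrink, ih, squeezeEmb_zero]; rfl

/-- The smooth map `v ↦ v / √(1 + v²)` onto the interior of the cube. -/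
def cubeMap : (n : ℕ) → SmoothMap (vec (CubeVec n)) (cube n).toSmoothMfd
  | 0 => SmoothMap.const _ (0 : EuclideanSpace ℝ (Fin 0))
  | n + 1 => SmoothMap.pair
      ((cubeMap n).comp (SmoothMap.ofContDiff (fun v : CubeVec (n + 1) => Fin.init v) (by
        exact contDiff_pi.2 fun i => contDiff_apply ℝ ℝ i.castSucc)))
      (intervalMap.comp (SmoothMap.ofContDiff (fun v : CubeVec (n + 1) => v (Fin.last (0 + n)))
        (contDiff_apply ℝ ℝ _)))

/-- Appending a coordinate. -/
def snocMap (n : ℕ) : SmoothMap ((vec (Fin n → ℝ)).prod (vec ℝ)) (vec (Fin (n + 1) → ℝ)) where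
  toFun p := Fin.snoc (α := fun _ => ℝ) p.1 p.2
  smooth := by
    refine contMDiff_pi_space.2 fun i => ?_
    refine Fin.lastCases ?_ (fun j => ?_) i
    · simpa using contMDiff_snd
    · simp only [Fin.snoc_castSucc]
      exact (contDiff_apply ℝ ℝ j).contMDiff.comp
        (contMDiff_fst (I := 𝓘(ℝ, Fin n → ℝ)) (J := 𝓘(ℝ, ℝ)))

/-- The map `q ↦ q / √(1 + r²q²)` from the cube to its coordinate space. -/
def cubeCoord (r : ℝ) : (n : ℕ) → SmoothMap (cube n).toSmoothMfd (vec (CubeVec n))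
  | 0 => SmoothMap.const _ (0 : CubeVec 0)
  | n + 1 => (snocMap (0 + n)).comp ((cubeCoord r n).prodMap (intervalCoord r))

/-- The coordinatewise form of `squeeze.one_squeeze`. It lets `cubeCoord` inherit injectivity, also
of its derivatives, from the embedding `shrink`, and identifies the ends of the linear homotopy in
`Frame.exists_homotopyWith`. -/
theorem cubeMap_comp_cubeCoord (r : ℝ) (n : ℕ) :
    (cubeMap n).comp (cubeCoord r n) = (shrink n √(1 + r ^ 2)).toSmoothMap := by
  induction n with
  | zero => exact SmoothMap.ext fun x => Subsingleton.elim (α := EuclideanSpace ℝ (Fin 0)) _ _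
  | succ n ih =>
    refine SmoothMap.ext fun x => Prod.ext ?_ ?_
    · refine Eq.trans ?_ (congrArg (fun f => f.toFun x.1) ih)
      change (cubeMap n).toFun (Fin.init (Fin.snoc (α := fun _ => ℝ)
        ((cubeCoord r n).toFun x.1) ((intervalCoord r).toFun x.2))) = _
      rw [Fin.init_snoc]; rfl
    · refine Eq.trans ?_ (congrArg (fun f => f.toFun x.2) (intervalMap_intervalCoord r))
      change intervalMap.toFun (Fin.snoc (α := fun _ => ℝ) ((cubeCoord r n).toFun x.1)
        ((intervalCoord r).toFun x.2) (Fin.last (0 + n))) = _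
      rw [Fin.snoc_last]; rfl

theorem cubeCoord_cubeMap (r : ℝ) (n : ℕ) (v : CubeVec n) :
    (cubeCoord r n).toFun ((cubeMap n).toFun v) = fun i => squeeze r (squeeze 1 (v i)) := by
  induction n with
  | zero => exact Subsingleton.elim (α := Fin 0 → ℝ) _ _
  | succ n ih =>
    funext i
    change Fin.snoc (α := fun _ => ℝ) ((cubeCoord r n).toFun ((cubeMap n).toFun (Fin.init v)))
      ((intervalCoord r).toFun (intervalMap.toFun (v (Fin.last (0 + n))))) i = _
    obtain ⟨j, rfl⟩ | rfl := Fin.eq_castSucc_or_eq_last (n := 0 + n) i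
    · rw [Fin.snoc_castSucc, ih]; rfl
    · rw [Fin.snoc_last]; rfl

/-- Every squeeze has derivative one at zero, so the size of the cube can be changed without
changing the frame at its centre. -/
theorem D_cubeCoord_cubeMap (r : ℝ) (n : ℕ) (v : CubeVec n) :
    ((cubeCoord r n).comp (cubeMap n)).D (0 : CubeVec n) v = v := by
  rw [SmoothMap.D_eq_fderiv]
  have h : ((cubeCoord r n).comp (cubeMap n)).toFun =
      fun (v : CubeVec n) i => squeeze r (squeeze 1 (v i)) :=
    funext fun v => cubeCoord_cubeMap r n v
  have h1 : HasFDerivAt (fun (v : CubeVec n) i => squeeze r (squeeze 1 (v i)))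
      (ContinuousLinearMap.id ℝ (CubeVec n)) 0 := by
    refine hasFDerivAt_pi'.2 fun i => ?_
    have h0 : HasDerivAt (squeeze r) 1 (squeeze 1 0) := by
      rw [squeeze.zero_right]; exact squeeze.hasDerivAt_zero r
    have h2 : HasDerivAt (fun t => squeeze r (squeeze 1 t)) 1 0 :=
      (h0.comp (0 : ℝ) (squeeze.hasDerivAt_zero 1)).congr_deriv (mul_one 1)
    have h3 : HasFDerivAt (fun v : CubeVec n => v i)
        (ContinuousLinearMap.proj i : CubeVec n →L[ℝ] ℝ) 0 := hasFDerivAt_apply i _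
    refine (HasFDerivAt.comp (0 : CubeVec n) (g := fun t => squeeze r (squeeze 1 t))
      h2.hasFDerivAt h3).congr_fderiv ?_
    ext w
    simp
  rw [h, h1.fderiv]
  rfl

theorem abs_mul_cubeCoord_le (r : ℝ) (n : ℕ) (q : (cube n).M) :
    |r| * ‖(show CubeVec n from (cubeCoord r n).toFun q)‖ ≤ 1 := by
  have key : ∀ i, |r| * |(show CubeVec n from (cubeCoord r n).toFun q) i| ≤ 1 := by
    induction n with
    | zero => exact fun i => i.elim0
    | succ n ih =>
      intro i
      change |r| * |Fin.snoc (α := fun _ => ℝ) ((cubeCoord r n).toFun q.1)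
        ((intervalCoord r).toFun q.2) i| ≤ 1
      obtain ⟨j, rfl⟩ | rfl := Fin.eq_castSucc_or_eq_last (n := 0 + n) i
      · rw [Fin.snoc_castSucc]; exact ih q.1 j
      · rw [Fin.snoc_last]; exact (squeeze.mul_abs_lt r q.2.1).le
  rcases eq_or_ne r 0 with rfl | hr
  · simp
  · have hr' : 0 < |r| := abs_pos.2 hr
    rw [← le_div_iff₀' hr']
    refine (pi_norm_le_iff_of_nonneg (by positivity)).2 fun i => ?_
    rw [Real.norm_eq_abs, le_div_iff₀' hr']
    exact key i

theorem cubeCoord_injective (r : ℝ) (n : ℕ) : Function.Injective (cubeCoord r n).toFun := by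
  have h := (shrink n √(1 + r ^ 2)).isEmbedding.injective
  rw [← cubeMap_comp_cubeCoord] at h
  exact Function.Injective.of_comp (f := (cubeMap n).toFun) h

theorem D_cubeCoord_injective (r : ℝ) (n : ℕ) (q : (cube n).M) :
    Function.Injective ((cubeCoord r n).D q) := by
  have h := (shrink n √(1 + r ^ 2)).D_injective q
  rw [← cubeMap_comp_cubeCoord, SmoothMap.D_comp] at h
  exact Function.Injective.of_comp (f := (cubeMap n).D _) h

/-! ### The standard frame of the cube, and interior points. -/

namespace Frame
variable {d e : ℕ} {X : CornerMfd d} {Y : CornerMfd e}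

/-- The only frame of the point. -/
def ofPoint : Frame point := 
  ⟨(0 : EuclideanSpace ℝ (Fin 0)), fun i => i.elim0,
    linearIndependent_empty_type (R := ℝ) (M := EuclideanSpace ℝ (Fin 0))⟩

/-- The frame of coordinate vectors at the centre of the cube. -/
def std : (n : ℕ) → Frame (cube n)
  | 0 => ofPoint
  | n + 1 => stabilize (std n)

theorem std_pt (n : ℕ) : (std n).pt = (cubeMap n).toFun (0 : CubeVec n) := by
  induction n with
  | zero => rfl
  | succ n ih => exact Prod.ext ih intervalMap_zero.symm

/-- This replaces the recursive definition by stabilization with one linear parametrization, so that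
frames of embedded cubes become derivatives at `0` of maps on `CubeVec n`. -/
theorem std_v (n : ℕ) (i : Fin (0 + n)) :
    (std n).v i = (cubeMap n).D (0 : CubeVec n) (Pi.single i (1 : ℝ) : CubeVec n) := by
  induction n with
  | zero => exact i.elim0
  | succ n ih =>
    rw [cubeMap]
    refine Eq.trans ?_ (SmoothMap.D_pair _ _ _ _).symm
    rw [SmoothMap.D_comp_apply, SmoothMap.D_comp_apply, SmoothMap.D_eq_fderiv,
      SmoothMap.D_eq_fderiv]
    have h1 : HasFDerivAt (fun v : CubeVec (n + 1) => (Fin.init v : CubeVec n))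
        (ContinuousLinearMap.pi fun i : Fin (0 + n) => ContinuousLinearMap.proj i.castSucc) 0 :=
      (ContinuousLinearMap.pi fun i : Fin (0 + n) =>
        (ContinuousLinearMap.proj i.castSucc : CubeVec (n + 1) →L[ℝ] ℝ)).hasFDerivAt
    have h2 : HasFDerivAt (fun v : CubeVec (n + 1) => v (Fin.last (0 + n)))
        (ContinuousLinearMap.proj (Fin.last (0 + n)) : CubeVec (n + 1) →L[ℝ] ℝ) 0 :=
      (ContinuousLinearMap.proj (Fin.last (0 + n)) : CubeVec (n + 1) →L[ℝ] ℝ).hasFDerivAt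
    have e1 : (SmoothMap.ofContDiff (fun v : CubeVec (n + 1) => (Fin.init v : CubeVec n)) (by
        exact contDiff_pi.2 fun i => contDiff_apply ℝ ℝ i.castSucc)).toFun =
        fun v : CubeVec (n + 1) => (Fin.init v : CubeVec n) := rfl
    have e2 : (SmoothMap.ofContDiff (fun v : CubeVec (n + 1) => v (Fin.last (0 + n)))
        (contDiff_apply ℝ ℝ _)).toFun = fun v : CubeVec (n + 1) => v (Fin.last (0 + n)) := rfl
    rw [e1, e2, h1.fderiv, h2.fderiv]
    change (stabilize (std n)).v i = ((cubeMap n).D (0 : CubeVec n) _, intervalMap.D (0 : ℝ) _)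
    obtain ⟨j, rfl⟩ | rfl := Fin.eq_castSucc_or_eq_last (n := 0 + n) i
    case inr =>
      rw [stabilize_v_last]
      refine Prod.ext ?_ ?_
      · refine Eq.trans (map_zero ((cubeMap n).D (0 : CubeVec n))).symm ?_
        refine congrArg ((cubeMap n).D (0 : CubeVec n)) (funext fun i => ?_)
        exact (Pi.single_eq_of_ne (M := fun _ => ℝ) (Fin.castSucc_ne_last i) (1 : ℝ)).symm
      · refine D_intervalMap_zero.symm.trans (congrArg (intervalMap.D (0 : ℝ)) ?_)
        exact (Pi.single_eq_same (M := fun _ => ℝ) (Fin.last (0 + n)) (1 : ℝ)).symm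
    case inl =>
      rw [stabilize_v_castSucc, ih]
      refine Prod.ext ?_ ?_
      · refine congrArg ((cubeMap n).D (0 : CubeVec n)) (funext fun i => ?_)
        change (Pi.single j (1 : ℝ) : CubeVec n) i =
          (Pi.single j.castSucc (1 : ℝ) : CubeVec (n + 1)) i.castSucc
        simp only [Pi.single_apply, Fin.castSucc_inj]
      · refine Eq.trans (map_zero (intervalMap.D (0 : ℝ))).symm ?_
        refine congrArg (intervalMap.D (0 : ℝ)) ?_
        exact (Pi.single_eq_of_ne (M := fun _ => ℝ) (Fin.castSucc_ne_last j).symm (1 : ℝ)).symm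

/-- Stabilization sees the new factor only to first order at the origin, so any `c` with the
first-order behaviour of the identity there can stand in for the identity. -/
theorem push_prodMap_stabilize (h : d = e) (f : Emb X.toSmoothMfd Y.toSmoothMfd)
    (c : Emb interval interval) (hc : c.toFun origin = origin)
    (hc' : ∀ v, c.toSmoothMap.D origin v = v) (z : Frame X) :
    push (Y := Y.thicken) (congrArg (· + 1) h) (f.prodMap c) (stabilize z) =
      stabilize (push h f z) := by
  subst h
  refine ext' (Prod.ext rfl hc) fun i => ?_
  rw [push_v]
  refine (SmoothMap.D_prodMap f.toSmoothMap c.toSmoothMap _ _).trans ?_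
  refine Fin.lastCases ?_ (fun j => ?_) i
  · rw [stabilize_v_last]
    exact Prod.ext ((congrArg (fun w => f.toSmoothMap.D z.pt w.1) (stabilize_v_last z)).trans
        (map_zero (f.toSmoothMap.D z.pt)))
      ((congrArg (fun w => c.toSmoothMap.D origin w.2) (stabilize_v_last z)).trans (hc' unitVec))
  · rw [stabilize_v_castSucc]
    exact Prod.ext (congrArg (fun w => f.toSmoothMap.D z.pt w.1) (stabilize_v_castSucc z j))
      ((congrArg (fun w => c.toSmoothMap.D origin w.2) (stabilize_v_castSucc z j)).trans
        (map_zero (c.toSmoothMap.D origin)))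

theorem push_shrink_std (n : ℕ) (s : ℝ) : push rfl (shrink n s) (std n) = std n := by
  induction n with
  | zero => exact push_id _
  | succ n ih =>
    refine (push_prodMap_stabilize rfl (shrink n s) (squeezeEmb s) (squeezeEmb_origin s)
      (D_squeezeEmb_origin s) (std n)).trans ?_
    rw [ih]; rfl

end Frame

theorem isInteriorPoint_prod {X Y : SmoothMfd} {x : X.M} {y : Y.M} (hx : X.I.IsInteriorPoint x)
    (hy : Y.I.IsInteriorPoint y) :
    (X.prod Y).I.IsInteriorPoint (show (X.prod Y).M from (x, y)) := by
  have h := ModelWithCorners.interior_prod (I := X.I) (J := Y.I) (M := X.M) (N := Y.M)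
  have h1 : (x, y) ∈ X.I.interior X.M ×ˢ Y.I.interior Y.M := ⟨hx, hy⟩
  rw [← h] at h1
  exact h1

theorem isInteriorPoint_cubeMap_zero (n : ℕ) :
    (cube n).I.IsInteriorPoint ((cubeMap n).toFun (0 : CubeVec n)) := by
  induction n with
  | zero =>
    exact BoundarylessManifold.isInteriorPoint (I := 𝓘(ℝ, EuclideanSpace ℝ (Fin 0)))
      (M := EuclideanSpace ℝ (Fin 0))
  | succ n ih =>
    have h2 : interval.I.IsInteriorPoint (intervalMap.toFun (0 : ℝ)) := by
      have := isInteriorPoint_squeezeEmb one_ne_zero Frame.origin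
      rwa [squeezeEmb_origin, ← intervalMap_zero] at this
    exact isInteriorPoint_prod ih h2

/-! ### Charts with globally defined coordinates, and perturbations supported in them. -/

open Set Metric in
/-- A chart around `y₀`, onto a relatively open ball in the range of the model with corners, whose
coordinate function is extended to the whole manifold. -/
structure LocalChart (Y : SmoothMfd) (y₀ : Y.M) where
  coord : SmoothMap Y (vec Y.E)
  inv : Y.E → Y.M
  dom : Set Y.M
  r : ℝ
  r_pos : 0 < r
  isOpen_dom : IsOpen dom
  mem_dom : y₀ ∈ dom
  coord_mem : ∀ y ∈ dom, coord.toFun y ∈ range Y.I ∩ ball (coord.toFun y₀ : Y.E) r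
  inv_mem : ∀ u ∈ range Y.I ∩ ball (coord.toFun y₀ : Y.E) r, inv u ∈ dom
  inv_coord : ∀ y ∈ dom, inv (coord.toFun y) = y
  coord_inv : ∀ u ∈ range Y.I ∩ ball (coord.toFun y₀ : Y.E) r, coord.toFun (inv u) = u
  contMDiffOn_inv : ContMDiffOn 𝓘(ℝ, Y.E) Y.I ∞ inv (range Y.I ∩ ball (coord.toFun y₀ : Y.E) r)
  coord_center : coord.toFun y₀ = extChartAt Y.I y₀ y₀
  D_coord_injective : ∀ y ∈ dom, Function.Injective (coord.D y)
  isInteriorPoint : ∀ y ∈ dom, coord.toFun y ∈ interior (range Y.I) → Y.I.IsInteriorPoint y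

open Set Metric in
-- Multiplying a chart by a bump function makes it globally smooth and leaves it unchanged on the
-- inner ball. The bound `ε` later allows the ball to be taken inside the range of the model around
-- an interior point.
theorem exists_localChart (Y : SmoothMfd) [T2Space Y.M] (y₀ : Y.M) {ε : ℝ} (hε : 0 < ε) :
    ∃ c : LocalChart Y y₀, c.r ≤ ε := by
  obtain ⟨f⟩ : Nonempty (SmoothBumpFunction Y.I y₀) := inferInstance
  have hφ0 := mem_extChartAt_source (I := Y.I) y₀
  let coord : SmoothMap Y (vec Y.E) :=
    ⟨fun y => f y • extChartAt Y.I y₀ y, f.contMDiff_smul contMDiffOn_extChartAt⟩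
  have hrf : min f.rIn ε ≤ f.rIn := min_le_left _ _
  have h1 : ∀ y ∈ (extChartAt Y.I y₀).source,
      extChartAt Y.I y₀ y ∈ ball (extChartAt Y.I y₀ y₀) (min f.rIn ε) →
      coord.toFun y = extChartAt Y.I y₀ y := by
    intro y hy hy'
    rw [extChartAt_source] at hy
    have : f y = 1 := f.one_of_dist_le hy (hy'.le.trans hrf)
    change f y • extChartAt Y.I y₀ y = _
    rw [this, one_smul]
  have hc : coord.toFun y₀ = extChartAt Y.I y₀ y₀ :=
    h1 _ hφ0 (mem_ball_self (lt_min f.rIn_pos hε))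
  have ht : range Y.I ∩ ball (extChartAt Y.I y₀ y₀) (min f.rIn ε) ⊆ (extChartAt Y.I y₀).target :=
    fun u hu => f.closedBall_subset
      ⟨ball_subset_closedBall (ball_subset_ball (hrf.trans f.rIn_lt_rOut.le) hu.2), hu.1⟩
  have ho : IsOpen ((extChartAt Y.I y₀).source ∩
      extChartAt Y.I y₀ ⁻¹' ball (extChartAt Y.I y₀ y₀) (min f.rIn ε)) :=
    isOpen_extChartAt_preimage' y₀ isOpen_ball
  refine ⟨⟨coord, (extChartAt Y.I y₀).symm, (extChartAt Y.I y₀).source ∩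
      extChartAt Y.I y₀ ⁻¹' ball (extChartAt Y.I y₀ y₀) (min f.rIn ε), min f.rIn ε,
      lt_min f.rIn_pos hε, ho, ⟨hφ0, mem_ball_self (lt_min f.rIn_pos hε)⟩, ?_, ?_, ?_, ?_, ?_, hc,
      ?_, ?_⟩, min_le_right _ _⟩
  · intro y hy
    rw [h1 y hy.1 hy.2, hc]
    exact ⟨extChartAt_target_subset_range y₀ ((extChartAt Y.I y₀).map_source hy.1), hy.2⟩
  · intro u hu
    rw [hc] at hu
    refine ⟨(extChartAt Y.I y₀).map_target (ht hu), ?_⟩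
    rw [mem_preimage, (extChartAt Y.I y₀).right_inv (ht hu)]
    exact hu.2
  · intro y hy
    rw [h1 y hy.1 hy.2, (extChartAt Y.I y₀).left_inv hy.1]
  · intro u hu
    rw [hc] at hu
    have e := (extChartAt Y.I y₀).right_inv (ht hu)
    rw [h1 _ ((extChartAt Y.I y₀).map_target (ht hu)) (by rw [e]; exact hu.2), e]
  · rw [hc]
    exact (contMDiffOn_extChartAt_symm y₀).mono ht
  · intro y hy
    have he : coord.toFun =ᶠ[𝓝 y] extChartAt Y.I y₀ := by
      filter_upwards [ho.mem_nhds hy] with z hz using h1 z hz.1 hz.2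
    have h2 : coord.D y = mfderiv Y.I 𝓘(ℝ, Y.E) (extChartAt Y.I y₀) y := he.mfderiv_eq
    rw [h2]
    exact (isInvertible_mfderiv_extChartAt hy.1).injective
  · intro y hy hi
    rw [h1 y hy.1 hy.2] at hi
    have hs : y ∈ (chartAt Y.H y₀).source := by simpa using hy.1
    rw [ModelWithCorners.isInteriorPoint_iff_of_mem_atlas (n := ∞) (by simp)
      (chart_mem_atlas Y.H y₀) hs]
    refine interior_mono ht ?_
    rw [interior_inter, isOpen_ball.interior_eq]
    exact ⟨hi, hy.2⟩

namespace LocalChart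
variable {d : ℕ} {Y : CornerMfd d} {y₀ : Y.M}

theorem coord_injOn (c : LocalChart Y.toSmoothMfd y₀) : Set.InjOn c.coord.toFun c.dom :=
  fun a ha b hb h => by
    rw [← c.inv_coord a ha, h, c.inv_coord b hb]

/-- The set is the image of a compact set under the inverse chart, hence closed in all of `Y` and
not merely in `c.dom`. Perturbations supported on it therefore extend smoothly by the identity. -/
theorem isClosed_coord_preimage (c : LocalChart Y.toSmoothMfd y₀) {ρ : ℝ} (hρ : ρ < c.r) :
    IsClosed {y | y ∈ c.dom ∧ ‖(c.coord.toFun y : Y.E) - c.coord.toFun y₀‖ ≤ ρ} := by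
  have hK : IsCompact (Set.range Y.I ∩ Metric.closedBall (c.coord.toFun y₀ : Y.E) ρ) :=
    (isCompact_closedBall _ _).inter_left Y.I.isClosed_range
  have hs : Set.range Y.I ∩ Metric.closedBall (c.coord.toFun y₀ : Y.E) ρ ⊆
      Set.range Y.I ∩ Metric.ball (c.coord.toFun y₀ : Y.E) c.r :=
    Set.inter_subset_inter_right _ (Metric.closedBall_subset_ball hρ)
  have h := (hK.image_of_continuousOn (c.contMDiffOn_inv.continuousOn.mono hs)).isClosed
  convert h using 1
  ext y
  constructor
  · rintro ⟨h1, h2⟩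
    exact ⟨c.coord.toFun y, ⟨(c.coord_mem y h1).1, mem_closedBall_iff_norm.2 h2⟩, c.inv_coord y h1⟩
  · rintro ⟨u, hu, rfl⟩
    refine ⟨c.inv_mem u (hs hu), ?_⟩
    rw [c.coord_inv u (hs hu)]
    exact mem_closedBall_iff_norm.1 hu.2

/-- A map of the coordinate ball which differs from the identity by a contraction is injective with
injective derivative. Extended by the identity it is an injective immersion of a compact manifold to
itself, hence an embedding; surjectivity is never needed. The smooth parameter makes the family
continuous. -/
theorem exists_perturb (c : LocalChart Y.toSmoothMfd y₀) {T : SmoothMfd}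
    (W : SmoothMap (T.prod (vec Y.E)) (vec Y.E)) {ρ : ℝ} (hρ : ρ < c.r) {κ : NNReal} (hκ : κ < 1)
    (hW : ∀ (t : T.M) (u : Y.E), ρ < ‖u - c.coord.toFun y₀‖ → W.toFun (t, u) = u)
    (hW' : ∀ (t : T.M), ∀ u ∈ Set.range Y.I ∩ Metric.ball (c.coord.toFun y₀ : Y.E) c.r,
      W.toFun (t, u) ∈ Set.range Y.I ∩ Metric.ball (c.coord.toFun y₀ : Y.E) c.r)
    (hL : ∀ t : T.M, LipschitzWith κ fun u : Y.E => (W.toFun (t, u) : Y.E) - u) :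
    ∃ Θ : T.M → Emb Y.toSmoothMfd Y.toSmoothMfd, Continuous Θ ∧
      (∀ t, ∀ y ∈ c.dom, (Θ t).toFun y ∈ c.dom ∧
        c.coord.toFun ((Θ t).toFun y) = W.toFun (t, c.coord.toFun y)) ∧
      ∀ t, ∀ y ∉ c.dom, (Θ t).toFun y = y := by
  classical
  let C : Set Y.M := {y | y ∈ c.dom ∧ ‖(c.coord.toFun y : Y.E) - c.coord.toFun y₀‖ ≤ ρ}
  have hC : IsClosed C := c.isClosed_coord_preimage hρ
  let θ : T.M × Y.M → Y.M := fun p =>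
    if p.2 ∈ c.dom then c.inv (W.toFun (p.1, c.coord.toFun p.2)) else p.2
  have hin : ∀ t, ∀ y ∈ c.dom, θ (t, y) = c.inv (W.toFun (t, c.coord.toFun y)) :=
    fun t y hy => if_pos hy
  have hout : ∀ t, ∀ y ∉ C, θ (t, y) = y := by
    intro t y hy
    by_cases hd : y ∈ c.dom
    · rw [hin t y hd, hW t _ (not_le.1 fun h => hy ⟨hd, h⟩), c.inv_coord y hd]
    · exact if_neg hd
  have hmem : ∀ t, ∀ y ∈ c.dom, θ (t, y) ∈ c.dom ∧
      c.coord.toFun (θ (t, y)) = W.toFun (t, c.coord.toFun y) := by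
    intro t y hy
    have := hW' t _ (c.coord_mem y hy)
    rw [hin t y hy]
    exact ⟨c.inv_mem _ this, c.coord_inv _ this⟩
  have hsm : ContMDiff (T.I.prod Y.I) Y.I ∞ θ := by
    intro ⟨t, y⟩
    by_cases hy : y ∈ C
    · have hU : IsOpen (Set.univ ×ˢ c.dom : Set (T.M × Y.M)) := isOpen_univ.prod c.isOpen_dom
      have h1 : ContMDiffOn (T.I.prod Y.I) Y.I ∞ (c.inv ∘ (W.comp
          ((SmoothMap.id T).prodMap c.coord)).toFun) (Set.univ ×ˢ c.dom) :=
        c.contMDiffOn_inv.comp (W.comp ((SmoothMap.id T).prodMap c.coord)).smooth.contMDiffOn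
          fun p hp => hW' p.1 _ (c.coord_mem p.2 hp.2)
      refine ((h1.congr fun p hp => ?_).contMDiffAt (hU.mem_nhds ⟨trivial, hy.1⟩))
      exact hin p.1 p.2 hp.2
    · have hU : IsOpen (Set.univ ×ˢ Cᶜ : Set (T.M × Y.M)) := isOpen_univ.prod hC.isOpen_compl
      refine (contMDiffAt_snd (I := T.I) (J := Y.I)).congr_of_eventuallyEq ?_
      filter_upwards [hU.mem_nhds ⟨trivial, hy⟩] with p hp using hout p.1 p.2 hp.2
  let G : SmoothMap (T.prod Y.toSmoothMfd) Y.toSmoothMfd := ⟨θ, hsm⟩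
  have hG : ∀ t y, (G.slice t).toFun y = θ (t, y) := fun t y => rfl
  -- Equal images would give `‖u - u'‖ ≤ κ * ‖u - u'‖` with `κ < 1`.
  have hinjW : ∀ (t : T.M) (u u' : Y.E), W.toFun (t, u) = W.toFun (t, u') → u = u' := by
    intro t u u' h
    have h1 := (hL t).dist_le_mul u u'
    rw [h, dist_sub_left] at h1
    have h2 : (κ : ℝ) < 1 := by exact_mod_cast hκ
    by_contra hne
    have := dist_pos.2 hne
    nlinarith
  have hinj : ∀ t, Function.Injective (G.slice t).toFun := by
    intro t a b h
    rw [hG, hG] at h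
    -- The map preserves the chart domain and fixes its complement, which excludes the two mixed
    -- cases.
    by_cases ha : a ∈ c.dom <;> by_cases hb : b ∈ c.dom
    · have h1 := congrArg c.coord.toFun h
      rw [(hmem t a ha).2, (hmem t b hb).2] at h1
      exact c.coord_injOn ha hb (hinjW t _ _ h1)
    · have := (hmem t a ha).1
      rw [h, hout t b fun h => hb h.1] at this
      exact absurd this hb
    · have := (hmem t b hb).1
      rw [← h, hout t a fun h => ha h.1] at this
      exact absurd this ha
    · rwa [hout t a fun h => ha h.1, hout t b fun h => hb h.1] at h
  have hDW : ∀ (t : T.M) (u : Y.E), Function.Injective ((W.slice t).D u) := by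
    intro t u
    refine (injective_iff_map_eq_zero _).2 fun v hv => ?_
    rw [SmoothMap.D_eq_fderiv] at hv
    have hd : DifferentiableAt ℝ (W.slice t).toFun u := (W.slice t).contDiff.differentiable (by simp) u
    -- The derivative is within `κ` of the identity, so a vector in its kernel satisfies `‖v‖ ≤ κ *
    -- ‖v‖`.
    have h1 := norm_fderiv_le_of_lipschitz ℝ (hL t) (x₀ := u)
    have h2 : fderiv ℝ (fun u : Y.E => (W.toFun (t, u) : Y.E) - u) u =
        fderiv ℝ (W.slice t).toFun u - ContinuousLinearMap.id ℝ Y.E :=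
      (hd.hasFDerivAt.sub (hasFDerivAt_id u)).fderiv
    have h3 := ContinuousLinearMap.le_of_opNorm_le _ h1 v
    rw [h2, sub_apply, hv, zero_sub, norm_neg] at h3
    have h4 : (κ : ℝ) < 1 := by exact_mod_cast hκ
    have h5 : ‖v‖ ≤ κ * ‖v‖ := h3
    have : ‖v‖ ≤ 0 := by nlinarith [norm_nonneg v]
    exact norm_le_zero_iff.1 this
  have hD : ∀ t y, Function.Injective ((G.slice t).D y) := by
    intro t y
    by_cases hy : y ∈ C
    · have e : (c.coord.comp (G.slice t)).D y = ((W.slice t).comp c.coord).D y := by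
        refine SmoothMap.D_congr ?_
        filter_upwards [c.isOpen_dom.mem_nhds hy.1] with z hz using (hmem t z hz).2
      have h1 : Function.Injective ((c.coord.comp (G.slice t)).D y) := by
        rw [e, SmoothMap.D_comp]
        exact (hDW t _).comp (c.D_coord_injective y hy.1)
      rw [SmoothMap.D_comp] at h1
      exact Function.Injective.of_comp (f := c.coord.D _) h1
    · have e : (G.slice t).D y = (SmoothMap.id Y.toSmoothMfd).D y := by
        refine SmoothMap.D_congr ?_
        filter_upwards [hC.isOpen_compl.mem_nhds hy] with z hz using hout t z hz
      rw [e]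
      exact fun a b h => by rwa [SmoothMap.D_id, SmoothMap.D_id] at h
  exact ⟨fun t => Emb.ofInjective rfl (G.slice t) (hinj t) (hD t),
    Emb.continuous_iff.2 G.continuous_slice, hmem, fun t y hy => hout t y fun h => hy h.1⟩

end LocalChart

/-! ### Pushing a manifold with corners into its interior. -/

section push
variable {d : ℕ} {X : CornerMfd d}

/-- The sum of the basis vectors increases every constrained coordinate at once, so it points inward
at all boundary and corner strata of the octant. -/
theorem CornerMfd.exists_inward (X : CornerMfd d) :
    ∃ e : X.E, ∀ u ∈ Set.range X.I, ∀ s : ℝ, 0 < s → u + s • e ∈ interior (Set.range X.I) := by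
  obtain ⟨b, S, h⟩ := X.octant
  refine ⟨∑ i, b i, fun u hu s hs => ?_⟩
  have hopen : IsOpen {v : X.E | ∀ i, i ∈ S → 0 < b.repr v i} := by
    have : {v : X.E | ∀ i, i ∈ S → 0 < b.repr v i} = ⋂ i ∈ S, {v : X.E | 0 < b.coord i v} := by
      ext v; simp
    rw [this]
    refine S.toFinite.isOpen_biInter fun i _ => ?_
    exact isOpen_lt continuous_const (b.coord i).continuous_of_finiteDimensional
  refine interior_maximal ?_ hopen ?_
  · rw [h]
    exact fun v hv i hi => (hv i hi).le
  · intro i hi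
    rw [h] at hu
    have h1 : b.repr (∑ j, b j) i = 1 := by
      simp [map_sum, Finsupp.single_apply]
    rw [map_add, map_smul, Finsupp.add_apply, Finsupp.smul_apply, h1]
    have := hu i hi
    simp only [smul_eq_mul, mul_one]
    linarith

/-- In a chart, add a small multiple of the inward vector, cut off by a bump function. Each point
either stays fixed or becomes interior; this dichotomy is what lets several local pushes be
composed. -/
theorem exists_local_push (X : CornerMfd d) (x₀ : X.M) :
    ∃ (U : Set X.M) (h : ℝ → Emb X.toSmoothMfd X.toSmoothMfd), U ∈ 𝓝 x₀ ∧ Continuous h ∧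
      h 0 = Emb.id _ ∧ (∀ s x, (h s).toFun x = x ∨ X.I.IsInteriorPoint ((h s).toFun x)) ∧
      ∀ s ≠ 0, ∀ x ∈ U, X.I.IsInteriorPoint ((h s).toFun x) := by
  obtain ⟨c, -⟩ := exists_localChart X.toSmoothMfd x₀ one_pos
  obtain ⟨e, he⟩ := X.exists_inward
  have hr := c.r_pos
  let f : ContDiffBump (show X.E from c.coord.toFun x₀) :=
    ⟨c.r / 4, c.r / 2, by positivity, by linarith⟩
  obtain ⟨K, hK⟩ := ContDiff.lipschitzWith_of_hasCompactSupport (n := ∞) f.hasCompactSupport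
    f.contDiff (by simp)
  -- One `δ` serves two purposes: `δ * (K * ‖e‖) < 1 / 2` makes the displacement a contraction, and
  -- `δ * ‖e‖ < c.r / 4` keeps the points of the half ball inside the chart.
  obtain ⟨δ, hδ, hδ'⟩ := exists_pos_mul_lt (show 0 < min (1 / 2) (c.r / 4) by positivity)
    (K * ‖e‖ + ‖e‖)
  -- The time factor `s² / (1 + s²)` is smooth, bounded by one and zero only at `s = 0`, so the push
  -- is defined for all real times.
  have hβ : ∀ s : ℝ, 0 ≤ s ^ 2 / (1 + s ^ 2) ∧ s ^ 2 / (1 + s ^ 2) ≤ 1 := fun s =>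
    ⟨by positivity, (div_le_one (by positivity)).2 (by linarith)⟩
  let a : ℝ → X.E → ℝ := fun s u => δ * (s ^ 2 / (1 + s ^ 2)) * f u
  have ha : ∀ s u, 0 ≤ a s u ∧ a s u ≤ δ := by
    intro s u
    have h1 := hβ s
    have h2 : 0 ≤ f u := f.nonneg
    have h3 : f u ≤ 1 := f.le_one
    refine ⟨mul_nonneg (mul_nonneg hδ.le h1.1) h2, ?_⟩
    calc δ * (s ^ 2 / (1 + s ^ 2)) * f u ≤ δ * 1 * 1 :=
          mul_le_mul (mul_le_mul_of_nonneg_left h1.2 hδ.le) h3 h2 (by linarith)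
      _ = δ := by ring
  have hsm : ContDiff ℝ ∞ fun p : ℝ × X.E => p.2 + a p.1 p.2 • e := by
    refine contDiff_snd.add (ContDiff.smul (ContDiff.mul (contDiff_const.mul
      (ContDiff.div (by fun_prop) (by fun_prop) fun p => by positivity))
      (f.contDiff.comp contDiff_snd)) contDiff_const)
  let W : SmoothMap ((vec ℝ).prod (vec X.E)) (vec X.E) :=
    ⟨fun p => p.2 + a p.1 p.2 • e, by
      have := hsm.contMDiff
      rw [modelWithCornersSelf_prod, ← chartedSpaceSelf_prod] at this
      exact this⟩
  have hKe : 0 ≤ K * ‖e‖ := by positivity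
  have hne : δ * ‖e‖ < c.r / 4 := by
    have := hδ'.trans_le (min_le_right _ _)
    nlinarith [norm_nonneg e]
  have hKe' : δ * (K * ‖e‖) < 1 / 2 := by
    have := hδ'.trans_le (min_le_left _ _)
    nlinarith [norm_nonneg e]
  have hrange : ∀ s, ∀ u ∈ Set.range X.I, u + a s u • e ∈ Set.range X.I := by
    intro s u hu
    rcases (ha s u).1.eq_or_lt with h | h
    · rw [← h, zero_smul, add_zero]; exact hu
    · exact interior_subset (he u hu _ h)
  obtain ⟨h, hc, h1, h2⟩ := c.exists_perturb (T := vec ℝ) W (ρ := c.r / 2) (by linarith)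
    (κ := 1 / 2) (by norm_num) (fun s u hu => by
      have : f u = 0 := f.zero_of_le_dist (by rw [dist_eq_norm]; exact hu.le)
      change u + a s u • e = u
      simp [a, this]) (fun s u hu => by
      refine ⟨hrange s u hu.1, ?_⟩
      change u + a s u • e ∈ _
      rw [mem_ball_iff_norm]
      rcases le_or_gt (c.r / 2) ‖u - c.coord.toFun x₀‖ with h | h
      · have : f u = 0 := f.zero_of_le_dist (by rw [dist_eq_norm]; exact h)
        simpa [a, this] using mem_ball_iff_norm.1 hu.2
      · have h3 : ‖a s u • e‖ ≤ δ * ‖e‖ := by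
          rw [norm_smul, Real.norm_of_nonneg (ha s u).1]
          exact mul_le_mul_of_nonneg_right (ha s u).2 (norm_nonneg e)
        have h4 : u + a s u • e - c.coord.toFun x₀ = (u - c.coord.toFun x₀) + a s u • e := by abel
        rw [h4]
        refine (norm_add_le _ _).trans_lt ?_
        linarith) (fun s => by
      refine LipschitzWith.of_dist_le_mul fun u u' => ?_
      change dist (u + a s u • e - u) (u' + a s u' • e - u') ≤ _
      rw [add_sub_cancel_left, add_sub_cancel_left, dist_eq_norm, ← sub_smul, norm_smul]
      have h3 : a s u - a s u' = δ * (s ^ 2 / (1 + s ^ 2)) * (f u - f u') := by simp only [a]; ring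
      have h4 := hK.dist_le_mul u u'
      rw [Real.dist_eq] at h4
      rw [h3, Real.norm_eq_abs, abs_mul, abs_of_nonneg (mul_nonneg hδ.le (hβ s).1)]
      have h5 : δ * (s ^ 2 / (1 + s ^ 2)) ≤ δ := by nlinarith [(hβ s).2]
      have h6 := dist_nonneg (x := u) (y := u')
      calc δ * (s ^ 2 / (1 + s ^ 2)) * |f u - f u'| * ‖e‖ ≤ δ * (K * dist u u') * ‖e‖ := by
            refine mul_le_mul_of_nonneg_right ?_ (norm_nonneg e)
            exact mul_le_mul h5 h4 (abs_nonneg _) hδ.le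
        _ = δ * (K * ‖e‖) * dist u u' := by ring
        _ ≤ 1 / 2 * dist u u' := mul_le_mul_of_nonneg_right hKe'.le h6
        _ = _ := by simp)
  have hcase : ∀ s, ∀ x ∈ c.dom, 0 < a s (c.coord.toFun x) →
      X.I.IsInteriorPoint ((h s).toFun x) := by
    intro s x hx hs
    refine c.isInteriorPoint _ (h1 s x hx).1 ?_
    rw [(h1 s x hx).2]
    exact he _ (c.coord_mem x hx).1 _ hs
  refine ⟨{x | x ∈ c.dom ∧ c.coord.toFun x ∈ Metric.ball (c.coord.toFun x₀ : X.E) (c.r / 4)}, h,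
    ?_, hc, ?_, ?_, ?_⟩
  · refine (c.isOpen_dom.inter (Metric.isOpen_ball.preimage c.coord.smooth.continuous)).mem_nhds
      ⟨c.mem_dom, Metric.mem_ball_self (by positivity)⟩
  · refine Emb.ext fun x => ?_
    by_cases hx : x ∈ c.dom
    · refine c.coord_injOn (h1 0 x hx).1 hx ?_
      rw [(h1 0 x hx).2]
      change c.coord.toFun x + a 0 (c.coord.toFun x) • e = c.coord.toFun x
      simp [a]
    · exact h2 0 x hx
  · intro s x
    by_cases hx : x ∈ c.dom
    · rcases (ha s (c.coord.toFun x)).1.eq_or_lt with h3 | h3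
      · left
        refine c.coord_injOn (h1 s x hx).1 hx ?_
        rw [(h1 s x hx).2]
        change c.coord.toFun x + a s (c.coord.toFun x) • e = _
        rw [← h3, zero_smul, add_zero]
      · exact Or.inr (hcase s x hx h3)
    · exact Or.inl (h2 s x hx)
  · rintro s hs x ⟨hx, hx'⟩
    refine hcase s x hx ?_
    have h3 : f (c.coord.toFun x) = 1 := f.one_of_mem_closedBall (Metric.ball_subset_closedBall hx')
    change 0 < δ * (s ^ 2 / (1 + s ^ 2)) * f (c.coord.toFun x)
    rw [h3]
    positivity

/-- Finitely many local pushes cover `X` by compactness, and they are composed. Before its own push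
a point is either already interior, and then remains so by `Emb.isInteriorPoint`, or has not moved,
and then still lies in the region where that push takes effect. -/
theorem exists_push (X : CornerMfd d) :
    ∃ h : ℝ → Emb X.toSmoothMfd X.toSmoothMfd, Continuous h ∧ h 0 = Emb.id _ ∧
      ∀ s ≠ 0, ∀ x, X.I.IsInteriorPoint ((h s).toFun x) := by
  choose U h hU hc h0 h1 h2 using exists_local_push X
  obtain ⟨t, -, ht⟩ := isCompact_univ.elim_nhds_subcover U fun x _ => hU x
  suffices key : ∀ t : Finset X.M, ∃ H : ℝ → Emb X.toSmoothMfd X.toSmoothMfd, Continuous H ∧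
      H 0 = Emb.id _ ∧ (∀ s x, (H s).toFun x = x ∨ X.I.IsInteriorPoint ((H s).toFun x)) ∧
      ∀ s ≠ 0, ∀ x ∈ ⋃ y ∈ t, U y, X.I.IsInteriorPoint ((H s).toFun x) by
    obtain ⟨H, hH, hH0, -, hH1⟩ := key t
    exact ⟨H, hH, hH0, fun s hs x => hH1 s hs x (ht (Set.mem_univ x))⟩
  classical
  intro t
  induction t using Finset.induction_on with
  | empty =>
    exact ⟨fun _ => Emb.id _, continuous_const, rfl, fun _ _ => Or.inl rfl, by simp⟩
  | insert y t _ ih =>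
    obtain ⟨H, hH, hH0, hH1, hH2⟩ := ih
    have hint : ∀ s x, X.I.IsInteriorPoint x → X.I.IsInteriorPoint ((h y s).toFun x) :=
      fun s x hx => (h y s).isInteriorPoint hx
    refine ⟨fun s => (h y s).comp (H s), Emb.continuous_comp.comp ((hc y).prodMk hH), ?_, ?_, ?_⟩
    · change (h y 0).comp (H 0) = _
      rw [hH0, h0]; rfl
    · intro s x
      change (h y s).toFun ((H s).toFun x) = x ∨ X.I.IsInteriorPoint ((h y s).toFun ((H s).toFun x))
      rcases hH1 s x with h3 | h3
      · rw [h3]; exact h1 y s x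
      · exact Or.inr (hint s _ h3)
    · intro s hs x hx
      change X.I.IsInteriorPoint ((h y s).toFun ((H s).toFun x))
      rw [Finset.set_biUnion_insert] at hx
      rcases hx with hx | hx
      · rcases hH1 s x with h3 | h3
        · rw [h3]; exact h2 y s hs x hx
        · exact hint s _ h3
      · exact hint s _ (hH2 s hs x hx)

end push

/-! ### Moving frames at interior points. -/

section interiorChart
variable {d : ℕ} {Y : CornerMfd d}

theorem exists_localChart_of_isInteriorPoint {y₀ : Y.M} (hy : Y.I.IsInteriorPoint y₀) :
    ∃ c : LocalChart Y.toSmoothMfd y₀,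
      Metric.ball (c.coord.toFun y₀ : Y.E) c.r ⊆ Set.range Y.I := by
  obtain ⟨ε, hε, h⟩ := Metric.mem_nhds_iff.1 (mem_interior_iff_mem_nhds.1 hy)
  obtain ⟨c, hc⟩ := exists_localChart Y.toSmoothMfd y₀ hε
  refine ⟨c, ?_⟩
  rw [c.coord_center]
  exact (Metric.ball_subset_ball hc).trans h

namespace LocalChart
variable {y₀ : Y.M}

/-- The inverse of a chart around an interior point, modified away from the centre so as to be
globally defined and smooth. -/
theorem exists_param (c : LocalChart Y.toSmoothMfd y₀)
    (hc : Metric.ball (c.coord.toFun y₀ : Y.E) c.r ⊆ Set.range Y.I) :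
    ∃ ψ : SmoothMap (vec Y.E) Y.toSmoothMfd,
      ∀ u ∈ Metric.ball (c.coord.toFun y₀ : Y.E) (c.r / 2), ψ.toFun u = c.inv u := by
  have hr := c.r_pos
  -- The map `u ↦ center + f u • (u - center)` is the identity on the half ball and has values
  -- within `3 * c.r / 4` of the centre, where the inverse chart is smooth.
  let f : ContDiffBump (show Y.E from c.coord.toFun y₀) :=
    ⟨c.r / 2, 3 * c.r / 4, by positivity, by linarith⟩
  have hs : ContDiff ℝ ∞ fun u : Y.E =>
      (c.coord.toFun y₀ : Y.E) + f u • (u - c.coord.toFun y₀ : Y.E) :=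
    contDiff_const.add (f.contDiff.smul (contDiff_id.sub contDiff_const))
  have hm : ∀ u : Y.E, (c.coord.toFun y₀ : Y.E) + f u • (u - c.coord.toFun y₀ : Y.E) ∈
      Set.range Y.I ∩ Metric.ball (c.coord.toFun y₀ : Y.E) c.r := by
    intro u
    suffices h : (c.coord.toFun y₀ : Y.E) + f u • (u - c.coord.toFun y₀ : Y.E) ∈
      Metric.ball (c.coord.toFun y₀ : Y.E) c.r from ⟨hc h, h⟩
    rw [mem_ball_iff_norm, add_sub_cancel_left, norm_smul, Real.norm_of_nonneg f.nonneg]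
    rcases le_or_gt (3 * c.r / 4) ‖u - (c.coord.toFun y₀ : Y.E)‖ with h | h
    · rw [f.zero_of_le_dist (by rw [dist_eq_norm]; exact h), zero_mul]
      exact hr
    · calc f u * ‖u - (c.coord.toFun y₀ : Y.E)‖ ≤ 1 * ‖u - (c.coord.toFun y₀ : Y.E)‖ :=
          mul_le_mul_of_nonneg_right f.le_one (norm_nonneg _)
        _ < c.r := by linarith
  refine ⟨⟨_, contMDiffOn_univ.1 (c.contMDiffOn_inv.comp hs.contMDiff.contMDiffOn
    fun u _ => hm u)⟩, fun u hu => ?_⟩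
  have h1 : f u = 1 := f.one_of_mem_closedBall (Metric.ball_subset_closedBall hu)
  change c.inv ((c.coord.toFun y₀ : Y.E) + f u • (u - c.coord.toFun y₀ : Y.E)) = _
  rw [h1, one_smul, add_sub_cancel]

/-- Diffeomorphisms of `Y` which are small affine maps in a chart around an interior point. -/
theorem exists_affine (c : LocalChart Y.toSmoothMfd y₀)
    (hc : Metric.ball (c.coord.toFun y₀ : Y.E) c.r ⊆ Set.range Y.I) :
    ∃ (Θ : Y.E × (Y.E →L[ℝ] Y.E) → Emb Y.toSmoothMfd Y.toSmoothMfd) (η : ℝ), 0 < η ∧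
      Continuous Θ ∧ Θ 0 = Emb.id _ ∧ ∀ v ∈ Metric.ball (0 : Y.E × (Y.E →L[ℝ] Y.E)) 1, ∀ y ∈ c.dom,
        (c.coord.toFun y : Y.E) ∈ Metric.ball (c.coord.toFun y₀ : Y.E) (c.r / 4) →
        (Θ v).toFun y ∈ c.dom ∧
        c.coord.toFun ((Θ v).toFun y) = c.coord.toFun y + η • (v.1 + v.2 (c.coord.toFun y)) ∧
        ∀ w, c.coord.D ((Θ v).toFun y) ((Θ v).D y w) = c.coord.D y w + η • v.2 (c.coord.D y w) := by
  have hr := c.r_pos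
  let f : ContDiffBump (show Y.E from c.coord.toFun y₀) :=
    ⟨c.r / 4, c.r / 2, by positivity, by linarith⟩
  -- Cutting off the parameter as well makes `φ` compactly supported, so that one Lipschitz constant
  -- and one bound hold for all parameters.
  let g : ContDiffBump (0 : Y.E × (Y.E →L[ℝ] Y.E)) := ⟨1, 2, by norm_num, by norm_num⟩
  let φ : (Y.E × (Y.E →L[ℝ] Y.E)) × Y.E → Y.E := fun p => (g p.1 * f p.2) • (p.1.1 + p.1.2 p.2)
  have hφ : ContDiff ℝ ∞ φ :=
    ((g.contDiff.comp contDiff_fst).mul (f.contDiff.comp contDiff_snd)).smul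
      ((contDiff_fst.comp contDiff_fst).add
        ((contDiff_snd.comp contDiff_fst).clm_apply contDiff_snd))
  have hz1 : ∀ p, 2 ≤ ‖p.1‖ → φ p = 0 := fun p hp => by
    have : g p.1 = 0 := g.zero_of_le_dist (by rw [dist_zero_right]; exact hp)
    simp [φ, this]
  have hz2 : ∀ p : (Y.E × (Y.E →L[ℝ] Y.E)) × Y.E,
      c.r / 2 ≤ ‖p.2 - (c.coord.toFun y₀ : Y.E)‖ → φ p = 0 := fun p hp => by
    have : f p.2 = 0 := f.zero_of_le_dist (by rw [dist_eq_norm]; exact hp)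
    simp [φ, this]
  have hcs : HasCompactSupport φ := by
    refine HasCompactSupport.intro ((isCompact_closedBall (0 : Y.E × (Y.E →L[ℝ] Y.E)) 2).prod
      (isCompact_closedBall (show Y.E from c.coord.toFun y₀) (c.r / 2))) fun p hp => ?_
    rw [Set.mem_prod, not_and_or] at hp
    rcases hp with hp | hp
    · exact hz1 p (by rw [mem_closedBall_zero_iff, not_le] at hp; exact hp.le)
    · exact hz2 p (by rw [← dist_eq_norm]; exact (not_le.1 hp).le)
  obtain ⟨K, hK⟩ := ContDiff.lipschitzWith_of_hasCompactSupport (n := ∞) hcs hφ (by simp)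
  obtain ⟨C, hC⟩ := hφ.continuous.bounded_above_of_compact_support hcs
  have hC0 : 0 ≤ C := (norm_nonneg _).trans (hC 0)
  -- The scale `η` makes the perturbation a contraction and keeps it inside the chart.
  -- `Frame.exists_move` compensates for it by rescaling its parameter with `η⁻¹`.
  obtain ⟨η, hη, hη'⟩ := exists_pos_mul_lt (show 0 < min (1 / 2) (c.r / 4) by positivity)
    (K + C)
  have hηK : η * K < 1 / 2 := by
    have := hη'.trans_le (min_le_left _ _); nlinarith
  have hηC : η * C < c.r / 4 := by
    have := hη'.trans_le (min_le_right _ _); nlinarith [K.2]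
  have hsm : ContDiff ℝ ∞ fun p : (Y.E × (Y.E →L[ℝ] Y.E)) × Y.E => p.2 + η • φ p :=
    contDiff_snd.add (contDiff_const.smul hφ)
  let W : SmoothMap ((vec (Y.E × (Y.E →L[ℝ] Y.E))).prod (vec Y.E)) (vec Y.E) :=
    ⟨fun p => p.2 + η • φ p, by
      have := hsm.contMDiff
      rw [modelWithCornersSelf_prod (E := Y.E × (Y.E →L[ℝ] Y.E)) (F := Y.E),
        ← chartedSpaceSelf_prod] at this
      exact this⟩
  obtain ⟨Θ, hc, h1, h2⟩ := c.exists_perturb (T := vec (Y.E × (Y.E →L[ℝ] Y.E))) W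
    (ρ := c.r / 2) (by linarith)
    (κ := 1 / 2) (by norm_num) (fun s u hu => by
      change u + η • φ (s, u) = u
      rw [hz2 (s, u) hu.le, smul_zero, add_zero]) (fun s u hu => by
      suffices h : u + η • φ (s, u) ∈ Metric.ball (c.coord.toFun y₀ : Y.E) c.r from ⟨hc h, h⟩
      rw [mem_ball_iff_norm]
      rcases le_or_gt (c.r / 2) ‖u - c.coord.toFun y₀‖ with h | h
      · rw [hz2 (s, u) h, smul_zero, add_zero]
        exact mem_ball_iff_norm.1 hu.2
      · have h3 : ‖η • φ (s, u)‖ ≤ η * C := by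
          rw [norm_smul, Real.norm_of_nonneg hη.le]
          exact mul_le_mul_of_nonneg_left (hC _) hη.le
        have h4 : u + η • φ (s, u) - c.coord.toFun y₀ =
          (u - c.coord.toFun y₀) + η • φ (s, u) := by abel
        rw [h4]
        refine (norm_add_le _ _).trans_lt ?_
        linarith) (fun s => by
      refine LipschitzWith.of_dist_le_mul fun u u' => ?_
      change dist (u + η • φ (s, u) - u) (u' + η • φ (s, u') - u') ≤ _
      rw [add_sub_cancel_left, add_sub_cancel_left, dist_smul₀, Real.norm_of_nonneg hη.le]
      have h4 := hK.dist_le_mul (s, u) (s, u')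
      rw [dist_prod_same_left] at h4
      have h6 := dist_nonneg (x := u) (y := u')
      calc η * dist (φ (s, u)) (φ (s, u')) ≤ η * (K * dist u u') :=
            mul_le_mul_of_nonneg_left h4 hη.le
        _ = η * K * dist u u' := by ring
        _ ≤ 1 / 2 * dist u u' := mul_le_mul_of_nonneg_right hηK.le h6
        _ = _ := by simp)
  have hW : ∀ v ∈ Metric.ball (0 : Y.E × (Y.E →L[ℝ] Y.E)) 1,
      ∀ u ∈ Metric.ball (c.coord.toFun y₀ : Y.E) (c.r / 4),
      W.toFun (v, u) = u + η • (v.1 + v.2 u) := by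
    intro v hv u hu
    have h3 : g v = 1 := g.one_of_mem_closedBall (Metric.ball_subset_closedBall hv)
    have h4 : f u = 1 := f.one_of_mem_closedBall (Metric.ball_subset_closedBall hu)
    change u + η • φ (v, u) = _
    simp [φ, h3, h4]
  refine ⟨Θ, η, hη, hc, ?_, ?_⟩
  · refine Emb.ext fun x => ?_
    by_cases hx : x ∈ c.dom
    · refine c.coord_injOn (h1 0 x hx).1 hx ?_
      rw [(h1 0 x hx).2]
      change c.coord.toFun x + η • φ (0, c.coord.toFun x) = c.coord.toFun x
      simp [φ]
    · exact h2 0 x hx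
  · intro v hv y hy hy'
    refine ⟨(h1 v y hy).1, ?_, fun w => ?_⟩
    · rw [(h1 v y hy).2, hW v hv _ hy']
    · have e : (c.coord.comp (Θ v).toSmoothMap).D y = ((W.slice v).comp c.coord).D y := by
        refine SmoothMap.D_congr ?_
        filter_upwards [c.isOpen_dom.mem_nhds hy] with z hz using (h1 v z hz).2
      rw [← SmoothMap.D_comp_apply, e, SmoothMap.D_comp_apply, SmoothMap.D_eq_fderiv]
      have e2 : (W.slice v).toFun =ᶠ[𝓝 (c.coord.toFun y)] fun u => u + η • (v.1 + v.2 u) := by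
        filter_upwards [Metric.isOpen_ball.mem_nhds hy'] with u hu using hW v hv u hu
      have e3 : HasFDerivAt (fun u : Y.E => u + η • (v.1 + v.2 u))
          (ContinuousLinearMap.id ℝ Y.E + η • v.2) (c.coord.toFun y) :=
        (hasFDerivAt_id _).add ((v.2.hasFDerivAt.const_add v.1).const_smul η)
      rw [e2.fderiv_eq, e3.fderiv]
      rfl

/-- A frame at a point of a chart, as a linear map in coordinates. -/
def frameMap (c : LocalChart Y.toSmoothMfd y₀) (z : Frame Y) : (Fin d → ℝ) →L[ℝ] Y.E :=
  ∑ i, (ContinuousLinearMap.proj i).smulRight (c.coord.D z.pt (z.v i) : Y.E)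

theorem frameMap_apply (c : LocalChart Y.toSmoothMfd y₀) (z : Frame Y) (w : Fin d → ℝ) :
    c.frameMap z w = ∑ i, w i • (c.coord.D z.pt (z.v i) : Y.E) := by
  simp [frameMap]

theorem frameMap_single (c : LocalChart Y.toSmoothMfd y₀) (z : Frame Y) (i : Fin d) :
    c.frameMap z (Pi.single i 1) = c.coord.D z.pt (z.v i) := by
  rw [frameMap_apply, Finset.sum_eq_single i] <;> simp +contextual

theorem continuous_frameMap (c : LocalChart Y.toSmoothMfd y₀) : Continuous c.frameMap := by
  refine continuous_clm_apply.2 fun w => ?_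
  simp only [frameMap_apply]
  refine continuous_finsetSum _ fun i _ => ?_
  have h := (SmoothMap.continuous_D_apply (X := Y.toSmoothMfd) (E := Y.E)).comp
    ((continuous_const (y := c.coord)).prodMk (Frame.continuous_vec (X := Y) i))
  exact h.const_smul (w i)

theorem frameMap_isInvertible (c : LocalChart Y.toSmoothMfd y₀) {z : Frame Y} (hz : z.pt ∈ c.dom) :
    (c.frameMap z).IsInvertible := by
  have hinj : Function.Injective (c.frameMap z) := by
    have h := (z.linearIndependent_v.map' (c.coord.D z.pt).toLinearMap
      (LinearMap.ker_eq_bot.2 (c.D_coord_injective _ hz)))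
    refine (injective_iff_map_eq_zero _).2 fun w hw => ?_
    rw [frameMap_apply] at hw
    exact funext (Fintype.linearIndependent_iff.1 h w hw)
  have hd : Module.finrank ℝ (Fin d → ℝ) = Module.finrank ℝ Y.E := by
    rw [Y.finrank_E]; simp
  exact ⟨(LinearEquiv.ofInjectiveOfFinrankEq (c.frameMap z).toLinearMap hinj hd
    ).toContinuousLinearEquiv, by ext; rfl⟩

theorem frame_ext (c : LocalChart Y.toSmoothMfd y₀) {z w : Frame Y} (hz : z.pt ∈ c.dom)
    (hw : w.pt ∈ c.dom) (h : c.coord.toFun z.pt = c.coord.toFun w.pt)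
    (h' : ∀ i, c.coord.D z.pt (z.v i) = c.coord.D w.pt (w.v i)) : z = w := by
  have hp : z.pt = w.pt := c.coord_injOn hz hw h
  refine Frame.ext' hp fun i => c.D_coord_injective _ hw ?_
  rw [← h', hp]

end LocalChart

/-- Near a frame at an interior point, any frame can be moved to any other one by a
diffeomorphism depending continuously on both. -/
theorem Frame.exists_move (z₀ : Frame Y) (hz₀ : Y.I.IsInteriorPoint z₀.pt) :
    ∃ (U : Set (Frame Y)) (M : ℝ → Frame Y → Frame Y → Emb Y.toSmoothMfd Y.toSmoothMfd),
      IsOpen U ∧ z₀ ∈ U ∧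
      ContinuousOn (fun p : ℝ × Frame Y × Frame Y => M p.1 p.2.1 p.2.2)
        {p | p.2.1 ∈ U ∧ p.2.2 ∈ U} ∧
      (∀ z z', M 0 z z' = Emb.id _) ∧ (∀ l, ∀ z ∈ U, M l z z = Emb.id _) ∧
      ∀ z ∈ U, ∀ z' ∈ U, push rfl (M 1 z z') z = z' := by
  obtain ⟨c, hc⟩ := exists_localChart_of_isInteriorPoint hz₀
  obtain ⟨Θ, η, hη, hΘ, hΘ0, hΘ1⟩ := c.exists_affine hc
  have hr := c.r_pos
  let O : Set (Frame Y) := {z | z.pt ∈ c.dom ∧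
    (c.coord.toFun z.pt : Y.E) ∈ Metric.ball (c.coord.toFun z₀.pt : Y.E) (c.r / 4)}
  have hO : IsOpen O := (c.isOpen_dom.inter
    (Metric.isOpen_ball.preimage c.coord.smooth.continuous)).preimage continuous_pt
  have hO0 : z₀ ∈ O := ⟨c.mem_dom, Metric.mem_ball_self (by positivity)⟩
  let p : Frame Y → Y.E := fun z => c.coord.toFun z.pt
  have hp : Continuous p := c.coord.smooth.continuous.comp continuous_pt
  -- In coordinates, `id + B (z, z')` is the linear map carrying the vectors of `z` to those of
  -- `z'`.
  let B : Frame Y × Frame Y → (Y.E →L[ℝ] Y.E) := fun q =>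
    (c.frameMap q.2).comp (c.frameMap q.1).inverse - ContinuousLinearMap.id ℝ Y.E
  have hB : ContinuousOn B (O ×ˢ O) := by
    refine ContinuousOn.sub (ContinuousOn.clm_comp
      (c.continuous_frameMap.comp continuous_snd).continuousOn ?_) continuousOn_const
    intro q hq
    obtain ⟨e, he⟩ := c.frameMap_isInvertible hq.1.1
    -- Inversion is continuous near an invertible operator; `O` only contains frames over the chart
    -- domain, where `frameMap` is invertible.
    have h1 := (contDiffAt_map_inverse (𝕜 := ℝ) (n := 0) e).continuousAt
    rw [he] at h1
    exact (ContinuousAt.comp (f := fun q : Frame Y × Frame Y => c.frameMap q.1) h1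
      (c.continuous_frameMap.comp continuous_fst).continuousAt).continuousWithinAt
  have hB1 : ∀ z ∈ O, B (z, z) = 0 := fun z hz => by
    simp only [B]
    rw [(c.frameMap_isInvertible hz.1).self_comp_inverse, sub_self]
  have hB2 : ∀ z ∈ O, ∀ z' i, B (z, z') (c.coord.D z.pt (z.v i)) =
      c.coord.D z'.pt (z'.v i) - c.coord.D z.pt (z.v i) := fun z hz z' i => by
    simp only [B]
    rw [← c.frameMap_single z i, ← c.frameMap_single z' i, sub_apply,
      ContinuousLinearMap.comp_apply, ← ContinuousLinearMap.comp_apply (c.frameMap z).inverse,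
      (c.frameMap_isInvertible hz.1).inverse_comp_self]
    rfl
  -- The translation part is chosen so that `u ↦ u + b + B u` sends the base point of `z` to that of
  -- `z'`.
  let mv : Frame Y × Frame Y → Y.E × (Y.E →L[ℝ] Y.E) := fun q =>
    η⁻¹ • (p q.2 - p q.1 - B q (p q.1), B q)
  have hmv : ContinuousOn mv (O ×ˢ O) := by
    have h : ContinuousOn (fun q => (p q.2 - p q.1 - B q (p q.1), B q)) (O ×ˢ O) :=
      ContinuousOn.prodMk (ContinuousOn.sub
        ((hp.comp continuous_snd).sub (hp.comp continuous_fst)).continuousOn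
        (hB.clm_apply (hp.comp continuous_fst).continuousOn)) hB
    exact h.const_smul η⁻¹
  have hmv0 : ∀ z ∈ O, mv (z, z) = 0 := fun z hz => by
    simp only [mv]
    rw [hB1 z hz]
    simp
  have hOO : O ×ˢ O ∈ 𝓝 (z₀, z₀) := (hO.prod hO).mem_nhds ⟨hO0, hO0⟩
  -- The parameter vanishes on the diagonal, so by continuity it stays in the unit ball, where
  -- `exists_affine` is explicit, on some square neighbourhood.
  have hev : {q | q ∈ O ×ˢ O ∧ mv q ∈ Metric.ball 0 1} ∈ 𝓝 (z₀, z₀) := by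
    have h : Metric.ball 0 1 ∈ 𝓝 (mv (z₀, z₀)) := by
      rw [hmv0 z₀ hO0]
      exact Metric.ball_mem_nhds _ one_pos
    exact Filter.inter_mem hOO ((hmv.continuousAt hOO).preimage_mem_nhds h)
  obtain ⟨U, hU, hU0, hUU⟩ : ∃ U, IsOpen U ∧ z₀ ∈ U ∧
      U ×ˢ U ⊆ {q | q ∈ O ×ˢ O ∧ mv q ∈ Metric.ball 0 1} := by
    obtain ⟨u, hu, v, hv, huv⟩ := mem_nhds_prod_iff.1 hev
    obtain ⟨U, hU, hU1, hU2⟩ := mem_nhds_iff.1 (Filter.inter_mem hu hv)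
    exact ⟨U, hU1, hU2, fun q hq => huv ⟨(hU hq.1).1, (hU hq.2).2⟩⟩
  have hUO : U ⊆ O := fun z hz => (hUU (show (z, z) ∈ U ×ˢ U from ⟨hz, hz⟩)).1.1
  refine ⟨U, fun l z z' => Θ (l • mv (z, z')), hU, hU0, ?_, ?_, ?_, ?_⟩
  · refine hΘ.comp_continuousOn (continuous_fst.continuousOn.smul
      (hmv.comp continuous_snd.continuousOn fun q hq => ⟨hUO hq.1, hUO hq.2⟩))
  · intro z z'
    beta_reduce
    rw [zero_smul, hΘ0]
  · intro l z hz
    beta_reduce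
    rw [hmv0 z (hUO hz), smul_zero, hΘ0]
  · intro z hz z' hz'
    have hq := (hUU (show (z, z') ∈ U ×ˢ U from ⟨hz, hz'⟩)).2
    obtain ⟨h1, h2, h3⟩ := hΘ1 _ hq _ (hUO hz).1 (hUO hz).2
    beta_reduce
    rw [one_smul]
    refine c.frame_ext h1 (hUO hz').1 ?_ fun i => ?_
    · refine h2.trans ?_
      change p z + η • (η⁻¹ • (p z' - p z - B (z, z') (p z)) + (η⁻¹ • B (z, z')) (p z)) = p z'
      rw [smul_apply, ← smul_add, smul_inv_smul₀ hη.ne']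
      abel
    · refine (h3 (z.v i)).trans ?_
      change c.coord.D z.pt (z.v i) + η • (η⁻¹ • B (z, z')) (c.coord.D z.pt (z.v i)) = _
      rw [smul_apply, smul_inv_smul₀ hη.ne', hB2 z (hUO hz)]
      exact add_sub_cancel _ _

end interiorChart

/-! ### Homotopies between embeddings of cubes with the same frame. -/

/-- A quantitative inverse function argument with a compact parameter space: near a parameter and
near `0`, all derivatives are within `(2 * K)⁻¹` of a fixed linear map which is antilipschitz with
constant `K`. The local neighbourhoods of `0` then combine by compactness of `P`. -/
theorem exists_uniform_injOn {V E P : Type} [NormedAddCommGroup V] [NormedSpace ℝ V]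
    [FiniteDimensional ℝ V] [NormedAddCommGroup E] [NormedSpace ℝ E] [FiniteDimensional ℝ E]
    [TopologicalSpace P] [CompactSpace P] {U : P → SmoothMap (vec V) (vec E)} (hU : Continuous U)
    (h : ∀ p, Function.Injective (fderiv ℝ (U p).toFun 0)) :
    ∀ᶠ q : V × V in 𝓝 (0, 0), ∀ p, ((U p).toFun q.1 = (U p).toFun q.2 → q.1 = q.2) ∧
      Function.Injective (fderiv ℝ (U p).toFun q.1) := by
  suffices key : ∀ᶠ q : V × V in 𝓝 (0, 0), ∀ p ∈ (Set.univ : Set P),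
      ((U p).toFun q.1 = (U p).toFun q.2 → q.1 = q.2) ∧
      Function.Injective (fderiv ℝ (U p).toFun q.1) by simpa using key
  refine isCompact_univ.eventually_forall_of_forall_eventually fun p₀ _ => ?_
  obtain ⟨K, hK, hA⟩ := (fderiv ℝ (U p₀).toFun 0).toLinearMap.exists_antilipschitzWith
    (LinearMap.ker_eq_bot.2 (h p₀))
  have hK' : (0 : ℝ) < K := hK
  have hA' : ∀ v, ‖v‖ ≤ K * ‖fderiv ℝ (U p₀).toFun 0 v‖ := fun v => by
    have := hA.le_mul_dist v 0
    rwa [map_zero, dist_zero_right, dist_zero_right] at this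
  have hc : Continuous fun q : P × V => fderiv ℝ (U q.1).toFun q.2 :=
    SmoothMap.continuous_fderiv.comp ((hU.comp continuous_fst).prodMk continuous_snd)
  have hnear : ∀ᶠ q : P × V in 𝓝 (p₀, 0),
      ‖fderiv ℝ (U q.1).toFun q.2 - fderiv ℝ (U p₀).toFun 0‖ < (2 * K : ℝ)⁻¹ := by
    have h1 := hc.continuousAt (x := (p₀, 0)) |>.sub
      (continuousAt_const (y := fderiv ℝ (U p₀).toFun 0))
    refine h1.norm.eventually_lt (continuousAt_const (y := (2 * K : ℝ)⁻¹)) ?_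
    simpa using hK
  rw [nhds_prod_eq, Filter.eventually_prod_iff] at hnear
  obtain ⟨a, ha, b, hb, hab⟩ := hnear
  obtain ⟨δ, hδ, hb⟩ := Metric.eventually_nhds_iff_ball.1 hb
  have hball : ∀ᶠ q : V × V in 𝓝 (0, 0), q.1 ∈ Metric.ball 0 δ ∧ q.2 ∈ Metric.ball 0 δ :=
    prod_mem_nhds (Metric.ball_mem_nhds _ hδ) (Metric.ball_mem_nhds _ hδ)
  filter_upwards [hball.prod_nhds ha] with z hz
  obtain ⟨⟨h1, h2⟩, h3⟩ := hz
  have hcontr : ∀ v : V, ‖fderiv ℝ (U p₀).toFun 0 v‖ ≤ (2 * K : ℝ)⁻¹ * ‖v‖ → v = 0 := by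
    intro v hv
    have h4 := (hA' v).trans (mul_le_mul_of_nonneg_left hv hK'.le)
    have h5 : (K : ℝ) * ((2 * K : ℝ)⁻¹ * ‖v‖) = ‖v‖ / 2 := by field_simp
    rw [h5] at h4
    exact norm_le_zero_iff.1 (by linarith)
  constructor
  · intro he
    -- The mean value inequality bounds the deviation of `U` from the fixed linear map on the
    -- difference of the two points; if their values agree, `hcontr` applies to that difference.
    have h4 := (convex_ball (0 : V) δ).norm_image_sub_le_of_norm_fderiv_le'
      (f := (U z.2).toFun) (φ := fderiv ℝ (U p₀).toFun 0) (𝕜 := ℝ)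
      (fun v _ => (U z.2).contDiff.differentiable (by simp) v)
      (fun v hv => (hab h3 (hb v hv)).le) h1 h2
    rw [he, sub_self, zero_sub, norm_neg] at h4
    exact (sub_eq_zero.1 (hcontr _ h4)).symm
  · refine (injective_iff_map_eq_zero _).2 fun v hv => hcontr v ?_
    have h4 := ContinuousLinearMap.le_of_opNorm_le _ (hab h3 (hb _ h1)).le v
    rwa [sub_apply, hv, zero_sub, norm_neg] at h4

/-- Linear interpolation `(t, a, b) ↦ a + t (b - a)`. -/
def lerpMap (E : Type) [NormedAddCommGroup E] [NormedSpace ℝ E] [FiniteDimensional ℝ E] :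
    SmoothMap ((vec ℝ).prod ((vec E).prod (vec E))) (vec E) where
  toFun q := q.2.1 + q.1 • (q.2.2 - q.2.1 : E)
  smooth :=
    (contMDiff_fst.comp contMDiff_snd).add (contMDiff_fst.smul
      ((contMDiff_snd.comp contMDiff_snd).sub (contMDiff_fst.comp contMDiff_snd)))

section fiberHomotopy
variable {n : ℕ} {Y : CornerMfd (0 + n)} {y₀ : Y.M}

namespace LocalChart

/-- An embedding of the cube, near the centre, in a chart. -/
def germ (c : LocalChart Y.toSmoothMfd y₀) (g : Emb (cube n).toSmoothMfd Y.toSmoothMfd) :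
    SmoothMap (vec (CubeVec n)) (vec Y.E) := c.coord.comp (g.toSmoothMap.comp (cubeMap n))

theorem continuous_germ (c : LocalChart Y.toSmoothMfd y₀) :
    Continuous (c.germ : Emb (cube n).toSmoothMfd Y.toSmoothMfd → _) :=
  (SmoothMap.continuous_comp_left c.coord).comp
    ((SmoothMap.continuous_comp_right (cubeMap n)).comp Emb.continuous_toSmoothMap)

theorem germ_zero (c : LocalChart Y.toSmoothMfd y₀)
    (g : Emb (cube n).toSmoothMfd Y.toSmoothMfd) :
    (c.germ g).toFun (0 : CubeVec n) = c.coord.toFun (Frame.push rfl g (Frame.std n)).pt := by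
  change c.coord.toFun (g.toFun ((cubeMap n).toFun (0 : CubeVec n))) =
    c.coord.toFun (g.toFun (Frame.std n).pt)
  rw [Frame.std_pt]

theorem frameMap_eq (c : LocalChart Y.toSmoothMfd y₀) {z : Frame Y} {A : CubeVec n →L[ℝ] Y.E}
    (h : ∀ i, A (Pi.single i 1) = c.coord.D z.pt (z.v i)) : A = c.frameMap z := by
  refine ContinuousLinearMap.coe_injective ((Pi.basisFun ℝ (Fin (0 + n))).ext fun i => ?_)
  rw [Pi.basisFun_apply]
  exact (h i).trans (c.frameMap_single z i).symm

/-- With `germ_zero`, this identifies the frame at the centre of an embedded cube with the value and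
derivative of its germ at `0`. Linear interpolation of germs therefore preserves a common frame. -/
theorem fderiv_germ (c : LocalChart Y.toSmoothMfd y₀)
    (g : Emb (cube n).toSmoothMfd Y.toSmoothMfd) :
    fderiv ℝ (c.germ g).toFun (0 : CubeVec n) =
      c.frameMap (Frame.push rfl g (Frame.std n)) := by
  refine c.frameMap_eq fun i => ?_
  rw [← SmoothMap.D_eq_fderiv, germ, SmoothMap.D_comp_apply, SmoothMap.D_comp_apply,
    Frame.push_v, ← Frame.std_v]
  change c.coord.D (g.toFun ((cubeMap n).toFun (0 : CubeVec n))) (g.toSmoothMap.D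
    ((cubeMap n).toFun (0 : CubeVec n)) ((Frame.std n).v i)) =
      c.coord.D (g.toFun (Frame.std n).pt) (g.toSmoothMap.D (Frame.std n).pt ((Frame.std n).v i))
  rw [Frame.std_pt]

/-- Embeddings of the cube given in a chart. -/
theorem exists_emb (c : LocalChart Y.toSmoothMfd y₀)
    (hc : Metric.ball (c.coord.toFun y₀ : Y.E) c.r ⊆ Set.range Y.I)
    {ψ : SmoothMap (vec Y.E) Y.toSmoothMfd}
    (hψ : ∀ u ∈ Metric.ball (c.coord.toFun y₀ : Y.E) (c.r / 2), ψ.toFun u = c.inv u)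
    {U : SmoothMap (vec (CubeVec n)) (vec Y.E)} {R δ : ℝ} (hR : 0 < R) (hRδ : R⁻¹ < δ)
    (hU : ∀ v ∈ Metric.ball (0 : CubeVec n) δ, U.toFun v ∈
      Metric.ball (c.coord.toFun y₀ : Y.E) (c.r / 2))
    (hinj : Set.InjOn U.toFun (Metric.ball (0 : CubeVec n) δ))
    (hD : ∀ v ∈ Metric.ball (0 : CubeVec n) δ, Function.Injective (fderiv ℝ U.toFun v)) :
    ∃ f : Emb (cube n).toSmoothMfd Y.toSmoothMfd,
      f.toSmoothMap = ψ.comp (U.comp (cubeCoord R n)) ∧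
      ∀ z : Frame Y, z.pt ∈ c.dom → U.toFun (0 : CubeVec n) = c.coord.toFun z.pt →
        fderiv ℝ U.toFun (0 : CubeVec n) = c.frameMap z → Frame.push rfl f (Frame.std n) = z := by
  have hr := c.r_pos
  -- All coordinates of the squeezed cube are bounded by `R⁻¹ < δ`, so only the behaviour of `U` on
  -- the small ball matters.
  have hq : ∀ q, (show CubeVec n from (cubeCoord R n).toFun q) ∈ Metric.ball (0 : CubeVec n) δ := by
    intro q
    rw [mem_ball_zero_iff]
    refine lt_of_le_of_lt ?_ hRδ
    have := abs_mul_cubeCoord_le R n q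
    rwa [abs_of_pos hR, ← le_div_iff₀' hR, one_div] at this
  have hin : ∀ q, U.toFun ((cubeCoord R n).toFun q) ∈
      Set.range Y.I ∩ Metric.ball (c.coord.toFun y₀ : Y.E) c.r := fun q =>
    have h := Metric.ball_subset_ball (by linarith) (hU _ (hq q))
    ⟨hc h, h⟩
  -- The chart undoes `ψ` on the relevant ball. Injectivity of the composite and of its derivatives
  -- thus reduces to that of `U.comp (cubeCoord R n)`.
  have hcoord : c.coord.comp (ψ.comp (U.comp (cubeCoord R n))) = U.comp (cubeCoord R n) := by
    refine SmoothMap.ext fun q => ?_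
    change c.coord.toFun (ψ.toFun (U.toFun ((cubeCoord R n).toFun q))) = _
    rw [hψ _ (hU _ (hq q)), c.coord_inv _ (hin q)]
    rfl
  have hinj' : Function.Injective (ψ.comp (U.comp (cubeCoord R n))).toFun := by
    have h : Function.Injective (U.comp (cubeCoord R n)).toFun := fun a b hab =>
      cubeCoord_injective R n (hinj (hq a) (hq b) hab)
    rw [← hcoord] at h
    exact Function.Injective.of_comp (f := c.coord.toFun) h
  have hD' : ∀ q, Function.Injective ((ψ.comp (U.comp (cubeCoord R n))).D q) := by
    intro q
    have h : Function.Injective ((U.comp (cubeCoord R n)).D q) := by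
      rw [SmoothMap.D_comp, SmoothMap.D_eq_fderiv]
      exact (hD _ (hq q)).comp (D_cubeCoord_injective R n q)
    rw [← hcoord, SmoothMap.D_comp] at h
    exact Function.Injective.of_comp (f := c.coord.D _) h
  refine ⟨Emb.ofInjective rfl _ hinj' hD', rfl, fun z hz h0 h1 => ?_⟩
  have hcz : (cubeCoord R n).toFun (Frame.std n).pt = (0 : CubeVec n) := by
    rw [Frame.std_pt, cubeCoord_cubeMap]
    funext i
    simp
  refine c.frame_ext ?_ hz ?_ fun i => ?_
  · change ψ.toFun (U.toFun ((cubeCoord R n).toFun (Frame.std n).pt)) ∈ c.dom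
    rw [hψ _ (hU _ (hq _))]
    exact c.inv_mem _ (hin _)
  · refine (congrArg (fun f => f.toFun (Frame.std n).pt) hcoord).trans ?_
    change U.toFun ((cubeCoord R n).toFun (Frame.std n).pt) = _
    rw [hcz, h0]
  · have h2 := SmoothMap.D_comp_apply c.coord (ψ.comp (U.comp (cubeCoord R n))) (Frame.std n).pt
      ((Frame.std n).v i)
    refine h2.symm.trans ?_
    rw [hcoord, SmoothMap.D_comp_apply, hcz, SmoothMap.D_eq_fderiv, h1, Frame.std_v, Frame.std_pt,
      ← SmoothMap.D_comp_apply, D_cubeCoord_cubeMap]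
    exact c.frameMap_single z i

end LocalChart

/-- The affine map with the prescribed value and derivative, read through the chart on a
sufficiently small cube, realizes the frame. -/
theorem Frame.exists_push_std_eq (z : Frame Y) (hz : Y.I.IsInteriorPoint z.pt) :
    ∃ f : Emb (cube n).toSmoothMfd Y.toSmoothMfd, push rfl f (std n) = z := by
  obtain ⟨c, hc⟩ := exists_localChart_of_isInteriorPoint hz
  obtain ⟨ψ, hψ⟩ := c.exists_param hc
  have hr := c.r_pos
  have hA : Function.Injective (c.frameMap z) := (c.frameMap_isInvertible c.mem_dom).injective
  let U : SmoothMap (ThickMfd.vec (CubeVec n)) (ThickMfd.vec Y.E) :=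
    SmoothMap.ofContDiff (fun v => (c.coord.toFun z.pt : Y.E) + c.frameMap z v)
      (contDiff_const.add (c.frameMap z).contDiff)
  have hUd : ∀ v : CubeVec n, fderiv ℝ U.toFun v = c.frameMap z := fun v =>
    ((c.frameMap z).hasFDerivAt.const_add _).fderiv
  have hball : U.toFun ⁻¹' Metric.ball (c.coord.toFun z.pt : Y.E) (c.r / 2) ∈ 𝓝 (0 : CubeVec n) := by
    refine U.smooth.continuous.continuousAt.preimage_mem_nhds (Metric.isOpen_ball.mem_nhds ?_)
    change (c.coord.toFun z.pt : Y.E) + c.frameMap z 0 ∈ _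
    rw [map_zero, add_zero]
    exact Metric.mem_ball_self (by positivity)
  obtain ⟨δ, hδ, hδ'⟩ := Metric.mem_nhds_iff.1 hball
  obtain ⟨f, -, hf⟩ := c.exists_emb hc hψ (U := U) (R := 2 / δ) (δ := δ) (by positivity)
    (by rw [inv_div]; linarith) (fun v hv => hδ' hv)
    (fun v _ w _ h => hA (add_left_cancel h)) (fun v _ => by rw [hUd]; exact hA)
  refine ⟨f, hf z c.mem_dom ?_ (hUd _)⟩
  change (c.coord.toFun z.pt : Y.E) + c.frameMap z 0 = _
  rw [map_zero, add_zero]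

open ContinuousMap unitInterval in
/-- Locally, two families of embeddings of the cube with the same frames at the centre are
homotopic. -/
theorem Frame.exists_homotopyWith (z₀ : Frame Y) (hz₀ : Y.I.IsInteriorPoint z₀.pt) :
    ∃ U : Set (Frame Y), IsOpen U ∧ z₀ ∈ U ∧ ∀ (D : Type) [TopologicalSpace D] [CompactSpace D]
      (g g' : C(D, Emb (cube n).toSmoothMfd Y.toSmoothMfd)) (F : D → Frame Y), (∀ x, F x ∈ U) →
      (∀ x, push rfl (g x) (std n) = F x) → (∀ x, push rfl (g' x) (std n) = F x) →
      Nonempty (HomotopyWith g g' fun f => ∀ x, push rfl (f x) (std n) = F x) := by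
  obtain ⟨c, hc⟩ := exists_localChart_of_isInteriorPoint hz₀
  obtain ⟨ψ, hψ⟩ := c.exists_param hc
  have hr := c.r_pos
  refine ⟨{z | z.pt ∈ c.dom ∧
    (c.coord.toFun z.pt : Y.E) ∈ Metric.ball (c.coord.toFun z₀.pt : Y.E) (c.r / 2)},
    (c.isOpen_dom.inter
      (Metric.isOpen_ball.preimage c.coord.smooth.continuous)).preimage continuous_pt,
    ⟨c.mem_dom, Metric.mem_ball_self (by positivity)⟩, ?_⟩
  intro D _ _ g g' F hF hg hg'
  let u : D → SmoothMap (ThickMfd.vec (CubeVec n)) (ThickMfd.vec Y.E) := fun x => c.germ (g x)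
  let u' : D → SmoothMap (ThickMfd.vec (CubeVec n)) (ThickMfd.vec Y.E) := fun x => c.germ (g' x)
  -- `U (t, x)` interpolates linearly between the two germs. They share their value and derivative
  -- at `0`, so every intermediate map has them too.
  let U : I × D → SmoothMap (ThickMfd.vec (CubeVec n)) (ThickMfd.vec Y.E) := fun p =>
    (lerpMap Y.E).comp ((SmoothMap.const _ (p.1 : ℝ)).pair ((u p.2).pair (u' p.2)))
  have hu : Continuous fun p : I × D => (u p.2).pair (u' p.2) :=
    SmoothMap.continuous_pair.comp
      ((c.continuous_germ.comp (g.continuous.comp continuous_snd)).prodMk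
      (c.continuous_germ.comp (g'.continuous.comp continuous_snd)))
  have ht : Continuous fun p : I × D =>
      (SmoothMap.const (ThickMfd.vec (CubeVec n)) (p.1 : ℝ) : SmoothMap _ (ThickMfd.vec ℝ)) :=
    (SmoothMap.continuous_const (T := ThickMfd.vec ℝ)).comp
      (continuous_subtype_val.comp continuous_fst)
  have hUc : Continuous U := (SmoothMap.continuous_comp_left _).comp
    (SmoothMap.continuous_pair.comp (ht.prodMk hu))
  have hU : ∀ p v, (U p).toFun v =
      (u p.2).toFun v + (p.1 : ℝ) • ((u' p.2).toFun v - (u p.2).toFun v : Y.E) := fun _ _ => rfl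
  have hU0 : ∀ p, (U p).toFun (0 : CubeVec n) = c.coord.toFun (F p.2).pt := by
    intro p
    have h1 : (u p.2).toFun (0 : CubeVec n) = c.coord.toFun (F p.2).pt := by
      rw [← hg]; exact c.germ_zero _
    have h2 : (u' p.2).toFun (0 : CubeVec n) = c.coord.toFun (F p.2).pt := by
      rw [← hg']; exact c.germ_zero _
    rw [hU, h1, h2, sub_self, smul_zero, add_zero]
  have hUd : ∀ p, fderiv ℝ (U p).toFun (0 : CubeVec n) = c.frameMap (F p.2) := by
    intro p
    have h1 : HasFDerivAt (u p.2).toFun (c.frameMap (F p.2)) (0 : CubeVec n) := by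
      have h := ((u p.2).contDiff.differentiable (by simp) (0 : CubeVec n)).hasFDerivAt
      rw [← hg, ← c.fderiv_germ]; exact h
    have h2 : HasFDerivAt (u' p.2).toFun (c.frameMap (F p.2)) (0 : CubeVec n) := by
      have h := ((u' p.2).contDiff.differentiable (by simp) (0 : CubeVec n)).hasFDerivAt
      rw [← hg', ← c.fderiv_germ]; exact h
    have h3 := h1.add ((h2.sub h1).const_smul (p.1 : ℝ))
    rw [sub_self, smul_zero, add_zero] at h3
    exact h3.fderiv
  have hinj := exists_uniform_injOn hUc fun p => by
    rw [hUd]; exact (c.frameMap_isInvertible (hF p.2).1).injective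
  have hball : ∀ᶠ v : CubeVec n in 𝓝 0, ∀ p ∈ (Set.univ : Set (I × D)),
      (U p).toFun v ∈ Metric.ball (c.coord.toFun z₀.pt : Y.E) (c.r / 2) := by
    refine isCompact_univ.eventually_forall_of_forall_eventually fun p _ => ?_
    have h : Continuous fun z : CubeVec n × (I × D) => (U z.2).toFun z.1 :=
      SmoothMap.continuous_eval.comp ((hUc.comp continuous_snd).prodMk continuous_fst)
    refine h.continuousAt.preimage_mem_nhds (Metric.isOpen_ball.mem_nhds ?_)
    change (U p).toFun (0 : CubeVec n) ∈ _
    rw [hU0]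
    exact (hF p.2).2
  -- The given embeddings must map the small cube into the chart domain; only there can they be
  -- recovered from their coordinates.
  have hdom : ∀ f : C(D, Emb (cube n).toSmoothMfd Y.toSmoothMfd),
      (∀ x, push rfl (f x) (std n) = F x) → ∀ᶠ v : CubeVec n in 𝓝 0, ∀ x ∈ (Set.univ : Set D),
        (f x).toFun ((cubeMap n).toFun v) ∈ c.dom := by
    intro f hf
    refine isCompact_univ.eventually_forall_of_forall_eventually fun x _ => ?_
    have h : Continuous fun z : CubeVec n × D => (f z.2).toFun ((cubeMap n).toFun z.1) :=
      SmoothMap.continuous_eval.comp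
        ((Emb.continuous_toSmoothMap.comp (f.continuous.comp continuous_snd)).prodMk
        ((cubeMap n).smooth.continuous.comp continuous_fst))
    refine h.continuousAt.preimage_mem_nhds (c.isOpen_dom.mem_nhds ?_)
    have h1 := (hF x).1
    rw [← hf x] at h1
    change (f x).toFun ((cubeMap n).toFun (0 : CubeVec n)) ∈ c.dom
    rw [← std_pt]
    exact h1
  obtain ⟨δ₁, hδ₁, h₁⟩ := Metric.eventually_nhds_iff_ball.1 hinj
  obtain ⟨δ₂, hδ₂, h₂⟩ := Metric.eventually_nhds_iff_ball.1 (hball.and ((hdom g hg).and (hdom g' hg')))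
  let δ := min δ₁ δ₂
  have hδ : 0 < δ := lt_min hδ₁ hδ₂
  have hδ1 : ∀ {v : CubeVec n}, v ∈ Metric.ball 0 δ → v ∈ Metric.ball 0 δ₁ :=
    fun h => Metric.ball_subset_ball (min_le_left _ _) h
  have hδ2 : ∀ {v : CubeVec n}, v ∈ Metric.ball 0 δ → v ∈ Metric.ball 0 δ₂ :=
    fun h => Metric.ball_subset_ball (min_le_right _ _) h
  have hpair : ∀ {v w : CubeVec n}, v ∈ Metric.ball 0 δ → w ∈ Metric.ball 0 δ →
      (v, w) ∈ Metric.ball ((0 : CubeVec n), (0 : CubeVec n)) δ₁ := fun hv hw => by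
    rw [← ball_prod_same]; exact ⟨hδ1 hv, hδ1 hw⟩
  have hRδ : (2 / δ)⁻¹ < δ := by rw [inv_div]; linarith
  have hR : 0 < 2 / δ := by positivity
  choose h hh hh' using fun p => c.exists_emb hc hψ (U := U p) (R := 2 / δ) (δ := δ) hR hRδ
    (fun v hv => (h₂ v (hδ2 hv)).1 p trivial)
    (fun v hv w hw => (h₁ (v, w) (hpair hv hw) p).1)
    (fun v hv => (h₁ (v, v) (hpair hv hv) p).2)
  have hcont : Continuous h := by
    refine Emb.continuous_iff.2 ?_
    simp only [hh]
    exact (SmoothMap.continuous_comp_left ψ).comp ((SmoothMap.continuous_comp_right _).comp hUc)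
  let S : ℝ := √(1 + (2 / δ) ^ 2)
  -- At either end the construction gives the original embedding precomposed with `shrink n S`,
  -- since going to coordinates and back is a squeeze.
  have hend : ∀ (t : I) (f : C(D, Emb (cube n).toSmoothMfd Y.toSmoothMfd)),
      (∀ v ∈ Metric.ball (0 : CubeVec n) δ, ∀ x, (f x).toFun ((cubeMap n).toFun v) ∈ c.dom) →
      (∀ x v, (U (t, x)).toFun v = (c.germ (f x)).toFun v) →
      ∀ x, h (t, x) = (f x).comp (shrink n S) := by
    intro t f hf ht x
    refine Emb.ext fun q => ?_
    have hq : (show CubeVec n from (cubeCoord (2 / δ) n).toFun q) ∈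
        Metric.ball (0 : CubeVec n) δ := by
      rw [mem_ball_zero_iff]
      refine lt_of_le_of_lt ?_ hRδ
      have := abs_mul_cubeCoord_le (2 / δ) n q
      rwa [abs_of_pos hR, ← le_div_iff₀' hR, one_div] at this
    have h1 : (h (t, x)).toFun q =
        ψ.toFun ((U (t, x)).toFun ((cubeCoord (2 / δ) n).toFun q)) := by rw [hh]; rfl
    have h2 : (shrink n S).toFun q = (cubeMap n).toFun ((cubeCoord (2 / δ) n).toFun q) :=
      (congrArg (fun f => f.toFun q) (cubeMap_comp_cubeCoord (2 / δ) n)).symm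
    change _ = (f x).toFun ((shrink n S).toFun q)
    rw [h1, h2, hψ _ ((h₂ _ (hδ2 hq)).1 _ trivial), ht]
    exact c.inv_coord _ (hf _ hq x)
  let P : C(D, Emb (cube n).toSmoothMfd Y.toSmoothMfd) → Prop :=
    fun f => ∀ x, push rfl (f x) (std n) = F x
  let k (f : C(D, Emb (cube n).toSmoothMfd Y.toSmoothMfd)) :
      C(D, Emb (cube n).toSmoothMfd Y.toSmoothMfd) :=
    ⟨fun x => (f x).comp (shrink n S), Emb.continuous_comp.comp (f.continuous.prodMk continuous_const)⟩
  have hshrink : ∀ f, P f → Nonempty (HomotopyWith f (k f) P) := by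
    intro f hf
    refine ⟨⟨⟨⟨fun p : I × D => (f p.2).comp (shrink n (p.1 * S)), Emb.continuous_comp.comp
      ((f.continuous.comp continuous_snd).prodMk ((continuous_shrink n).comp
        ((continuous_subtype_val.comp continuous_fst).mul continuous_const)))⟩, ?_, ?_⟩, ?_⟩⟩
    · intro x
      change (f x).comp (shrink n (0 * S)) = f x
      rw [zero_mul, shrink_zero]; rfl
    · intro x
      change (f x).comp (shrink n (1 * S)) = _
      rw [one_mul]; rfl
    · intro t x
      change push rfl ((f x).comp (shrink n (t * S))) (std n) = _
      rw [← push_comp rfl rfl, push_shrink_std, hf x]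
  have hline : Nonempty (HomotopyWith (k g) (k g') P) := by
    refine ⟨⟨⟨⟨h, hcont⟩, ?_, ?_⟩, ?_⟩⟩
    · refine hend 0 g (fun v hv x => (h₂ v (hδ2 hv)).2.1 x trivial) fun x v => ?_
      rw [hU]
      change (u x).toFun v + (0 : ℝ) • ((u' x).toFun v - (u x).toFun v : Y.E) = (u x).toFun v
      rw [zero_smul, add_zero]
    · refine hend 1 g' (fun v hv x => (h₂ v (hδ2 hv)).2.2 x trivial) fun x v => ?_
      rw [hU]
      change (u x).toFun v + (1 : ℝ) • ((u' x).toFun v - (u x).toFun v : Y.E) = (u' x).toFun v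
      rw [one_smul]
      exact add_sub_cancel _ _
    · intro t x
      exact hh' (t, x) (F x) (hF x).1 (hU0 (t, x)) (hUd (t, x))
  -- The homotopy first shrinks `g`, then interpolates in the chart, then expands to `g'`; each
  -- piece keeps the frame at the centre fixed.
  obtain ⟨H₁⟩ := hshrink g hg
  obtain ⟨H₂⟩ := hline
  obtain ⟨H₃⟩ := hshrink g' hg'
  exact ⟨(H₁.trans H₂).trans H₃.symm⟩

end fiberHomotopy

/-! ### A lifting theorem for maps with local moves and homotopies. -/

section lifting
open Set ContinuousMap unitInterval
variable {E Z : Type} [TopologicalSpace E] [TopologicalSpace Z]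

/-- Over the open set `U`, the map `p : E → Z` is surjective, its points can be moved along with
their images, and any two families of points over the same family of points of `U` are homotopic
over it. -/
structure IsLocallyLiftable (p : E → Z) (U : Set Z) : Prop where
  isOpen : IsOpen U
  nonempty : ∃ e, p e ∈ U
  move : ∃ m : ℝ → Z → E → E,
    ContinuousOn (fun q : ℝ × Z × E => m q.1 q.2.1 q.2.2) {q | q.2.1 ∈ U ∧ p q.2.2 ∈ U} ∧
    (∀ z e, m 0 z e = e) ∧ (∀ l e, p e ∈ U → m l (p e) e = e) ∧
    ∀ z ∈ U, ∀ e, p e ∈ U → p (m 1 z e) = z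
  homotopy : ∀ (D : Type) [TopologicalSpace D] [CompactSpace D] (g g' : C(D, E)) (F : D → Z),
    (∀ x, F x ∈ U) → (∀ x, p (g x) = F x) → (∀ x, p (g' x) = F x) →
    Nonempty (HomotopyWith g g' fun f => ∀ x, p (f x) = F x)

variable {K : Type} [TopologicalSpace K] [CompactSpace K] [T2Space K] {p : E → Z}

theorem exists_closed_cover {F : K → Z} (hF : Continuous F)
    (hU : ∀ x, ∃ U, F x ∈ U ∧ IsLocallyLiftable p U) :
    ∃ (t : Finset K) (C : K → Set K) (U : K → Set Z), (∀ x, IsClosed (C x)) ∧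
      (∀ x, C x ⊆ F ⁻¹' U x) ∧ (∀ x, IsLocallyLiftable p (U x)) ∧ ⋃ x ∈ t, C x = univ := by
  choose U hU hU' using hU
  choose C hC hC1 hC2 using fun x => exists_mem_nhds_isClosed_subset
    (((hU' x).isOpen.preimage hF).mem_nhds (hU x))
  obtain ⟨t, -, ht⟩ := isCompact_univ.elim_nhds_subcover C fun x _ => hC x
  exact ⟨t, C, U, hC1, hC2, hU', univ_subset_iff.1 ht⟩

/-- Composing `f` with the retraction gives a map near `B` that lifts `F ∘ r` rather than `F`. The
moves correct it over one closed set of the cover at a time, and leave alone the points which are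
already correct, in particular those of `B`. -/
theorem exists_lift_nhds (hp : Continuous p) {F : K → Z} (hF : Continuous F)
    (hU : ∀ x, ∃ U, F x ∈ U ∧ IsLocallyLiftable p U) {B N : Set K} (hN : IsOpen N) (hBN : B ⊆ N)
    {r : K → K} (hr : ContinuousOn r N) (hr' : ∀ x ∈ N, r x ∈ B) (hrB : ∀ x ∈ B, r x = x)
    {f : K → E} (hf : ContinuousOn f B) (hpf : ∀ x ∈ B, p (f x) = F x) :
    ∃ (O : Set K) (g : K → E), IsOpen O ∧ B ⊆ O ∧ ContinuousOn g O ∧ (∀ x ∈ O, p (g x) = F x) ∧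
      EqOn g f B := by
  obtain ⟨t, C, U, hC, hCU, hU, ht⟩ := exists_closed_cover hF hU
  suffices key : ∀ t : Finset K, ∃ (O : Set K) (g : K → E), IsOpen O ∧ B ⊆ O ∧ ContinuousOn g O ∧
      (∀ x ∈ O, x ∈ ⋃ y ∈ t, C y → p (g x) = F x) ∧ EqOn g f B by
    obtain ⟨O, g, h1, h2, h3, h4, h5⟩ := key t
    exact ⟨O, g, h1, h2, h3, fun x hx => h4 x hx (ht ▸ mem_univ x), h5⟩
  classical
  intro t
  induction t using Finset.induction_on with
  | empty =>
    exact ⟨N, fun x => f (r x), hN, hBN, hf.comp hr hr', by simp, fun x hx => by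
      change f (r x) = f x
      rw [hrB x hx]⟩
  | insert y t _ ih =>
    obtain ⟨O, g, hO, hBO, hg, hpg, hgf⟩ := ih
    obtain ⟨m, hm, hm0, hm1, hm2⟩ := (hU y).move
    obtain ⟨V, hV, hCV, hVU⟩ := normal_exists_closure_subset (hC y) ((hU y).isOpen.preimage hF)
      (hCU y)
    -- The move runs to its end on `C y` and is switched off outside `V`.
    obtain ⟨l, hl0, hl1, -⟩ := exists_continuous_zero_one_of_isClosed (s := Vᶜ) (t := C y)
      hV.isClosed_compl (hC y) (disjoint_compl_left_iff_subset.2 hCV)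
    have hpgB : ∀ x ∈ B, p (g x) = F x := fun x hx => by rw [hgf hx, hpf x hx]
    have hlC : ∀ x ∉ closure V, l x = 0 := fun x hx => hl0 fun h => hx (subset_closure h)
    have hmF : ∀ x, p (g x) = F x → m (l x) (F x) (g x) = g x := by
      intro x hx
      by_cases hxV : x ∈ closure V
      · rw [← hx]
        exact hm1 _ _ (hx ▸ hVU hxV)
      · rw [hlC x hxV, hm0]
    have hO' : IsOpen (O ∩ (fun x => p (g x)) ⁻¹' U y) :=
      (hp.comp_continuousOn hg).isOpen_inter_preimage hO (hU y).isOpen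
    -- Moves are continuous only while both frames involved lie in `U y`. The new neighbourhood
    -- drops the points of `closure V` whose current image has left `U y`; no point of `B` is among
    -- them.
    refine ⟨(O ∩ (closure V)ᶜ) ∪ (O ∩ (fun x => p (g x)) ⁻¹' U y), fun x => m (l x) (F x) (g x),
      (hO.inter isClosed_closure.isOpen_compl).union hO', ?_, ?_, ?_, ?_⟩
    · intro x hx
      by_cases hxV : x ∈ closure V
      · exact Or.inr ⟨hBO hx, by rw [mem_preimage, hpgB x hx]; exact hVU hxV⟩
      · exact Or.inl ⟨hBO hx, hxV⟩
    · intro x hx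
      by_cases hxV : x ∈ closure V
      · have hx' : x ∈ O ∩ (fun x => p (g x)) ⁻¹' U y := hx.elim (fun h => absurd hxV h.2) fun h => h
        have hW : IsOpen ((O ∩ (fun x => p (g x)) ⁻¹' U y) ∩ F ⁻¹' U y) :=
          hO'.inter ((hU y).isOpen.preimage hF)
        have h1 : ContinuousOn (fun x => m (l x) (F x) (g x))
            ((O ∩ (fun x => p (g x)) ⁻¹' U y) ∩ F ⁻¹' U y) :=
          hm.comp (f := fun x => (l x, F x, g x)) (l.continuous.continuousOn.prodMk
            (hF.continuousOn.prodMk (hg.mono fun x hx => hx.1.1))) fun x hx => ⟨hx.2, hx.1.2⟩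
        exact (h1.continuousAt (hW.mem_nhds ⟨hx', hVU hxV⟩)).continuousWithinAt
      · have hx' : x ∈ O := hx.elim (fun h => h.1) fun h => h.1
        have hW : O ∩ (closure V)ᶜ ∈ 𝓝 x :=
          (hO.inter isClosed_closure.isOpen_compl).mem_nhds ⟨hx', hxV⟩
        refine ((hg.continuousAt (hO.mem_nhds hx')).congr ?_).continuousWithinAt
        filter_upwards [hW] with z hz
        rw [hlC z hz.2, hm0]
    · intro x hx hxt
      have hxO : x ∈ O := hx.elim (fun h => h.1) fun h => h.1
      rw [Finset.set_biUnion_insert] at hxt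
      beta_reduce
      by_cases hxt' : x ∈ ⋃ y ∈ t, C y
      · have := hpg x hxO hxt'
        rw [hmF x this, this]
      · have hxC : x ∈ C y := hxt.resolve_right hxt'
        have h1 : l x = 1 := hl1 hxC
        have h2 : p (g x) ∈ U y := hx.elim (fun h => absurd (subset_closure (hCV hxC)) h.2) fun h => h.2
        rw [h1]
        exact hm2 _ (hCU y hxC) _ h2
    · intro x hx
      exact (hmF x (hpgB x hx)).trans (hgf hx)

/-- A lift defined near a closed set can be extended over a further set, over the image of which
the map is locally liftable. -/
theorem exists_lift_union {F : K → Z} (hF : Continuous F) {U : Set Z} (hU : IsLocallyLiftable p U)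
    {A C O : Set K} (hA : IsClosed A) (hC : IsClosed C) (hCU : C ⊆ F ⁻¹' U) (hO : IsOpen O)
    (hAO : A ⊆ O) {g : K → E} (hg : ContinuousOn g O) (hpg : ∀ x ∈ O, p (g x) = F x) :
    ∃ (O' : Set K) (g' : K → E), IsOpen O' ∧ A ∪ C ⊆ O' ∧ ContinuousOn g' O' ∧
      (∀ x ∈ O', p (g' x) = F x) ∧ EqOn g' g A := by
  classical
  obtain ⟨m, hm, hm0, hm1, hm2⟩ := hU.move
  obtain ⟨e₀, he₀⟩ := hU.nonempty
  obtain ⟨V, hV, hCV, hVU⟩ := normal_exists_closure_subset hC (hU.isOpen.preimage hF) hCU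
  -- Between the nested neighbourhoods `N₁` and `N₂` of `A` the old lift is blended into a new one;
  -- `l` is `0` on `N₁` and `1` off `N₂`.
  obtain ⟨N₂, hN₂, hAN₂, hN₂O⟩ := normal_exists_closure_subset hA hO hAO
  obtain ⟨N₁, hN₁, hAN₁, hN₁N₂⟩ := normal_exists_closure_subset hA hN₂ hAN₂
  obtain ⟨l, hl0, hl1, hl⟩ := exists_continuous_zero_one_of_isClosed (s := closure N₁) (t := N₂ᶜ)
    isClosed_closure hN₂.isClosed_compl (disjoint_compl_right_iff_subset.2 hN₁N₂)
  have hlN : ∀ x ∉ closure N₂, l x = 1 := fun x hx => hl1 fun h => hx (subset_closure h)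
  have hlO : ∀ x, l x ≠ 1 → x ∈ O := fun x hx =>
    hN₂O (by_contra fun h => hx (hlN x h))
  -- Moving the single point `e₀` over all of `U` gives a local section, hence a lift of `F` on
  -- `closure V`.
  let s : K → E := fun x => m 1 (F x) e₀
  have hs : ContinuousOn s (closure V) :=
    hm.comp (f := fun x => (1, F x, e₀)) (continuousOn_const.prodMk
      (hF.continuousOn.prodMk continuousOn_const)) fun x hx => ⟨hVU hx, he₀⟩
  have hps : ∀ x ∈ closure V, p (s x) = F x := fun x hx => hm2 _ (hVU hx) _ he₀
  let D : Set K := closure V ∩ closure N₂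
  have hD : IsClosed D := isClosed_closure.inter isClosed_closure
  have : CompactSpace D := isCompact_iff_compactSpace.1 hD.isCompact
  let gD : C(D, E) := ⟨D.domRestrict g, (hg.mono fun x hx => hN₂O hx.2).domRestrict⟩
  let sD : C(D, E) := ⟨D.domRestrict s, (hs.mono fun x hx => hx.1).domRestrict⟩
  obtain ⟨H⟩ := hU.homotopy D gD sD (fun x => F x) (fun x => hVU x.2.1)
    (fun x => hpg x (hN₂O x.2.2)) fun x => hps x x.2.1
  have hHp : ∀ (t : I) (x : D), p (H (t, x)) = F x := fun t x => H.prop t x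
  let h : K → E := fun x => if hx : x ∈ D then H (⟨l x, hl x⟩, ⟨x, hx⟩) else g x
  have hh : ∀ x (hx : x ∈ D), h x = H (⟨l x, hl x⟩, ⟨x, hx⟩) := fun x hx => dif_pos hx
  have hhc : ContinuousOn h D := by
    rw [continuousOn_iff_continuous_domRestrict]
    have h1 : Continuous fun x : D => H (⟨l x, hl x⟩, x) := H.continuous.comp
      (((l.continuous.comp continuous_subtype_val).subtype_mk _).prodMk continuous_id)
    exact h1.congr fun x => (hh x x.2).symm
  -- The old lift is kept where `l = 0`, the section is used where `l = 1`, and on the overlap `D`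
  -- the fibrewise homotopy is evaluated at time `l x`. The three prescriptions agree where the
  -- closed pieces meet.
  let g' : K → E := fun x => if l x = 0 then g x else if x ∈ D then h x else s x
  have hg'0 : ∀ x, l x = 0 → g' x = g x := fun x hx => if_pos hx
  have hg'D : ∀ x ∈ D, g' x = h x := by
    intro x hx
    by_cases h0 : l x = 0
    · rw [hg'0 x h0, hh x hx]
      have h1 : (⟨l x, hl x⟩ : I) = 0 := Subtype.ext h0
      rw [h1]
      exact (H.apply_zero ⟨x, hx⟩).symm
    · exact (if_neg h0).trans (if_pos hx)
  have hg'1 : ∀ x ∈ closure V, l x = 1 → g' x = s x := by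
    intro x hx h1
    have h0 : l x ≠ 0 := by rw [h1]; exact one_ne_zero
    by_cases hxD : x ∈ D
    · rw [hg'D x hxD, hh x hxD]
      have h2 : (⟨l x, hl x⟩ : I) = 1 := Subtype.ext h1
      rw [h2]
      exact H.apply_one ⟨x, hxD⟩
    · exact (if_neg h0).trans (if_neg hxD)
  have hl0c : IsClosed {x | l x = 0} := isClosed_eq l.continuous continuous_const
  have hl1c : IsClosed (closure V ∩ {x | l x = 1}) :=
    isClosed_closure.inter (isClosed_eq l.continuous continuous_const)
  have hlO0 : ∀ x, l x = 0 → x ∈ O := fun x hx => hlO x (by rw [hx]; exact zero_ne_one)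
  have hc : ContinuousOn g' ({x | l x = 0} ∪ (D ∪ (closure V ∩ {x | l x = 1}))) := by
    refine ContinuousOn.union_of_isClosed ?_ (ContinuousOn.union_of_isClosed ?_ ?_ hD hl1c) hl0c
      (hD.union hl1c)
    · exact (hg.mono hlO0).congr fun x hx => hg'0 x hx
    · exact hhc.congr hg'D
    · exact (hs.mono inter_subset_left).congr fun x hx => hg'1 x hx.1 hx.2
  have hsub : N₁ ∪ V ⊆ {x | l x = 0} ∪ (D ∪ (closure V ∩ {x | l x = 1})) := by
    rintro x (hx | hx)
    · exact Or.inl (hl0 (subset_closure hx))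
    · by_cases hxN : x ∈ closure N₂
      · exact Or.inr (Or.inl ⟨subset_closure hx, hxN⟩)
      · exact Or.inr (Or.inr ⟨subset_closure hx, hlN x hxN⟩)
  refine ⟨N₁ ∪ V, g', hN₁.union hV, union_subset_union hAN₁ hCV, hc.mono hsub, ?_, ?_⟩
  · intro x hx
    rcases hsub hx with hx | hx | hx
    · rw [hg'0 x hx, hpg x (hlO0 x hx)]
    · rw [hg'D x hx, hh x hx, hHp]
    · rw [hg'1 x hx.1 hx.2, hps x hx.1]
  · exact fun x hx => hg'0 x (hl0 (subset_closure (hAN₁ hx)))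

/-- The lifting theorem for locally liftable maps. -/
theorem exists_lift (hp : Continuous p) {F : K → Z} (hF : Continuous F)
    (hU : ∀ x, ∃ U, F x ∈ U ∧ IsLocallyLiftable p U) {B N : Set K} (hB : IsClosed B)
    (hN : IsOpen N) (hBN : B ⊆ N)
    {r : K → K} (hr : ContinuousOn r N) (hr' : ∀ x ∈ N, r x ∈ B) (hrB : ∀ x ∈ B, r x = x)
    {f : K → E} (hf : ContinuousOn f B) (hpf : ∀ x ∈ B, p (f x) = F x) :
    ∃ g : K → E, Continuous g ∧ (∀ x, p (g x) = F x) ∧ EqOn g f B := by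
  -- The extension step needs a lift on a neighbourhood, not just on `B`, because the blending takes
  -- place outside the set where the lift is kept.
  obtain ⟨O, g, h1, h2, h3, h4, h5⟩ := exists_lift_nhds hp hF hU hN hBN hr hr' hrB hf hpf
  obtain ⟨t, C, U, hC, hCU, hU, ht⟩ := exists_closed_cover hF hU
  suffices key : ∀ t : Finset K, ∃ (O : Set K) (g : K → E), IsOpen O ∧ B ∪ (⋃ y ∈ t, C y) ⊆ O ∧
      ContinuousOn g O ∧ (∀ x ∈ O, p (g x) = F x) ∧ EqOn g f B by
    obtain ⟨O, g, h1, h2, h3, h4, h5⟩ := key t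
    have hO : ∀ x, x ∈ O := fun x => h2 (Or.inr (ht ▸ mem_univ x))
    exact ⟨g, continuous_iff_continuousAt.2 fun x => h3.continuousAt (h1.mem_nhds (hO x)),
      fun x => h4 x (hO x), h5⟩
  classical
  intro t
  induction t using Finset.induction_on with
  | empty => exact ⟨O, g, h1, by simpa using h2, h3, h4, h5⟩
  | insert y t _ ih =>
    obtain ⟨O, g, h1, h2, h3, h4, h5⟩ := ih
    obtain ⟨O', g', k1, k2, k3, k4, k5⟩ := exists_lift_union hF (hU y)
      (hB.union (t.finite_toSet.isClosed_biUnion fun y _ => hC y)) (hC y) (hCU y) h1 h2 h3 h4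
    refine ⟨O', g', k1, ?_, k3, k4, fun x hx => (k5 (Or.inl hx)).trans (h5 hx)⟩
    rw [Finset.set_biUnion_insert]
    rintro x (hx | hx | hx)
    · exact k2 (Or.inl (Or.inl hx))
    · exact k2 (Or.inr hx)
    · exact k2 (Or.inl (Or.inr hx))

end lifting

/-- Cubes are moved by composing them with self-embeddings of `Y` that move their frames, so the
lift of a move of frames is automatic. Existence and homotopies come from the two chart
constructions above. -/
theorem Frame.exists_isLocallyLiftable {n e : ℕ} (h : 0 + n = e) {Y : CornerMfd e} (z₀ : Frame Y)
    (hz₀ : Y.I.IsInteriorPoint z₀.pt) :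
    ∃ U, z₀ ∈ U ∧ IsLocallyLiftable
      (fun f : Emb (cube n).toSmoothMfd Y.toSmoothMfd => push h f (std n)) U := by
  subst h
  obtain ⟨U, M, hU, hzU, hM, hM0, hM1, hM2⟩ := z₀.exists_move hz₀
  obtain ⟨U', hU', hzU', hH⟩ := z₀.exists_homotopyWith hz₀
  obtain ⟨f, hf⟩ := z₀.exists_push_std_eq hz₀
  have hp : Continuous fun f : Emb (cube n).toSmoothMfd Y.toSmoothMfd => push rfl f (std n) :=
    (continuous_push rfl).comp (continuous_id.prodMk continuous_const)
  refine ⟨U ∩ U', ⟨hzU, hzU'⟩, hU.inter hU', ⟨f, ?_⟩, ⟨fun l z g =>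
    (M l (push rfl g (std n)) z).comp g, ?_, ?_, ?_, ?_⟩,
    fun D _ _ g g' F hF => hH D g g' F fun x => (hF x).2⟩
  · rw [hf]; exact ⟨hzU, hzU'⟩
  · have h1 : ContinuousOn (fun q : ℝ × Frame Y × Emb (cube n).toSmoothMfd Y.toSmoothMfd =>
        M q.1 (push rfl q.2.2 (std n)) q.2.1)
        {q | q.2.1 ∈ U ∩ U' ∧ push rfl q.2.2 (std n) ∈ U ∩ U'} :=
      hM.comp (f := fun q : ℝ × Frame Y × Emb (cube n).toSmoothMfd Y.toSmoothMfd =>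
        (q.1, push rfl q.2.2 (std n), q.2.1)) (continuous_fst.prodMk
          ((hp.comp (continuous_snd.comp continuous_snd)).prodMk
            (continuous_fst.comp continuous_snd))).continuousOn fun q hq => ⟨hq.2.1, hq.1.1⟩
    exact Emb.continuous_comp.comp_continuousOn
      (h1.prodMk (continuous_snd.comp continuous_snd).continuousOn)
  · intro z g
    beta_reduce
    rw [hM0]; rfl
  · intro l g hg
    beta_reduce
    rw [hM1 l _ hg.1]; rfl
  · intro z hz g hg
    beta_reduce
    rw [← push_comp rfl rfl, hM2 _ hg.1 _ hz.1]

/-! ### Sequential colimits of closed embeddings. -/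

section SeqColim
variable {A : ℕ → Type} (s : ∀ i, A i → A (i + 1))

/-- The relation identifying an element of a sequence of types with its image at the next stage. -/
def SeqStep (a b : Σ i, A i) : Prop := b = ⟨a.1 + 1, s a.1 a.2⟩

namespace SeqStep

/-- The transition map to a later stage. -/
def up {i j : ℕ} (h : i ≤ j) : A i → A j := Nat.leRecOn h fun {k} => s k

theorem up_self {i : ℕ} (z : A i) : up s le_rfl z = z := Nat.leRecOn_self z

theorem up_succ {i j : ℕ} (h : i ≤ j) (z : A i) : up s (h.trans j.le_succ) z = s j (up s h z) :=
  Nat.leRecOn_succ h z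

theorem up_trans {i j k : ℕ} (h : i ≤ j) (h' : j ≤ k) (z : A i) :
    up s (h.trans h') z = up s h' (up s h z) := Nat.leRecOn_trans h h' z

theorem mk_up {i j : ℕ} (h : i ≤ j) (z : A i) :
    Quot.mk (SeqStep s) ⟨j, up s h z⟩ = Quot.mk (SeqStep s) ⟨i, z⟩ := by
  induction j, h using Nat.le_induction with
  | base => rw [up_self]
  | succ j h ih =>
    rw [up_succ s h, ← ih]
    exact (Quot.sound (r := SeqStep s) (a := ⟨j, up s h z⟩) rfl).symm

theorem exists_up_eq {a b : Σ i, A i} (h : Quot.mk (SeqStep s) a = Quot.mk (SeqStep s) b) :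
    ∃ (N : ℕ) (ha : a.1 ≤ N) (hb : b.1 ≤ N), up s ha a.2 = up s hb b.2 := by
  replace h := Quot.eqvGen_exact h
  induction h with
  | rel a b h =>
    obtain rfl : b = _ := h
    refine ⟨a.1 + 1, Nat.le_succ _, le_rfl, ?_⟩
    rw [up_self, up_succ s le_rfl, up_self]
  | refl a => exact ⟨a.1, le_rfl, le_rfl, rfl⟩
  | symm a b h ih =>
    obtain ⟨N, ha, hb, h⟩ := ih
    exact ⟨N, hb, ha, h.symm⟩
  | trans a b c h h' ih ih' =>
    obtain ⟨N, ha, hb, e⟩ := ih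
    obtain ⟨N', hb', hc, e'⟩ := ih'
    refine ⟨max N N', ha.trans (le_max_left _ _), hc.trans (le_max_right _ _), ?_⟩
    rw [up_trans s ha (le_max_left _ _), e, up_trans s hc (le_max_right _ _), ← e', ← up_trans,
      ← up_trans]

variable {s}

theorem up_injective (hs : ∀ i, Function.Injective (s i)) {i j : ℕ} (h : i ≤ j) :
    Function.Injective (up s h) := by
  induction j, h using Nat.le_induction with
  | base => exact fun a b hab => by rwa [up_self, up_self] at hab
  | succ j h ih =>
    intro a b hab
    rw [up_succ s h, up_succ s h] at hab
    exact ih (hs j hab)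

theorem mk_injective (hs : ∀ i, Function.Injective (s i)) (i : ℕ) :
    Function.Injective fun z : A i => Quot.mk (SeqStep s) ⟨i, z⟩ := by
  intro z w h
  obtain ⟨N, ha, hb, e⟩ := exists_up_eq s h
  exact up_injective hs ha e

theorem range_mk_mono {i j : ℕ} (h : i ≤ j) :
    Set.range (fun z : A i => Quot.mk (SeqStep s) ⟨i, z⟩) ⊆
      Set.range fun z : A j => Quot.mk (SeqStep s) ⟨j, z⟩ := by
  rintro _ ⟨z, rfl⟩
  exact ⟨up s h z, mk_up s h z⟩

variable [∀ i, TopologicalSpace (A i)]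

theorem isClosedEmbedding_up (hs : ∀ i, IsClosedEmbedding (s i)) {i j : ℕ} (h : i ≤ j) :
    IsClosedEmbedding (up s h) := by
  induction j, h using Nat.le_induction with
  | base =>
    have : up s (le_refl i) = id := funext (up_self s)
    rw [this]
    exact IsClosedEmbedding.id
  | succ j h ih =>
    have : up s (h.trans j.le_succ) = s j ∘ up s h := funext (up_succ s h)
    rw [this]
    exact (hs j).comp ih

theorem isClosed_iff {C : Set (Quot (SeqStep s))} :
    IsClosed C ↔ ∀ i, IsClosed {z : A i | Quot.mk (SeqStep s) ⟨i, z⟩ ∈ C} := by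
  rw [← isQuotientMap_quot_mk.isClosed_preimage, isClosed_sigma_iff]
  rfl

/-- Closedness in the colimit is tested at each stage: the trace of a closed set of stage `i` is its
image at a later stage and its preimage at an earlier one. -/
theorem isClosedEmbedding_mk (hs : ∀ i, IsClosedEmbedding (s i)) (i : ℕ) :
    IsClosedEmbedding fun z : A i => Quot.mk (SeqStep s) ⟨i, z⟩ := by
  have hinj := mk_injective fun i => (hs i).injective
  refine .of_continuous_injective_isClosedMap (continuous_quot_mk.comp continuous_sigmaMk)
    (hinj i) fun C hC => isClosed_iff.2 fun j => ?_
  rcases le_total i j with h | h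
  · convert (isClosedEmbedding_up hs h).isClosedMap C hC using 1
    ext w
    constructor
    · rintro ⟨z, hz, e⟩
      refine ⟨z, hz, hinj j ?_⟩
      exact (mk_up s h z).trans e
    · rintro ⟨z, hz, rfl⟩
      exact ⟨z, hz, (mk_up s h z).symm⟩
  · convert hC.preimage (isClosedEmbedding_up hs h).continuous using 1
    ext w
    constructor
    · rintro ⟨z, hz, e⟩
      have : z = up s h w := hinj i (e.trans (mk_up s h w).symm)
      rwa [Set.mem_preimage, ← this]
    · exact fun hw => ⟨_, hw, mk_up s h w⟩

/-- A map from a compact space to the colimit of a sequence of closed embeddings of `T₁` spaces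
factors through a finite stage. -/
theorem exists_factor [∀ i, T1Space (A i)] (hs : ∀ i, IsClosedEmbedding (s i)) {K : Type}
    [TopologicalSpace K] [CompactSpace K] (f : C(K, Quot (SeqStep s))) :
    ∃ l₀, ∀ l ≥ l₀, ∃ F : C(K, A l), ∀ x, Quot.mk (SeqStep s) ⟨l, F x⟩ = f x := by
  have hinj := mk_injective fun i => (hs i).injective
  suffices h : ∃ l₀, ∀ x, f x ∈ Set.range fun z : A l₀ => Quot.mk (SeqStep s) ⟨l₀, z⟩ by
    obtain ⟨l₀, h⟩ := h
    refine ⟨l₀, fun l hl => ?_⟩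
    choose F hF using fun x => range_mk_mono hl (h x)
    refine ⟨⟨F, (isClosedEmbedding_mk hs l).isInducing.continuous_iff.2 ?_⟩, hF⟩
    exact f.continuous.congr fun x => (hF x).symm
  by_contra! hc
  choose x hx using hc
  let S : Set (Quot (SeqStep s)) := Set.range fun l => f (x l)
  -- The points `f (x l)` escape every stage, so a subset of `S` meets stage `j` only in points with
  -- `l < j`. A finite set is closed by the `T₁` hypothesis.
  have hclosed : ∀ T ⊆ S, IsClosed T := by
    intro T hT
    refine isClosed_iff.2 fun j => Set.Finite.isClosed ?_
    have h1 : (T ∩ Set.range fun z : A j => Quot.mk (SeqStep s) ⟨j, z⟩).Finite := by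
      refine ((Set.finite_Iio j).image fun l => f (x l)).subset ?_
      rintro y ⟨hy, hy'⟩
      obtain ⟨l, rfl⟩ := hT hy
      exact ⟨l, not_le.1 fun h => hx l (range_mk_mono h hy'), rfl⟩
    refine Set.Finite.of_finite_image (h1.subset ?_) (hinj j).injOn
    rintro _ ⟨z, hz, rfl⟩
    exact ⟨hz, z, rfl⟩
  have hinf : S.Infinite := by
    intro hfin
    have hex : ∀ y : Quot (SeqStep s), ∃ j, y ∈ Set.range fun z : A j => Quot.mk (SeqStep s) ⟨j, z⟩ :=
      fun y => by
        induction y using Quot.ind with | mk a => exact ⟨a.1, a.2, rfl⟩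
    choose j hj using hex
    obtain ⟨J, hJ⟩ := (hfin.image j).bddAbove
    exact hx J (range_mk_mono (hJ ⟨_, ⟨J, rfl⟩, rfl⟩) (hj _))
  -- An infinite subset of a compact set accumulates somewhere, while all subsets of `S` are closed.
  obtain ⟨y, -, hy⟩ := hinf.exists_accPt_of_subset_isCompact
    (isCompact_range f.continuous) (by rintro _ ⟨l, rfl⟩; exact ⟨_, rfl⟩)
  have h1 : y ∈ closure (S \ {y}) := accPt_principal_iff_clusterPt.1 hy |>.mem_closure
  rw [(hclosed _ Set.sdiff_subset).closure_eq] at h1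
  exact h1.2 rfl

end SeqStep
end SeqColim

/-! ### Separation of frame bundles and closedness of stabilization. -/

/-- Vectors at different points are separated by the projection. Vectors at the same point are
separated by the derivative of a globally defined coordinate function, which is injective on that
fibre. -/
theorem t2Space_tangentBundle (X : SmoothMfd) [T2Space X.M] : T2Space (TangentBundle X.I X.M) := by
  refine ⟨fun p q hpq => ?_⟩
  have hproj : Continuous fun p : TangentBundle X.I X.M => p.1 :=
    FiberBundle.continuous_proj X.E (TangentSpace X.I)
  by_cases h : p.1 = q.1
  · obtain ⟨c, -⟩ := exists_localChart X p.1 one_pos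
    have hc : Continuous fun p : TangentBundle X.I X.M => (c.coord.D p.1 p.2 : X.E) :=
      (SmoothMap.continuous_D_apply (X := X) (E := X.E)).comp
        ((continuous_const (y := c.coord)).prodMk continuous_id)
    refine separated_by_continuous hc fun h' => hpq ?_
    obtain ⟨x, v⟩ := p
    obtain ⟨y, w⟩ := q
    obtain rfl : x = y := h
    exact congrArg (Bundle.TotalSpace.mk x) (c.D_coord_injective x c.mem_dom h')
  · exact separated_by_continuous hproj h

namespace Frame
variable {d : ℕ} {X : CornerMfd d}

instance instT2Space : T2Space (Frame X) :=
  have := t2Space_tangentBundle X.toSmoothMfd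
  T2Space.of_injective_continuous coords_injective continuous_coords

theorem stabilize_injective : Function.Injective (stabilize : Frame X → _) := by
  intro z w h
  refine ext' (congrArg (fun z => z.pt.1) h) fun i => ?_
  have := congrArg (fun z : Frame X.thicken => (z.v i.castSucc).1) h
  beta_reduce at this
  rwa [stabilize_v_castSucc, stabilize_v_castSucc] at this

/-- The differential of the projection to `X`, applied to all vectors but the last, continuously
recovers `coords` from the stabilized frame. -/
theorem isInducing_stabilize : IsInducing (stabilize : Frame X → _) := by
  let R : Frame X.thicken → X.M × (Fin d → TangentBundle X.I X.M) := fun w =>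
    (w.pt.1, fun i => (SmoothMap.fst X.toSmoothMfd interval).tangent.toFun ⟨w.pt, w.vec i.castSucc⟩)
  have hR : Continuous R := (continuous_fst.comp continuous_pt).prodMk
    (continuous_pi fun i => (SmoothMap.fst X.toSmoothMfd interval).tangent.smooth.continuous.comp
      (continuous_vec i.castSucc))
  refine IsInducing.of_comp continuous_stabilize hR ?_
  have h : R ∘ stabilize = (coords : Frame X → _) := by
    funext z
    refine Prod.ext rfl (funext fun i => ?_)
    refine congrArg (fun v => (⟨z.pt, v⟩ : TangentBundle X.I X.M)) ?_
    refine (SmoothMap.D_fst (X := X.toSmoothMfd) (Y := interval) (stabilize z).pt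
      ((stabilize z).v i.castSucc)).trans ?_
    rw [stabilize_v_castSucc]
    rfl
  rw [h]
  exact ⟨rfl⟩

theorem range_stabilize : Set.range (stabilize : Frame X → _) =
    {w | w.pt.2 = origin} ∩ {w | ∀ i : Fin d, (w.v (Fin.castSucc i)).2 = 0} ∩
      {w | w.v (Fin.last d) = (0, unitVec)} := by
  ext w
  constructor
  · rintro ⟨z, rfl⟩
    refine ⟨⟨rfl, fun i => ?_⟩, stabilize_v_last z⟩
    rw [stabilize_v_castSucc]
  · rintro ⟨⟨h1, h2⟩, h3⟩
    have h4 : ∀ i : Fin d, w.v i.castSucc = (LinearMap.inl ℝ X.E interval.E) (w.v i.castSucc).1 := fun i =>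
      Prod.ext rfl (h2 i)
    have h5 : LinearIndependent ℝ fun i : Fin d => (w.v i.castSucc).1 := by
      refine LinearIndependent.of_comp (LinearMap.inl ℝ X.E interval.E) ?_
      have h6 := w.linearIndependent_v.comp _ (Fin.castSucc_injective d)
      rw [show w.v ∘ Fin.castSucc = LinearMap.inl ℝ X.E interval.E ∘
        fun i : Fin d => (w.v i.castSucc).1 from funext h4] at h6
      exact h6
    refine ⟨⟨w.pt.1, fun i => (w.v i.castSucc).1, h5⟩, ext' (Prod.ext rfl h1.symm) fun i => ?_⟩
    obtain ⟨j, rfl⟩ | rfl := Fin.eq_castSucc_or_eq_last i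
    · rw [stabilize_v_castSucc, h4 j]
      rfl
    · rw [stabilize_v_last, h3]

/-- The equations of `range_stabilize` are rewritten as equalities between points of tangent
bundles, where the vectors of a frame vary continuously and the Hausdorff property applies. -/
theorem isClosed_range_stabilize : IsClosed (Set.range (stabilize : Frame X → _)) := by
  have := t2Space_tangentBundle X.toSmoothMfd
  have := t2Space_tangentBundle interval
  have h1 : IsClosed {w : Frame X.thicken | w.pt.2 = origin} :=
    isClosed_eq (continuous_snd.comp continuous_pt) continuous_const
  have hsnd : ∀ i, Continuous fun w : Frame X.thicken =>
      (⟨w.pt.2, (w.v i).2⟩ : TangentBundle interval.I interval.M) := fun i =>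
    Continuous.congr (f := fun w : Frame X.thicken =>
      (SmoothMap.snd X.toSmoothMfd interval).tangent.toFun ⟨w.pt, w.vec i⟩)
      ((SmoothMap.snd X.toSmoothMfd interval).tangent.smooth.continuous.comp (continuous_vec i))
      fun w => congrArg (fun v => (⟨w.pt.2, v⟩ : TangentBundle interval.I interval.M))
        (SmoothMap.D_snd (X := X.toSmoothMfd) (Y := interval) w.pt (w.v i))
  have hfst : ∀ i, Continuous fun w : Frame X.thicken =>
      (⟨w.pt.1, (w.v i).1⟩ : TangentBundle X.I X.M) := fun i =>
    Continuous.congr (f := fun w : Frame X.thicken =>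
      (SmoothMap.fst X.toSmoothMfd interval).tangent.toFun ⟨w.pt, w.vec i⟩)
      ((SmoothMap.fst X.toSmoothMfd interval).tangent.smooth.continuous.comp (continuous_vec i))
      fun w => congrArg (fun v => (⟨w.pt.1, v⟩ : TangentBundle X.I X.M))
        (SmoothMap.D_fst (X := X.toSmoothMfd) (Y := interval) w.pt (w.v i))
  have hzero : Continuous fun x : X.M => (⟨x, 0⟩ : TangentBundle X.I X.M) :=
    (Bundle.contMDiff_zeroSection ℝ (TangentSpace X.I) (n := ∞) (IB := X.I)).continuous
  have h2 : IsClosed ({w : Frame X.thicken | w.pt.2 = origin} ∩ {w | ∀ i : Fin d,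
      (⟨w.pt.2, (w.v i.castSucc).2⟩ : TangentBundle interval.I interval.M) = ⟨origin, 0⟩}) := by
    refine h1.inter ?_
    simp only [Set.ofPred_forall]
    exact isClosed_iInter fun i => isClosed_eq (hsnd _) continuous_const
  have h3 : IsClosed {w : Frame X.thicken |
      (⟨w.pt.2, (w.v (Fin.last d)).2⟩ : TangentBundle interval.I interval.M) = ⟨origin, unitVec⟩} :=
    isClosed_eq (hsnd _) continuous_const
  have h4 : IsClosed {w : Frame X.thicken |
      (⟨w.pt.1, (w.v (Fin.last d)).1⟩ : TangentBundle X.I X.M) = ⟨w.pt.1, 0⟩} :=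
    isClosed_eq (hfst _) (hzero.comp (continuous_fst.comp continuous_pt))
  have hval : ∀ (Z : SmoothMfd) {x y : Z.M} {v w : Z.E},
      (⟨x, v⟩ : TangentBundle Z.I Z.M) = ⟨y, w⟩ → v = w := by
    intro Z x y v w h
    exact congrArg (fun p : TangentBundle Z.I Z.M => (show Z.E from p.2)) h
  convert h2.inter (h3.inter h4) using 1
  rw [range_stabilize]
  ext w
  constructor
  · rintro ⟨⟨e1, e2⟩, e3⟩
    have e1' : w.pt.2 = origin := e1
    refine ⟨⟨e1, fun i => ?_⟩, ?_, ?_⟩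
    · rw [e2 i, e1']; rfl
    · change (⟨w.pt.2, (w.v (Fin.last d)).2⟩ : TangentBundle interval.I interval.M) = _
      rw [e3, e1']
    · change (⟨w.pt.1, (w.v (Fin.last d)).1⟩ : TangentBundle X.I X.M) = _
      rw [e3]; rfl
  · rintro ⟨⟨e1, e2⟩, e3, e4⟩
    exact ⟨⟨e1, fun i => hval interval (e2 i)⟩, Prod.ext (hval X.toSmoothMfd e4) (hval interval e3)⟩

theorem isClosedEmbedding_stabilize : IsClosedEmbedding (stabilize : Frame X → _) :=
  ⟨⟨isInducing_stabilize, stabilize_injective⟩, isClosed_range_stabilize⟩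

end Frame

namespace Fr
variable {X : Thickened}

theorem isClosedEmbedding_mk (i : ℕ) :
    IsClosedEmbedding (mk i : StageFrame X.mfd i → Fr X) :=
  SeqStep.isClosedEmbedding_mk (A := StageFrame X.mfd) (s := fun _ => StageFrame.stabilize)
    (fun _ => Frame.isClosedEmbedding_stabilize) i

theorem exists_factor {K : Type} [TopologicalSpace K] [CompactSpace K] (f : C(K, Fr X)) :
    ∃ l₀, ∀ l ≥ l₀, ∃ F : C(K, StageFrame X.mfd l), ∀ x, mk l (F x) = f x :=
  SeqStep.exists_factor (A := StageFrame X.mfd) (s := fun _ => StageFrame.stabilize)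
    (fun _ => Frame.isClosedEmbedding_stabilize) f

end Fr

/-! ### Gluing maps on faces of the simplex, and the Kan property of singular complexes. -/

section gluing
open SSet Simplicial

/-- The topological simplex. -/
abbrev TopSimplex (n : ℕ) : Type := stdSimplex ℝ (Fin (n + 1))

namespace TopSimplex
variable {n m k : ℕ}

instance (n : ℕ) : CompactSpace (TopSimplex n) :=
  isCompact_iff_compactSpace.1 (isCompact_stdSimplex ℝ (Fin (n + 1)))

/-- The vertices of the face spanned by a point. -/
def supp (x : TopSimplex n) : Finset (Fin (n + 1)) := Finset.univ.filter fun i => x i ≠ 0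

theorem mem_supp {x : TopSimplex n} {i : Fin (n + 1)} : i ∈ supp x ↔ x i ≠ 0 := by simp [supp]

theorem supp_nonempty (x : TopSimplex n) : (supp x).Nonempty := by
  by_contra h
  rw [Finset.not_nonempty_iff_eq_empty] at h
  have h1 : ∀ i, x i = 0 := fun i => by
    by_contra hi
    have := mem_supp.2 hi
    rw [h] at this
    exact absurd this (Finset.notMem_empty i)
  have := stdSimplex.sum_eq_one x
  simp [h1] at this

theorem map_apply (u : Fin (n + 1) → Fin (m + 1)) (x : TopSimplex n) (j : Fin (m + 1)) :
    stdSimplex.map u x j = ∑ i, if u i = j then x i else 0 := by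
  rw [stdSimplex.map_coe, FunOnFinite.linearMap_apply_apply, Finset.sum_filter]

theorem map_congr {u v : Fin (n + 1) → Fin (m + 1)} {x : TopSimplex n}
    (h : ∀ i ∈ supp x, u i = v i) : stdSimplex.map u x = stdSimplex.map v x := by
  refine stdSimplex.ext (funext fun j => ?_)
  refine (map_apply u x j).trans (Eq.trans ?_ (map_apply v x j).symm)
  refine Finset.sum_congr rfl fun i _ => ?_
  by_cases hi : i ∈ supp x
  · rw [h i hi]
  · have : x i = 0 := not_not.1 fun h => hi (mem_supp.2 h)
    simp [this]

theorem mem_supp_map {u : Fin (n + 1) → Fin (m + 1)} {x : TopSimplex n} {j : Fin (m + 1)} :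
    j ∈ supp (stdSimplex.map u x) ↔ ∃ i ∈ supp x, u i = j := by
  rw [mem_supp, map_apply, ne_eq, Finset.sum_eq_zero_iff_of_nonneg fun i _ => by
    split_ifs
    · exact stdSimplex.zero_le x i
    · exact le_rfl]
  simp only [Finset.mem_univ, true_imp_iff, ite_eq_right_iff, not_forall, mem_supp]
  exact ⟨fun ⟨i, hi, h⟩ => ⟨i, h, hi⟩, fun ⟨i, h, hi⟩ => ⟨i, hi, h⟩⟩

/-- The monotone retraction of the ordinal onto a nonempty subset. -/
def collapse (S : Finset (Fin (n + 1))) (hS : S.Nonempty) : Fin (n + 1) →o Fin (n + 1) where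
  toFun k := max (S.min' hS) ((S.filter (· ≤ k)).sup id)
  monotone' _ _ h := max_le_max le_rfl (Finset.sup_mono fun _ hi =>
    Finset.mem_filter.2 ⟨(Finset.mem_filter.1 hi).1, (Finset.mem_filter.1 hi).2.trans h⟩)

theorem collapse_mem (S : Finset (Fin (n + 1))) (hS : S.Nonempty) (k : Fin (n + 1)) :
    collapse S hS k ∈ S := by
  change max (S.min' hS) ((S.filter (· ≤ k)).sup id) ∈ S
  rcases max_choice (S.min' hS) ((S.filter (· ≤ k)).sup id) with h | h
  · rw [h]; exact S.min'_mem hS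
  · rcases (S.filter (· ≤ k)).eq_empty_or_nonempty with h0 | h0
    · rw [h0, Finset.sup_empty, max_bot_right]; exact S.min'_mem hS
    · obtain ⟨i, hi, hi'⟩ := Finset.exists_mem_eq_sup _ h0 id
      rw [h, hi']
      exact (Finset.mem_filter.1 hi).1

theorem collapse_eq {S : Finset (Fin (n + 1))} (hS : S.Nonempty) {k : Fin (n + 1)} (hk : k ∈ S) :
    collapse S hS k = k := by
  refine le_antisymm (max_le (S.min'_le k hk) (Finset.sup_le fun i hi => ?_))
    (le_max_of_le_right ?_)
  · exact (Finset.mem_filter.1 hi).2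
  · exact Finset.le_sup (f := id) (Finset.mem_filter.2 ⟨hk, le_rfl⟩)

theorem map_collapse {S : Finset (Fin (n + 1))} (hS : S.Nonempty) {x : TopSimplex n}
    (hx : supp x ⊆ S) : stdSimplex.map (collapse S hS) x = x := by
  exact (map_congr (u := collapse S hS) (v := id) fun i hi => collapse_eq hS (hx hi)).trans
    (stdSimplex.map_id_apply x)

variable {E : Type} [TopologicalSpace E]

/-- The value of a map to a singular complex on a simplex of a subcomplex of `Δ[n]`. -/
def val {L : (Δ[n] : SSet.{0}).Subcomplex} (φ : (L : SSet.{0}) ⟶ sing E)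
    (u : Fin (m + 1) →o Fin (n + 1)) (hu : stdSimplex.objMk (m := op ⦋m⦌) u ∈ L.obj _) :
    C(TopSimplex m, E) := sing.equiv (φ.app (op ⦋m⦌) ⟨stdSimplex.objMk u, hu⟩)

theorem val_comp {L : (Δ[n] : SSet.{0}).Subcomplex} (φ : (L : SSet.{0}) ⟶ sing E)
    (u : Fin (m + 1) →o Fin (n + 1)) (hu : stdSimplex.objMk (m := op ⦋m⦌) u ∈ L.obj _)
    (θ : Fin (k + 1) →o Fin (m + 1))
    (hu' : stdSimplex.objMk (m := op ⦋k⦌) (u.comp θ) ∈ L.obj _) (y : TopSimplex k) :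
    val φ (u.comp θ) hu' y = val φ u hu (stdSimplex.map θ y) := by
  have h := ConcreteCategory.congr_hom (φ.naturality
    (Quiver.Hom.op (X := ⦋k⦌) (Y := ⦋m⦌) (SimplexCategory.Hom.mk θ)))
    ⟨stdSimplex.objMk (m := op ⦋m⦌) u, hu⟩
  exact congrArg (fun σ => sing.equiv σ y) h

theorem val_congr {L : (Δ[n] : SSet.{0}).Subcomplex} (φ : (L : SSet.{0}) ⟶ sing E)
    {u v : Fin (m + 1) →o Fin (n + 1)} (h : u = v)
    (hu : stdSimplex.objMk (m := op ⦋m⦌) u ∈ L.obj _)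
    (hv : stdSimplex.objMk (m := op ⦋m⦌) v ∈ L.obj _) : val φ u hu = val φ v hv := by
  subst h; rfl

/-- A map from a subcomplex of `Δ[n]`, defined by a condition on the images of its simplices, to
a singular complex is given by a continuous map on the corresponding union of faces. -/
theorem exists_glue {L : (Δ[n] : SSet.{0}).Subcomplex} {R : Finset (Fin (n + 1)) → Prop}
    (hR : ∀ S T, S ⊆ T → R T → R S)
    (hL : ∀ (m : ℕ) (u : Fin (m + 1) →o Fin (n + 1)),
      stdSimplex.objMk (m := op ⦋m⦌) u ∈ L.obj _ ↔ R (Finset.univ.image u))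
    (φ : (L : SSet.{0}) ⟶ sing E) :
    ∃ F : C({x : TopSimplex n // R (supp x)}, E),
      ∀ (m : ℕ) (u : Fin (m + 1) →o Fin (n + 1))
        (hu : stdSimplex.objMk (m := op ⦋m⦌) u ∈ L.obj _) (y : TopSimplex m),
        ∃ h, F ⟨stdSimplex.map u y, h⟩ = val φ u hu y := by
  have himg : ∀ (S : Finset (Fin (n + 1))) hS, Finset.univ.image (collapse S hS) ⊆ S := by
    intro S hS i hi
    obtain ⟨k, -, rfl⟩ := Finset.mem_image.1 hi
    exact collapse_mem S hS k
  have hcol : ∀ (S : Finset (Fin (n + 1))) hS, R S →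
      stdSimplex.objMk (m := op ⦋n⦌) (collapse S hS) ∈ L.obj _ :=
    fun S hS h => (hL _ _).2 (hR _ _ (himg S hS) h)
  have hcomp : ∀ {m k : ℕ} (u : Fin (m + 1) →o Fin (n + 1)) (θ : Fin (k + 1) →o Fin (m + 1)),
      stdSimplex.objMk (m := op ⦋m⦌) u ∈ L.obj _ →
      stdSimplex.objMk (m := op ⦋k⦌) (u.comp θ) ∈ L.obj _ := by
    intro m k u θ hu
    rw [hL] at hu ⊢
    refine hR _ _ (fun i hi => ?_) hu
    obtain ⟨j, -, rfl⟩ := Finset.mem_image.1 hi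
    exact Finset.mem_image_of_mem u (Finset.mem_univ _)
  -- The collapse onto the support is a possibly degenerate `n`-simplex of the subcomplex, and its
  -- realization fixes `x`. This avoids choosing an injective parametrization of each face.
  let F : {x : TopSimplex n // R (supp x)} → E := fun x =>
    val φ (collapse (supp x.1) (supp_nonempty x.1)) (hcol _ _ x.2) x.1
  have hF : ∀ (m : ℕ) (u : Fin (m + 1) →o Fin (n + 1))
      (hu : stdSimplex.objMk (m := op ⦋m⦌) u ∈ L.obj _) (y : TopSimplex m)
      (h : R (supp (stdSimplex.map u y))), F ⟨stdSimplex.map u y, h⟩ = val φ u hu y := by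
    intro m u hu y h
    let c := collapse (supp y) (supp_nonempty y)
    let C := collapse (supp (stdSimplex.map u y)) (supp_nonempty (stdSimplex.map u y))
    have hC : stdSimplex.objMk (m := op ⦋n⦌) C ∈ L.obj _ := hcol _ _ h
    have hy : stdSimplex.map c y = y := map_collapse _ subset_rfl
    have e : (C.comp u).comp c = u.comp c := by
      exact OrderHom.ext _ _ (funext fun i =>
        collapse_eq _ (mem_supp_map.2 ⟨c i, collapse_mem _ _ i, rfl⟩))
    calc val φ C hC (stdSimplex.map u y) = val φ (C.comp u) (hcomp C u hC) y :=
          (val_comp φ C hC u _ y).symm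
      _ = val φ (C.comp u) (hcomp C u hC) (stdSimplex.map c y) := by rw [hy]
      _ = val φ ((C.comp u).comp c) (hcomp _ c (hcomp C u hC)) y := (val_comp φ _ _ c _ y).symm
      _ = val φ (u.comp c) (hcomp u c hu) y := by rw [val_congr φ e]
      _ = val φ u hu (stdSimplex.map c y) := val_comp φ u hu c _ y
      _ = val φ u hu y := by rw [hy]
  have hmem : ∀ (m : ℕ) (u : Fin (m + 1) →o Fin (n + 1)) (y : TopSimplex m),
      stdSimplex.objMk (m := op ⦋m⦌) u ∈ L.obj _ → R (supp (stdSimplex.map u y)) := by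
    intro m u y hu
    refine hR _ _ (fun j hj => ?_) ((hL m u).1 hu)
    obtain ⟨i, -, rfl⟩ := mem_supp_map.1 hj
    exact Finset.mem_image_of_mem u (Finset.mem_univ i)
  have hcont : Continuous F := by
    -- The closed faces form a finite closed cover, and on the face with vertices `S` the map `F`
    -- equals the continuous map given by the collapse onto `S`.
    refine (locallyFinite_of_finite fun (S : {S : Finset (Fin (n + 1)) // R S ∧ S.Nonempty}) =>
      Set.ofPred fun x : {x : TopSimplex n // R (supp x)} => supp x.1 ⊆ S.1).continuous ?_ ?_ ?_
    · exact Set.eq_univ_of_forall fun x => Set.mem_iUnion.2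
        ⟨⟨supp x.1, x.2, supp_nonempty x.1⟩, Finset.Subset.refl (supp x.1)⟩
    · intro S
      have : (Set.ofPred fun x : {x : TopSimplex n // R (supp x)} => supp x.1 ⊆ S.1) =
          ⋂ i ∈ (S.1ᶜ : Finset (Fin (n + 1))), Set.ofPred fun x => x.1 i = 0 := by
        ext x
        simp only [Set.mem_iInter, Finset.mem_compl]
        exact ⟨fun h i hi => not_not.1 fun h' => hi (h (mem_supp.2 h')),
          fun h i hi => by_contra fun h' => mem_supp.1 hi (h i h')⟩
      rw [this]
      refine isClosed_biInter fun i _ => isClosed_eq ?_ continuous_const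
      exact (continuous_apply i).comp (continuous_subtype_val.comp continuous_subtype_val)
    · intro S
      refine ContinuousOn.congr (f := fun x : {x : TopSimplex n // R (supp x)} =>
        val φ (collapse S.1 S.2.2) (hcol _ _ S.2.1) x.1)
        ((val φ _ _).continuous.comp continuous_subtype_val).continuousOn fun x hx => ?_
      have h1 := map_collapse S.2.2 hx
      have h2 := hF n (collapse S.1 S.2.2) (hcol _ _ S.2.1) x.1 (by rw [h1]; exact x.2)
      exact (congrArg F (Subtype.ext h1.symm)).trans h2
  exact ⟨⟨F, hcont⟩, fun m u hu y => ⟨hmem m u y hu, hF m u hu y (hmem m u y hu)⟩⟩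

theorem comp_yonedaEquiv_symm {L : (Δ[n] : SSet.{0}).Subcomplex} (φ : (L : SSet.{0}) ⟶ sing E)
    (G : C(TopSimplex n, E))
    (hG : ∀ (m : ℕ) (u : Fin (m + 1) →o Fin (n + 1))
      (hu : stdSimplex.objMk (m := op ⦋m⦌) u ∈ L.obj _) (y : TopSimplex m),
      G (stdSimplex.map u y) = val φ u hu y) :
    L.ι ≫ yonedaEquiv.symm (sing.equiv (n := op ⦋n⦌).symm G) = φ := by
  ext ⟨⟨m⟩⟩ ⟨x, hx⟩
  obtain ⟨u, rfl⟩ := stdSimplex.objMk_bijective.2 x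
  exact sing.ext fun y => hG m u hx y

/-- The smallest coordinate among those in a nonempty set. -/
def minCoord (S : Finset (Fin (n + 1))) (hS : S.Nonempty) (x : TopSimplex n) : ℝ :=
  S.inf' hS fun i => x i

theorem continuous_minCoord (S : Finset (Fin (n + 1))) (hS : S.Nonempty) :
    Continuous (minCoord S hS) :=
  Continuous.finset_inf'_apply hS fun i _ => (continuous_apply i).comp continuous_subtype_val

theorem minCoord_le {S : Finset (Fin (n + 1))} (hS : S.Nonempty) (x : TopSimplex n)
    {i : Fin (n + 1)} (hi : i ∈ S) : minCoord S hS x ≤ x i :=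
  Finset.inf'_le (f := fun i => x i) hi

theorem minCoord_nonneg (S : Finset (Fin (n + 1))) (hS : S.Nonempty) (x : TopSimplex n) :
    0 ≤ minCoord S hS x :=
  (Finset.le_inf'_iff hS _).2 fun i _ => stdSimplex.zero_le x i

theorem exists_minCoord_eq (S : Finset (Fin (n + 1))) (hS : S.Nonempty) (x : TopSimplex n) :
    ∃ i ∈ S, minCoord S hS x = x i := Finset.exists_mem_eq_inf' hS fun i => x i

theorem minCoord_eq_zero_iff {S : Finset (Fin (n + 1))} (hS : S.Nonempty) (x : TopSimplex n) :
    minCoord S hS x = 0 ↔ ∃ i ∈ S, i ∉ supp x := by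
  constructor
  · intro h
    obtain ⟨i, hi, hi'⟩ := exists_minCoord_eq S hS x
    exact ⟨i, hi, fun hs => mem_supp.1 hs (hi'.symm.trans h)⟩
  · rintro ⟨i, hi, hs⟩
    have h0 : x i = 0 := not_not.1 fun h => hs (mem_supp.2 h)
    exact le_antisymm ((minCoord_le hS x hi).trans h0.le) (minCoord_nonneg S hS x)

/-- The retraction of the simplex onto a horn. -/
theorem exists_horn_retraction (i : Fin (n + 2)) :
    ∃ r : C(TopSimplex (n + 1), TopSimplex (n + 1)), (∀ x, ∃ j, j ≠ i ∧ j ∉ supp (r x)) ∧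
      ∀ x, (∃ j, j ≠ i ∧ j ∉ supp x) → r x = x := by
  let S : Finset (Fin (n + 2)) := Finset.univ.erase i
  have hS : S.Nonempty := by
    obtain ⟨j, hj⟩ := exists_ne i
    exact ⟨j, Finset.mem_erase.2 ⟨hj, Finset.mem_univ j⟩⟩
  have hmS : ∀ {j}, j ∈ S ↔ j ≠ i := by simp [S]
  let m := minCoord S hS
  have hm : Continuous m := continuous_minCoord S hS
  -- The smallest coordinate other than the `i`th is subtracted from all coordinates other than the
  -- `i`th, and the lost mass goes to the `i`th. Points of the horn have minimum zero and stay put.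
  let f : TopSimplex (n + 1) → Fin (n + 2) → ℝ := fun x j =>
    if j = i then x j + S.card * m x else x j - m x
  have hf : ∀ x, f x ∈ stdSimplex ℝ (Fin (n + 2)) := by
    intro x
    refine ⟨fun j => ?_, ?_⟩
    · simp only [f]
      split_ifs with h
      · have := minCoord_nonneg S hS x
        have := stdSimplex.zero_le x j
        positivity
      · exact sub_nonneg.2 (minCoord_le hS x (hmS.2 h))
    · have h1 := stdSimplex.sum_eq_one x
      rw [← Finset.add_sum_erase _ _ (Finset.mem_univ i)] at h1 ⊢
      have h2 : ∑ j ∈ S, f x j = ∑ j ∈ S, (x j - m x) :=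
        Finset.sum_congr rfl fun j hj => if_neg (hmS.1 hj)
      have h3 : f x i = x i + S.card * m x := if_pos rfl
      change f x i + ∑ j ∈ S, f x j = 1
      change x i + ∑ j ∈ S, x j = 1 at h1
      rw [h2, h3, Finset.sum_sub_distrib, Finset.sum_const, nsmul_eq_mul]
      linarith
  have hfc : Continuous f := by
    refine continuous_pi fun j => ?_
    have hj : Continuous fun x : TopSimplex (n + 1) => x j :=
      (continuous_apply j).comp continuous_subtype_val
    simp only [f]
    split_ifs
    · exact hj.add (continuous_const.mul hm)
    · exact hj.sub hm
  refine ⟨⟨fun x => ⟨f x, hf x⟩, hfc.subtype_mk _⟩, fun x => ?_, fun x hx => ?_⟩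
  · obtain ⟨j, hj, hj'⟩ := exists_minCoord_eq S hS x
    refine ⟨j, hmS.1 hj, fun hs => mem_supp.1 hs ?_⟩
    change f x j = 0
    simp only [f, if_neg (hmS.1 hj)]
    exact sub_eq_zero.2 hj'.symm
  · obtain ⟨j, hj, hj'⟩ := hx
    have h0 : m x = 0 := (minCoord_eq_zero_iff hS x).2 ⟨j, hmS.2 hj, hj'⟩
    refine stdSimplex.ext (funext fun k => ?_)
    change f x k = x k
    simp [f, h0]

/-- The boundary of the simplex is a retract of a neighbourhood. -/
theorem exists_boundary_retraction (n : ℕ) :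
    ∃ (N : Set (TopSimplex n)) (r : TopSimplex n → TopSimplex n), IsOpen N ∧
      IsClosed (Set.ofPred fun x : TopSimplex n => ∃ j, j ∉ supp x) ∧
      (Set.ofPred fun x => ∃ j, j ∉ supp x) ⊆ N ∧
      ContinuousOn r N ∧ (∀ x ∈ N, ∃ j, j ∉ supp (r x)) ∧ ∀ x, (∃ j, j ∉ supp x) → r x = x := by
  classical
  have hS : (Finset.univ : Finset (Fin (n + 1))).Nonempty := Finset.univ_nonempty
  let m := minCoord Finset.univ hS
  have hm : Continuous m := continuous_minCoord _ hS
  have hm0 : ∀ {x : TopSimplex n}, (∃ j, j ∉ supp x) ↔ m x = 0 := fun {x} => by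
    rw [minCoord_eq_zero_iff]; simp
  let f : TopSimplex n → Fin (n + 1) → ℝ := fun x j => (x j - m x) / (1 - (n + 1) * m x)
  -- Subtracting the minimum from all coordinates leaves total mass `1 - (n + 1) * m x`, by which
  -- one renormalizes. It is positive except at the barycentre.
  let N : Set (TopSimplex n) := Set.ofPred fun x => 0 < 1 - (n + 1) * m x
  have hN : IsOpen N := isOpen_lt continuous_const (continuous_const.sub (continuous_const.mul hm))
  have hf : ∀ x ∈ N, f x ∈ stdSimplex ℝ (Fin (n + 1)) := by
    intro x hx
    refine ⟨fun j => div_nonneg (sub_nonneg.2 (minCoord_le hS x (Finset.mem_univ j))) (le_of_lt hx),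
      ?_⟩
    simp only [f]
    rw [← Finset.sum_div, Finset.sum_sub_distrib, stdSimplex.sum_eq_one x, div_eq_one_iff_eq
      (ne_of_gt hx)]
    simp
  let r : TopSimplex n → TopSimplex n := fun x => if h : x ∈ N then ⟨f x, hf x h⟩ else x
  have hr : ∀ x (h : x ∈ N), r x = ⟨f x, hf x h⟩ := fun x h => dif_pos h
  have hBN : ∀ x : TopSimplex n, (∃ j, j ∉ supp x) → x ∈ N := fun x hx => by
    change 0 < 1 - (n + 1) * m x
    rw [hm0.1 hx]; simp
  refine ⟨N, r, hN, ?_, hBN, ?_, ?_, ?_⟩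
  · simp only [hm0]
    exact isClosed_eq hm continuous_const
  · rw [IsInducing.subtypeVal.continuousOn_iff]
    have h1 : ContinuousOn f N := continuousOn_pi.2 fun j => ContinuousOn.div
      (((continuous_apply j).comp continuous_subtype_val).sub hm).continuousOn
      (continuous_const.sub (continuous_const.mul hm)).continuousOn fun x hx => ne_of_gt hx
    exact h1.congr fun x hx => by
      change (r x).1 = f x
      rw [hr x hx]
  · intro x hx
    obtain ⟨j, -, hj⟩ := exists_minCoord_eq Finset.univ hS x
    refine ⟨j, fun hs => mem_supp.1 hs ?_⟩
    rw [hr x hx]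
    change (x j - m x) / _ = 0
    rw [sub_eq_zero.2 hj.symm, zero_div]
  · intro x hx
    rw [hr x (hBN x hx)]
    refine stdSimplex.ext (funext fun k => ?_)
    change (x k - m x) / (1 - (n + 1) * m x) = x k
    rw [hm0.1 hx]; simp

end TopSimplex

theorem horn_mem_iff {n : ℕ} (i : Fin (n + 1)) (m : ℕ) (u : Fin (m + 1) →o Fin (n + 1)) :
    stdSimplex.objMk (m := op ⦋m⦌) u ∈ (horn.{0} n i).obj _ ↔
      ∃ j, j ≠ i ∧ j ∉ Finset.univ.image u := by
  rw [mem_horn_iff_notMem_range]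
  simp only [exists_prop, Set.mem_range, Finset.mem_image, Finset.mem_univ, true_and]
  rfl

theorem boundary_mem_iff {n : ℕ} (m : ℕ) (u : Fin (m + 1) →o Fin (n + 1)) :
    stdSimplex.objMk (m := op ⦋m⦌) u ∈ (boundary.{0} n).obj _ ↔ ∃ j, j ∉ Finset.univ.image u := by
  rw [mem_boundary_iff_notMem_range]
  simp only [Set.mem_range, Finset.mem_image, Finset.mem_univ, true_and]
  rfl

theorem kanComplex_of_horn {A : SSet.{0}}
    (h : ∀ (n : ℕ) (i : Fin (n + 2)) (φ : (Λ[n + 1, i] : SSet.{0}) ⟶ A),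
      ∃ ψ : Δ[n + 1] ⟶ A, Λ[n + 1, i].ι ≫ ψ = φ) : KanComplex A := by
  refine KanComplex.iff.2 fun n i f hf => ?_
  obtain ⟨ψ, hψ⟩ := h n i hf.desc
  refine ⟨ψ, fun j hj => ?_⟩
  rw [← horn.ι_ι_assoc i j hj, hψ]
  simp

open TopSimplex in
/-- The singular complex of a space is a Kan complex. -/
theorem kanComplex_sing (E : Type) [TopologicalSpace E] : KanComplex (sing E) := by
  refine kanComplex_of_horn fun n i φ => ?_
  obtain ⟨F, hF⟩ := exists_glue (R := fun S => ∃ j, j ≠ i ∧ j ∉ S)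
    (fun S T hST ⟨j, hj, hj'⟩ => ⟨j, hj, fun h => hj' (hST h)⟩) (horn_mem_iff i) φ
  obtain ⟨r, hr, hr'⟩ := exists_horn_retraction i
  refine ⟨_, comp_yonedaEquiv_symm φ ⟨fun x => F ⟨r x, hr x⟩,
    F.continuous.comp (r.continuous.subtype_mk _)⟩ fun m u hu y => ?_⟩
  obtain ⟨h, hy⟩ := hF m u hu y
  rw [← hy]
  exact congrArg F (Subtype.ext (hr' _ h))

end gluing

/-! ### Finite stages of the mapping space, and the comparison map. -/

section stages
open SSet Simplicial
variable {X : Thickened}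

/-- The embeddings into `X × [-1,1]^l` of the cube of the same dimension. -/
abbrev CubeEmb (X : Thickened) (l : ℕ) : Type := StageEmb point X.mfd (X.dim + l) l

theorem Emb.thicken_injective {d e : ℕ} {Y : CornerMfd d} {Z : CornerMfd e} :
    Function.Injective (Emb.thicken : Emb Y.toSmoothMfd Z.toSmoothMfd → _) := fun _ _ h =>
  Emb.ext fun x => congrArg
    (fun F : Emb Y.thicken.toSmoothMfd Z.thicken.toSmoothMfd => (F.toFun (x, Frame.origin)).1) h

namespace CubeEmb

/-- The map from a stage of the colimit to the mapping space out of the point. -/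
def toHom (X : Thickened) (l : ℕ) : sing (CubeEmb X l) ⟶ hom Thickened.pt X where
  app _ := ↾fun σ => Quot.mk _ ⟨X.dim + l, l, Nat.zero_add _, σ⟩
  naturality _ _ _ := rfl

theorem toHom_thicken {l : ℕ} {n : SimplexCategoryᵒᵖ} (σ : (sing (CubeEmb X l)).obj n) :
    (toHom X (l + 1)).app n ((sing.map StageEmb.thicken StageEmb.continuous_thicken).app n σ) =
      (toHom X l).app n σ :=
  (Quot.sound (r := HomRep.Step (X := Thickened.pt) (Y := X) (n := n))
    (a := ⟨X.dim + l, l, Nat.zero_add _, σ⟩) rfl).symm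

/-- A representative of a simplex of the mapping space, as a simplex of a stage. -/
def ofHomRep {n : SimplexCategoryᵒᵖ} (r : HomRep Thickened.pt X n) :
    Σ l, (sing (CubeEmb X l)).obj n :=
  -- The dimension equation forces `r.k = X.dim + r.l`, so `l` alone indexes the stages.
  ⟨r.l, cast (by rw [(Nat.zero_add r.k).symm.trans r.dim_eq]; rfl) r.σ⟩

theorem seqStep_ofHomRep {n : SimplexCategoryᵒᵖ} {r r' : HomRep Thickened.pt X n}
    (h : HomRep.Step r r') : SeqStep (A := fun l => (sing (CubeEmb X l)).obj n)
      (fun _ => (sing.map StageEmb.thicken StageEmb.continuous_thicken).app n)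
      (ofHomRep r) (ofHomRep r') := by
  obtain rfl := h
  obtain ⟨k, l, h, σ⟩ := r
  obtain rfl : k = X.dim + l := (Nat.zero_add k).symm.trans h
  rfl

/-- `ofHomRep` turns the quotient into a sequential colimit whose transition maps are injective,
because a thickened embedding determines the original on the slice over the origin. -/
theorem toHom_injective (l : ℕ) (n : SimplexCategoryᵒᵖ) :
    Function.Injective ((toHom X l).app n) := by
  intro σ τ h
  refine SeqStep.mk_injective (A := fun l => (sing (CubeEmb X l)).obj n)
    (s := fun _ => (sing.map StageEmb.thicken StageEmb.continuous_thicken).app n) ?_ l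
    (congrArg (Quot.map ofHomRep fun _ _ => seqStep_ofHomRep) h)
  intro i σ τ h
  exact sing.ext fun t => Emb.thicken_injective (congrArg (fun ρ => sing.equiv ρ t) h)

theorem exists_toHom_eq {n : SimplexCategoryᵒᵖ} (x : (hom Thickened.pt X).obj n) :
    ∃ l, x ∈ Set.range ((toHom X l).app n) := by
  induction x using Quot.ind with | mk r =>
  obtain ⟨k, l, h, σ⟩ := r
  obtain rfl : k = X.dim + l := (Nat.zero_add k).symm.trans h
  exact ⟨l, σ, rfl⟩

theorem range_toHom_mono (n : SimplexCategoryᵒᵖ) :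
    Monotone fun l => Set.range ((toHom X l).app n) := by
  refine monotone_nat_of_le_succ fun l => ?_
  rintro _ ⟨σ, rfl⟩
  exact ⟨_, toHom_thicken σ⟩

/-- A map from a finite simplicial set to the mapping space factors through all large stages. -/
theorem exists_comp_toHom_eq {K : SSet.{0}} [K.Finite] (α : K ⟶ hom Thickened.pt X) :
    ∃ l₀, ∀ l ≥ l₀, ∃ α' : K ⟶ sing (CubeEmb X l), α' ≫ toHom X l = α := by
  choose f hf using fun x : K.N => exists_toHom_eq (α.app _ x.simplex)
  obtain ⟨l₀, hl₀⟩ := (Set.finite_range f).bddAbove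
  refine ⟨l₀, fun l hl => ?_⟩
  -- A subcomplex containing all nondegenerate simplices is everything, and there are only finitely
  -- many of them to accommodate. Injectivity of the stage then makes the chosen lifts simplicial.
  have htop : (Subcomplex.range (toHom X l)).preimage α = ⊤ := by
    rw [Subcomplex.eq_top_iff_contains_nonDegenerate]
    intro n x hx
    exact range_toHom_mono _ ((hl₀ ⟨N.mk x hx, rfl⟩).trans hl) (hf (N.mk x hx))
  have h : ∀ n (x : K.obj n), ∃ σ, (toHom X l).app n σ = α.app n x := fun n x => by
    have : x ∈ ((Subcomplex.range (toHom X l)).preimage α).obj n := by rw [htop]; trivial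
    exact this
  choose g hg using h
  refine ⟨⟨fun n => ↾(g n), fun m n θ => ?_⟩, ?_⟩
  · ext x
    refine toHom_injective l n ((hg n _).trans ?_)
    refine (NatTrans.naturality_apply α θ x).trans ?_
    refine (congrArg _ (hg m x).symm).trans ?_
    exact (NatTrans.naturality_apply (toHom X l) θ (g m x)).symm
  · ext n x
    exact hg n x

end CubeEmb

/-- A horn is finite, so it maps to a single stage, and it is filled there in a singular complex. -/
theorem kanComplex_hom (X : Thickened) : KanComplex (hom Thickened.pt X) := by
  refine kanComplex_of_horn fun n i φ => ?_
  obtain ⟨l, hl⟩ := CubeEmb.exists_comp_toHom_eq φ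
  obtain ⟨φ', hφ'⟩ := hl l le_rfl
  have := kanComplex_sing (CubeEmb X l)
  obtain ⟨ψ, hψ⟩ := KanComplex.hornFilling φ'
  exact ⟨ψ ≫ CubeEmb.toHom X l, by rw [← Category.assoc, ← hψ, hφ']⟩

namespace Fr

/-- The stable frame of the point. -/
def basepoint : Fr Thickened.pt := mk 0 Frame.ofPoint

/-- The base frame can be represented at whatever stage an embedding starts from, which makes
`ofHom_toHom` computable without further stabilization. -/
theorem mk_std (k : ℕ) : mk (X := Thickened.pt) k (Frame.std k) = basepoint := by
  induction k with
  | zero => rfl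
  | succ k ih => exact (mk_stabilize (X := Thickened.pt) (i := k) _).trans ih

/-- The constant family at the frame of the point, paired with a family of embeddings. -/
def basepointPair {n : SimplexCategoryᵒᵖ} (y : (hom Thickened.pt X).obj n) :
    (sing (Fr Thickened.pt) ⊗ hom Thickened.pt X).obj n :=
  ((sing.equiv (n := n)).symm (ContinuousMap.const _ basepoint), y)

/-- The derivative at the origin. -/
def ofHom (X : Thickened) : hom Thickened.pt X ⟶ sing (Fr X) where
  app n := ↾fun y => (act Thickened.pt X).app n (basepointPair y)
  naturality _ _ _ := by
    ext y
    induction y using Quot.ind with | mk r =>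
    rfl

/-- This is the functoriality `map_compStage`, evaluated at the base frame. -/
theorem ofHom_act (X Y : Thickened) :
    (ofHom X ▷ hom X Y) ≫ act X Y = eComp SSet.{0} Thickened.pt X Y ≫ ofHom Y := by
  ext n ⟨y, z⟩
  induction y using Quot.ind with | mk r =>
  induction z using Quot.ind with | mk s =>
  exact sing.ext fun t => (map_compStage r.dim_eq s.dim_eq (sing.equiv s.σ t) (sing.equiv r.σ t)
    basepoint).symm

/-- The frame at the image of the origin. -/
def ofCubeEmb {l : ℕ} (f : CubeEmb X l) : StageFrame X.mfd l :=
  Frame.push (Nat.zero_add _) f (Frame.std (X.dim + l))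

theorem ofHom_toHom {l : ℕ} {n : SimplexCategoryᵒᵖ} (σ : (sing (CubeEmb X l)).obj n) (t) :
    sing.equiv ((ofHom X).app n ((CubeEmb.toHom X l).app n σ)) t = mk l (ofCubeEmb (sing.equiv σ t)) := by
  change map (X := Thickened.pt) (Nat.zero_add _) (sing.equiv σ t) basepoint = _
  rw [← mk_std (X.dim + l)]
  exact map_mk (X := Thickened.pt) _ (sing.equiv σ t) 0 _

end Fr

end stages

/-! ### The comparison with interior frames is a trivial fibration. -/

section
open SSet Simplicial TopSimplex modelCategoryQuillen

theorem isInteriorPoint_origin : interval.I.IsInteriorPoint Frame.origin := by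
  have h := isInteriorPoint_squeezeEmb one_ne_zero Frame.origin
  rwa [squeezeEmb_origin] at h

namespace Fr
variable {X : Thickened}

/-- The frames at interior points. -/
def IsInterior : Fr X → Prop :=
  Quot.lift (fun r : FrRep X => (X.mfd.thick r.1).I.IsInteriorPoint r.2.pt) (by
    rintro ⟨i, z⟩ _ rfl
    -- Interiors of products are products of interiors, and the origin is interior to `[-1,1]`;
    -- stabilizing neither creates nor destroys interior points.
    refine propext ⟨fun h => isInteriorPoint_prod h isInteriorPoint_origin, fun h => ?_⟩
    have h1 := ModelWithCorners.interior_prod (I := (X.mfd.thick i).I) (J := interval.I)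
      (M := (X.mfd.thick i).M) (N := interval.M)
    have h2 : (z.pt, Frame.origin) ∈ (X.mfd.thick i).I.interior _ ×ˢ interval.I.interior _ :=
      h1 ▸ h
    exact h2.1)

/-- The space of the frames at interior points. -/
abbrev Interior (X : Thickened) : Type := {x : Fr X // x.IsInterior}

theorem isInterior_ofHom {n : SimplexCategoryᵒᵖ} (y : (hom Thickened.pt X).obj n) (t) :
    (sing.equiv ((ofHom X).app n y) t).IsInterior := by
  obtain ⟨l, σ, rfl⟩ := CubeEmb.exists_toHom_eq y
  rw [ofHom_toHom]
  refine Emb.isInteriorPoint (sing.equiv σ t) ?_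
  rw [Frame.std_pt]
  exact isInteriorPoint_cubeMap_zero _

/-- The derivative at the origin is a frame at an interior point. -/
def ofHomInterior (X : Thickened) : hom Thickened.pt X ⟶ sing (Interior X) where
  app n := ↾fun y => (sing.equiv (n := n)).symm
    ⟨fun t => ⟨sing.equiv ((ofHom X).app n y) t, isInterior_ofHom y t⟩,
      (sing.equiv ((ofHom X).app n y)).continuous.subtype_mk _⟩
  naturality _ _ _ := by
    ext y
    induction y using Quot.ind with | mk r =>
    rfl

theorem continuous_ofCubeEmb (l : ℕ) : Continuous (ofCubeEmb : CubeEmb X l → _) :=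
  (Frame.continuous_push _).comp (continuous_id.prodMk continuous_const)

/-- A family of embeddings of the cube over the boundary of a simplex with a given family of frames
over the simplex extends to the simplex. -/
theorem exists_boundary_lift {l n : ℕ} (α : (∂Δ[n] : SSet.{0}) ⟶ sing (CubeEmb X l))
    (B : C(TopSimplex n, StageFrame X.mfd l))
    (hB : ∀ x, (X.mfd.thick l).I.IsInteriorPoint (B x).pt)
    (h : ∀ (m : ℕ) (u : Fin (m + 1) →o Fin (n + 1))
      (hu : stdSimplex.objMk (m := op ⦋m⦌) u ∈ ∂Δ[n].obj _) (y : TopSimplex m),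
      ofCubeEmb (val α u hu y) = B (stdSimplex.map u y)) :
    ∃ g : C(TopSimplex n, CubeEmb X l), (∀ x, ofCubeEmb (g x) = B x) ∧
      ∂Δ[n].ι ≫ SSet.yonedaEquiv.symm (sing.equiv (n := op ⦋n⦌).symm g) = α := by
  classical
  obtain ⟨F, hF⟩ := exists_glue (R := fun S => ∃ j, j ∉ S)
    (fun S T hST ⟨j, hj⟩ => ⟨j, fun h => hj (hST h)⟩) boundary_mem_iff α
  obtain ⟨N, r, hN, hcl, hBN, hr, hr', hrB⟩ := exists_boundary_retraction n
  have hU : ∀ x, ∃ U, B x ∈ U ∧ IsLocallyLiftable (ofCubeEmb : CubeEmb X l → _) U := fun x =>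
    Frame.exists_isLocallyLiftable (Nat.zero_add _) (B x) (hB x)
  -- An arbitrary value for the lift off the boundary, which is never looked at.
  obtain ⟨e₀⟩ : Nonempty (CubeEmb X l) := by
    obtain ⟨U, -, hU⟩ := hU (Classical.arbitrary _)
    obtain ⟨e, -⟩ := hU.nonempty
    exact ⟨e⟩
  let f : TopSimplex n → CubeEmb X l := fun x =>
    if hx : ∃ j, j ∉ supp x then F ⟨x, hx⟩ else e₀
  have hf : ∀ x (hx : ∃ j, j ∉ supp x), f x = F ⟨x, hx⟩ := fun x hx => dif_pos hx
  have hfc : ContinuousOn f (Set.ofPred fun x => ∃ j, j ∉ supp x) := by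
    rw [continuousOn_iff_continuous_domRestrict]
    exact F.continuous.congr fun x => (hf x.1 x.2).symm
  have hpf : ∀ x (hx : ∃ j, j ∉ supp x), ofCubeEmb (f x) = B x := by
    intro x hx
    have h1 := map_collapse (supp_nonempty x) subset_rfl
    have hu : stdSimplex.objMk (m := op ⦋n⦌) (collapse (supp x) (supp_nonempty x)) ∈
        ∂Δ[n].obj _ := by
      rw [boundary_mem_iff]
      obtain ⟨j, hj⟩ := hx
      refine ⟨j, fun h => hj ?_⟩
      obtain ⟨k, -, rfl⟩ := Finset.mem_image.1 h
      exact collapse_mem _ _ k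
    obtain ⟨h2, h3⟩ := hF n _ hu x
    have h4 := h n _ hu x
    rw [h1] at h4
    rw [hf x hx, ← h4, ← h3]
    exact congrArg (fun y => ofCubeEmb (F y)) (Subtype.ext h1.symm)
  obtain ⟨g, hg, hgB, hgf⟩ := exists_lift (continuous_ofCubeEmb l) B.continuous hU hcl hN hBN hr hr'
    hrB hfc hpf
  refine ⟨⟨g, hg⟩, hgB, comp_yonedaEquiv_symm α _ fun m u hu y => ?_⟩
  obtain ⟨h2, h3⟩ := hF m u hu y
  rw [← h3]
  exact (hgf h2).trans (hf _ h2)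

/-- The boundary data and the family of frames both factor through finite stages, and the larger of
the two serves for both. There `exists_boundary_lift` solves the problem, and its solution is sent
back to the colimit. -/
theorem hasLiftingProperty_ofHomInterior (X : Thickened) (n : ℕ) :
    HasLiftingProperty (∂Δ[n] : (Δ[n] : SSet.{0}).Subcomplex).ι (ofHomInterior X) := by
  refine ⟨fun {α β} sq => ?_⟩
  let b : C(TopSimplex n, Interior X) := sing.equiv (n := op ⦋n⦌) (SSet.yonedaEquiv β)
  obtain ⟨l₁, h₁⟩ := CubeEmb.exists_comp_toHom_eq α
  obtain ⟨l₂, h₂⟩ := exists_factor (⟨fun x => (b x).1, continuous_subtype_val.comp b.continuous⟩ :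
    C(TopSimplex n, Fr X))
  obtain ⟨α', hα'⟩ := h₁ (max l₁ l₂) (le_max_left _ _)
  obtain ⟨B, hB⟩ := h₂ (max l₁ l₂) (le_max_right _ _)
  have hβ : ∀ (m : ℕ) (u : Fin (m + 1) →o Fin (n + 1)) (y : TopSimplex m),
      sing.equiv (β.app (op ⦋m⦌) (stdSimplex.objMk u)) y = b (stdSimplex.map u y) := by
    intro m u y
    have h : β = SSet.yonedaEquiv.symm ((sing.equiv (n := op ⦋n⦌)).symm b) := by simp [b]
    rw [h]
    rfl
  have hB' : ∀ x, (X.mfd.thick (max l₁ l₂)).I.IsInteriorPoint (B x).pt := by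
    intro x
    have : (mk _ (B x)).IsInterior := by rw [hB]; exact (b x).2
    exact this
  have hα : ∀ (m : ℕ) (u : Fin (m + 1) →o Fin (n + 1))
      (hu : stdSimplex.objMk (m := op ⦋m⦌) u ∈ ∂Δ[n].obj _) (y : TopSimplex m),
      ofCubeEmb (val α' u hu y) = B (stdSimplex.map u y) := by
    intro m u hu y
    -- The square commutes only after passing to stable frames; injectivity of the stage into `Fr X`
    -- makes it commute at the stage itself.
    refine (isClosedEmbedding_mk _).injective ((ofHom_toHom (n := op ⦋m⦌) _ y).symm.trans ?_)
    rw [hB]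
    refine Eq.trans ?_ (congrArg Subtype.val (hβ m u y))
    have h1 := congrArg (fun f => sing.equiv (f.app (op ⦋m⦌) ⟨stdSimplex.objMk u, hu⟩) y) sq.w
    refine Eq.trans ?_ (congrArg Subtype.val h1)
    rw [← hα']
    rfl
  obtain ⟨g, hg, hgα⟩ := exists_boundary_lift α' B hB' hα
  refine ⟨⟨⟨SSet.yonedaEquiv.symm (sing.equiv (n := op ⦋n⦌).symm g) ≫ CubeEmb.toHom X _, ?_, ?_⟩⟩⟩
  · rw [← Category.assoc, hgα, hα']
  · ext ⟨⟨m⟩⟩ x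
    obtain ⟨u, rfl⟩ := stdSimplex.objMk_bijective.2 x
    refine sing.ext fun y => Subtype.ext ?_
    refine (ofHom_toHom (n := op ⦋m⦌) _ y).trans ?_
    refine Eq.trans ?_ (congrArg Subtype.val (hβ m u y)).symm
    refine Eq.trans ?_ (hB _)
    exact congrArg (mk _) (hg _)

theorem rlp_ofHomInterior (X : Thickened) :
    (MorphismProperty.monomorphisms SSet.{0}).rlp (ofHomInterior X) := by
  rw [rlp_monomorphisms]
  have h := hasLiftingProperty_ofHomInterior X
  rintro _ _ _ ⟨n⟩
  exact h n

end Fr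

end

/-! ### Lifting homotopies along trivial fibrations. -/

section
open SSet Simplicial

/-- The disjoint union of two copies of a simplicial set. -/
def double (A : SSet.{0}) : SSet.{0} where
  obj n := A.obj n ⊕ A.obj n
  map θ := ↾(Sum.map (A.map θ) (A.map θ))
  map_id n := by
    ext x
    rcases x with x | x
    · exact congrArg Sum.inl (congrArg (fun f => f x) (A.map_id n))
    · exact congrArg Sum.inr (congrArg (fun f => f x) (A.map_id n))
  map_comp θ ψ := by
    ext x
    rcases x with x | x
    · exact congrArg Sum.inl (congrArg (fun f => f x) (A.map_comp θ ψ))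
    · exact congrArg Sum.inr (congrArg (fun f => f x) (A.map_comp θ ψ))

namespace double
variable {A B C : SSet.{0}}

/-- The map given by two maps. -/
def desc (u v : A ⟶ B) : double A ⟶ B where
  app n := ↾(Sum.elim (u.app n) (v.app n))
  naturality n m θ := by
    ext x
    rcases x with x | x
    · exact NatTrans.naturality_apply u θ x
    · exact NatTrans.naturality_apply v θ x

theorem desc_comp (u v : A ⟶ B) (w : B ⟶ C) : desc u v ≫ w = desc (u ≫ w) (v ≫ w) := by
  ext n x
  rcases x with x | x <;> rfl

theorem eq_of_desc_eq {u v u' v' : A ⟶ B} (h : desc u v = desc u' v') : u = u' ∧ v = v' := by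
  constructor
  · ext n x
    exact congrArg (fun f => f.app n (Sum.inl x)) h
  · ext n x
    exact congrArg (fun f => f.app n (Sum.inr x)) h

/-- The two ends of the cylinder are disjoint, being distinguished by their component in `Δ[1]`.
Lifting along their joint inclusion is what lifts a homotopy with both ends prescribed. -/
instance mono_desc_ι : Mono (desc (ι₀ : A ⟶ A ⊗ Δ[1]) ι₁) := by
  have : ∀ n, Mono ((desc (ι₀ : A ⟶ A ⊗ Δ[1]) ι₁).app n) := by
    rintro ⟨⟨n⟩⟩
    rw [mono_iff_injective]
    have h01 : ∀ x y : A.obj (op ⦋n⦌), (ι₀ : A ⟶ A ⊗ Δ[1]).app _ x ≠ (ι₁ : A ⟶ A ⊗ Δ[1]).app _ y := by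
      intro x y h
      have h1 := congrArg (fun p : (A ⊗ Δ[1] : SSet.{0}) _⦋n⦌ => p.2 0) h
      exact zero_ne_one (α := Fin 2) h1
    rintro (x | x) (y | y) h
    · exact congrArg Sum.inl (congrArg Prod.fst h)
    · exact absurd h (h01 x y)
    · exact absurd h.symm (h01 y x)
    · exact congrArg Sum.inr (congrArg Prod.fst h)
  exact NatTrans.mono_of_mono_app _

end double

/-- A map with the right lifting property for all monomorphisms has a section. -/
theorem exists_section {A B : SSet.{0}} {φ : A ⟶ B}
    (hφ : (MorphismProperty.monomorphisms SSet.{0}).rlp φ) : ∃ σ : B ⟶ A, σ ≫ φ = 𝟙 B := by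
  have : HasLiftingProperty (⊥ : B.Subcomplex).ι φ := hφ _ (inferInstanceAs (Mono _))
  have sq : CommSq (Subcomplex.isInitialBot.to A) (⊥ : B.Subcomplex).ι φ (𝟙 B) :=
    ⟨Subcomplex.isInitialBot.hom_ext _ _⟩
  exact ⟨sq.lift, sq.fac_right⟩

/-- Homotopies lift along a map with the right lifting property for all monomorphisms. -/
theorem nonempty_homotopy_of_comp {A B C : SSet.{0}} {φ : A ⟶ B}
    (hφ : (MorphismProperty.monomorphisms SSet.{0}).rlp φ) {u v : C ⟶ A}
    (H : SSet.Homotopy (u ≫ φ) (v ≫ φ)) : Nonempty (SSet.Homotopy u v) := by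
  have : HasLiftingProperty (double.desc (ι₀ : C ⟶ C ⊗ Δ[1]) ι₁) φ :=
    hφ _ (inferInstanceAs (Mono _))
  have sq : CommSq (double.desc u v) (double.desc (ι₀ : C ⟶ C ⊗ Δ[1]) ι₁) φ H.h :=
    ⟨by rw [double.desc_comp, double.desc_comp, H.h₀, H.h₁]⟩
  obtain ⟨h₀, h₁⟩ := double.eq_of_desc_eq ((double.desc_comp _ _ _).symm.trans sq.fac_left)
  -- The homotopy is relative to the empty subcomplex, so the last field is vacuous.
  exact ⟨{ h := sq.lift, h₀ := h₀, h₁ := h₁, rel := by ext _ ⟨⟨_, ⟨⟩⟩, _⟩ }⟩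

/-- A homotopy of continuous maps gives a homotopy of maps of singular complexes. -/
theorem nonempty_homotopy_sing {Z W : Type} [TopologicalSpace Z] [TopologicalSpace W]
    (H : C(unitInterval × Z, W)) {f g : Z → W} (hf : Continuous f) (hg : Continuous g)
    (h₀ : ∀ z, H (0, z) = f z) (h₁ : ∀ z, H (1, z) = g z) :
    Nonempty (SSet.Homotopy (sing.map f hf) (sing.map g hg)) :=
  ⟨TopCat.Homotopy.toSSet (f := TopCat.ofHom ⟨f, hf⟩) (g := TopCat.ofHom ⟨g, hg⟩)
    ⟨H, h₀, h₁⟩⟩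

/-- If a space can be pushed into a subspace, and a simplicial set maps to the singular complex of
the subspace by a map with the right lifting property for all monomorphisms, then it is homotopy
equivalent to the singular complex of the space. -/
theorem isHomotopyEquiv_of_rlp {A : SSet.{0}} {Z : Type} [TopologicalSpace Z] {P : Z → Prop}
    {φ : A ⟶ sing {z // P z}} (hφ : (MorphismProperty.monomorphisms SSet.{0}).rlp φ)
    (H : C(unitInterval × Z, Z)) (h₀ : ∀ z, P (H (0, z))) (h₁ : ∀ z, H (1, z) = z)
    (hP : ∀ t z, P z → P (H (t, z))) :
    IsHomotopyEquiv (φ ≫ sing.map Subtype.val continuous_subtype_val) := by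
  obtain ⟨σ, hσ⟩ := exists_section hφ
  have hρ : Continuous fun z => (⟨H (0, z), h₀ z⟩ : {z // P z}) :=
    (H.continuous.comp (continuous_const.prodMk continuous_id)).subtype_mk _
  -- The inverse pushes into the subspace and then applies the section. One composite is homotopic
  -- to the identity by `H` itself; for the other, the restriction of `H` to the subspace gives a
  -- homotopy after composing with `φ`, which then lifts.
  refine ⟨sing.map _ hρ ≫ σ, ?_, ?_⟩
  · obtain ⟨K⟩ := nonempty_homotopy_sing (Z := {z // P z}) (W := {z // P z})
      ⟨fun p => ⟨H (p.1, p.2.1), hP _ _ p.2.2⟩, (H.continuous.comp (continuous_fst.prodMk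
        (continuous_subtype_val.comp continuous_snd))).subtype_mk _⟩
      (hρ.comp continuous_subtype_val) continuous_id (fun z => rfl) fun z => Subtype.ext (h₁ z)
    refine nonempty_homotopy_of_comp hφ ?_
    have e₀ : ((φ ≫ sing.map Subtype.val continuous_subtype_val) ≫ sing.map _ hρ ≫ σ) ≫ φ =
        φ ≫ sing.map _ (hρ.comp continuous_subtype_val) := by
      simp only [Category.assoc, hσ, Category.comp_id]
      rfl
    rw [e₀]
    exact { h := (φ ▷ Δ[1]) ≫ K.h
            h₀ := by
              refine (ι₀_comp_assoc φ K.h).trans ?_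
              exact congrArg (φ ≫ ·) K.h₀
            h₁ := by
              refine (ι₁_comp_assoc φ K.h).trans ?_
              exact congrArg (φ ≫ ·) K.h₁
            rel := by ext _ ⟨⟨_, ⟨⟩⟩, _⟩ }
  · have e : (sing.map _ hρ ≫ σ) ≫ φ ≫ sing.map Subtype.val continuous_subtype_val =
        sing.map (fun z => H (0, z)) (continuous_subtype_val.comp hρ) := by
      rw [Category.assoc, ← Category.assoc σ φ, hσ, Category.id_comp]
      rfl
    rw [e]
    exact nonempty_homotopy_sing H _ continuous_id (fun z => rfl) h₁

end

/-! ### Pushing stable frames into the interior, and the conclusion. -/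

namespace Fr
variable {X : Thickened}

/-- The push of `X`, times the squeeze of the cube. -/
def pushStage (h : ℝ → Emb X.mfd.toSmoothMfd X.mfd.toSmoothMfd) (s : ℝ) :
    (l : ℕ) → StageEmb X.mfd X.mfd l l
  | 0 => h s
  | l + 1 => (pushStage h s l).prodMap (squeezeEmb s)

theorem continuous_pushStage {h : ℝ → Emb X.mfd.toSmoothMfd X.mfd.toSmoothMfd} (hh : Continuous h)
    (l : ℕ) : Continuous fun s => pushStage h s l := by
  induction l with
  | zero => exact hh
  | succ l ih => exact Emb.continuous_prodMap.comp (ih.prodMk continuous_squeezeEmb)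

theorem pushStage_zero {h : ℝ → Emb X.mfd.toSmoothMfd X.mfd.toSmoothMfd} (h0 : h 0 = Emb.id _)
    (l : ℕ) : pushStage h 0 l = Emb.id _ := by
  induction l with
  | zero => exact h0
  | succ l ih =>
    change (pushStage h 0 l).prodMap (squeezeEmb 0) = _
    rw [ih, squeezeEmb_zero]; rfl

theorem isInteriorPoint_pushStage {h : ℝ → Emb X.mfd.toSmoothMfd X.mfd.toSmoothMfd} {s : ℝ}
    (hs : s ≠ 0) (hi : ∀ x, X.mfd.I.IsInteriorPoint ((h s).toFun x)) (l : ℕ) (x) :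
    (X.mfd.thick l).I.IsInteriorPoint ((pushStage h s l).toFun x) := by
  induction l with
  | zero => exact hi x
  | succ l ih => exact isInteriorPoint_prod (ih x.1) (isInteriorPoint_squeezeEmb hs x.2)

/-- The induced map of the stable frame bundle. -/
def pushInterior (h : ℝ → Emb X.mfd.toSmoothMfd X.mfd.toSmoothMfd) (s : ℝ) : Fr X → Fr X :=
  Quot.lift (fun r : FrRep X => mk r.1 (StageFrame.push rfl (pushStage h s r.1) r.2)) (by
    rintro ⟨i, z⟩ _ rfl
    refine (mk_stabilize (i := i) _).symm.trans (congrArg (mk (i + 1)) ?_)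
    -- The squeezes agree with the identity to first order at the origin, so the pushes at
    -- successive stages are compatible.
    exact (Frame.push_prodMap_stabilize rfl (pushStage h s i) (squeezeEmb s) (squeezeEmb_origin s)
      (D_squeezeEmb_origin s) z).symm)

/-- `Fr X` is a quotient of a disjoint union of stages, and local compactness of `ℝ` allows joint
continuity to be checked there by currying the parameter. -/
theorem continuous_pushInterior {h : ℝ → Emb X.mfd.toSmoothMfd X.mfd.toSmoothMfd}
    (hh : Continuous h) : Continuous fun p : ℝ × Fr X => pushInterior h p.1 p.2 := by
  have hG (i : ℕ) : Continuous fun p : StageFrame X.mfd i × ℝ =>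
      mk (X := X) i (StageFrame.push rfl (pushStage h p.2 i) p.1) :=
    (continuous_mk i).comp <| (Frame.continuous_push rfl).comp <|
      ((continuous_pushStage hh i).comp continuous_snd).prodMk continuous_fst
  have hq : Continuous fun p : FrRep X × ℝ => pushInterior h p.2 (Quot.mk _ p.1) :=
    ContinuousMap.continuous_uncurry_of_continuous
      (⟨fun r : FrRep X => ContinuousMap.curry ⟨_, hG r.1⟩ r.2,
        continuous_sigma fun i => (ContinuousMap.curry ⟨_, hG i⟩).continuous⟩ :
        C(FrRep X, C(ℝ, Fr X)))
  exact (isQuotientMap_quot_mk (X := FrRep X)).continuous_lift_prod_right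
    (g := fun p : ℝ × Fr X => pushInterior h p.1 p.2) (hq.comp continuous_swap)

theorem pushInterior_zero {h : ℝ → Emb X.mfd.toSmoothMfd X.mfd.toSmoothMfd} (h0 : h 0 = Emb.id _)
    (x : Fr X) : pushInterior h 0 x = x := by
  induction x using Quot.ind with | mk r =>
  obtain ⟨i, z⟩ := r
  change mk i (StageFrame.push rfl (pushStage h 0 i) z) = mk i z
  rw [pushStage_zero h0]
  exact congrArg (mk i) (Frame.push_id z)

theorem isInterior_pushInterior {h : ℝ → Emb X.mfd.toSmoothMfd X.mfd.toSmoothMfd} {s : ℝ}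
    (hs : s ≠ 0) (hi : ∀ x, X.mfd.I.IsInteriorPoint ((h s).toFun x)) (x : Fr X) :
    (pushInterior h s x).IsInterior := by
  induction x using Quot.ind with | mk r =>
  exact isInteriorPoint_pushStage hs hi r.1 r.2.pt

/-- The isotopy of `exists_push` supplies the deformation required by `isHomotopyEquiv_of_rlp`. It
runs backwards, as `1 - t`, because that lemma expects the push at time `0` and the identity at time
`1`. -/
theorem isHomotopyEquiv_ofHom (X : Thickened) : IsHomotopyEquiv (ofHom X) := by
  obtain ⟨h, hh, h0, hi⟩ := exists_push X.mfd
  refine isHomotopyEquiv_of_rlp (rlp_ofHomInterior X)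
    ⟨fun p => pushInterior h (1 - p.1) p.2, (continuous_pushInterior hh).comp
      ((continuous_const.sub (continuous_subtype_val.comp continuous_fst)).prodMk continuous_snd)⟩
    (fun z => ?_) (fun z => ?_) fun t z hz => ?_
  · have : (1 - ((0 : unitInterval) : ℝ)) ≠ 0 := by simp
    exact isInterior_pushInterior this (hi _ this) z
  · change pushInterior h (1 - ((1 : unitInterval) : ℝ)) z = z
    have : (1 - ((1 : unitInterval) : ℝ)) = 0 := by simp
    rw [this, pushInterior_zero h0]
  · by_cases ht : 1 - (t : ℝ) = 0
    · change (pushInterior h (1 - (t : ℝ)) z).IsInterior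
      rw [ht, pushInterior_zero h0]; exact hz
    · exact isInterior_pushInterior ht (hi _ ht) z

end Fr

end ThickMfd

end

theorem mainTheorem7 :
    (∀ X : ThickMfd.Thickened,
      SSet.KanComplex (ThickMfd.Thickened.pt ⟶[SSet.{0}] X) ∧
      SSet.KanComplex (ThickMfd.sing (ThickMfd.Fr X))) ∧
    ∃ Φ : ∀ X : ThickMfd.Thickened,
        (ThickMfd.Thickened.pt ⟶[SSet.{0}] X) ⟶ ThickMfd.sing (ThickMfd.Fr X),
      (∀ X Y : ThickMfd.Thickened,
        (Φ X ▷ (X ⟶[SSet.{0}] Y)) ≫ ThickMfd.Fr.act X Y =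
          eComp SSet.{0} ThickMfd.Thickened.pt X Y ≫ Φ Y) ∧
      ∀ X : ThickMfd.Thickened, ThickMfd.IsHomotopyEquiv (Φ X) :=
  ⟨fun X => ⟨ThickMfd.kanComplex_hom X, ThickMfd.kanComplex_sing (ThickMfd.Fr X)⟩,
    ThickMfd.Fr.ofHom, ThickMfd.Fr.ofHom_act, ThickMfd.Fr.isHomotopyEquiv_ofHom⟩
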